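/- **Setting.** Let $S$ be a scheme and let $Sch/S$ be the category of separated schemes of finite type over $S$; write $\pi_X:X\to S$ for the structure morphism. "Smooth of constant relative dimension $d$" is written $\dim f=d$. Let $\mathbb L_*$ be the Lazard ring, $F_{\mathbb L}(u,v)=\sum a_{ij}u^iv^j$ the universal (commutative, one-dimensional) formal group law, $\deg a_{ij}=i+j-1$. **Construction.** A *cobordism cycle* over $X\in Sch/S$ is $(h:V\to X;L_1,\dots,L_r)$, $r\ge 0$, with $V\in Sch/S$, $h$ a proper $S$-morphism, $V\to S$ smooth of constant relative dimension, and $L_i$ line bundles on $V$. Two cycles are isomorphic if there is an isomorphism of their sources over $X$ under which the line bundles correspond up to isomorphism and order. 1. $\mathcal Z^*(X\to S)$ is the free abelian group on isomorphism classes $[V\xrightarrow{h}X;L_1,\dots,L_r]$, modulo $[V]=[V_1]+[V_2]$ whenever $V=V_1\sqcup V_2$ (with $h$ and the $L_i$ restricted to $V_1$, $V_2$). The cycle has degree $r-\dim(V/S)$. 2. $\langle\mathcal R^{Dim}\rangle\subset\mathcal Z^*(X\to S)$ is generated by the $[V\xrightarrow{h}X;\pi^*L_1,\dots,\pi^*L_r,M_1,\dots,M_s]$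 for which $V\to S$ factors as $V\xrightarrow{\pi}S'\xrightarrow{\nu}S$ with $S'\in Sch/S$, $\pi$ smooth, $\nu$ smooth of constant relative dimension, and $r>\dim\nu$. 3. $\langle\mathcal R^{Sect}\rangle\subset\mathcal Z^*/\langle\mathcal R^{Dim}\rangle$ is generated by the $[V\xrightarrow{h}X;L_1,\dots,L_r]-[Z\xrightarrow{h\circ i}X;i^*L_1,\dots,i^*L_{r-1}]$ with $r>0$, where $i:Z\to V$ is the zero scheme of a section of $L_r$ that is fibrewise (over $S$) transverse to the zero section, i.e. $Z$ is empty or smooth over $S$ of relative dimension $\dim(V/S)-1$. Let $\underline\Omega^*(X\to S)$ be the quotient of $\mathcal Z^*/\langle\mathcal R^{Dim}\rangle$ by $\langle\mathcal R^{Sect}\rangle$. 4. $\langle\mathbb L_*\mathcal R^{FGL}\rangle\subset\mathbb L_*\otimes_{\mathbb Z}\underline\Omega^*(X\to S)$ is the $\mathbb L_*$-submodule generated by the $[V\to X;L_1,\dots,L_r,F_{\mathbb L}(L,M)]-1\otimes[V\to X;L_1,\dots,L_r,L\otimes M]$ for line bundles $L_1,\dots,L_r,L,M$ on $V$, where $[V\to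 X;\underline L,F_{\mathbb L}(L,M)]=\sum a_{ij}\otimes[V\to X;\underline L,L^{i},M^{j}]$ ($L$ repeated $i$ times, $M$ repeated $j$ times); the terms with $i>\dim(V/S)$ or $j>\dim(V/S)$ vanish. Put $\Omega^*(X\to S)=\mathbb L_*\otimes\underline\Omega^*(X\to S)\,/\,\langle\mathbb L_*\mathcal R^{FGL}\rangle$, and let $\Omega^n(X\to S)$ be generated by the classes of $a\otimes[V\to X;L_1,\dots,L_r]$ with $a\in\mathbb L_m$ and $n=r-\dim(V/S)-m$. **Theorem.** (1) For every scheme $S$ the following operations on $\Omega^*$ are well defined: * $f_*(a\otimes[V\xrightarrow{h}X;\underline L])=a\otimes[V\xrightarrow{f\circ h}Y;\underline L]$ for $f:X\to Y$ proper; * $f^*(a\otimes[W\to Y;\underline L])=a\otimes[W\times_YX\to X;pr^*\underline L]$ for $f:X\to Y$ smooth of constant relative dimension; * $\widetilde c_1(L)(a\otimes[V\xrightarrow{h}X;\underline L])=a\otimes[V\xrightarrow{h}X;\underline L,h^*L]$ for a line bundle $L$ on $X$; * $(a\otimes[V\to X;\underline L])\times_S(b\otimes[W\to Y;\underline M])=ab\otimes[V\times_SW\to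 X\times_SY;pr_1^*\underline L,pr_2^*\underline M]$. With these, the unit $1_S=[\mathrm{id}_S:S\to S]$ and $\Phi:\mathbb L_*\to\Omega^*(S\to S)$, $\Phi(a)=a\otimes[\mathrm{id}_S]$, the theory $\Omega^*$ is an oriented Borel–Moore functor with products of geometric type on $Sch/S$. That is: * $\Omega^*(X\to S)=\bigoplus_{n\in\mathbb Z}\Omega^n(X\to S)$. * (D1) $f_*$ preserves degrees, is functorial, and is additive: $\Omega^*(\emptyset\to S)=0$ and $\Omega^*(X\to S)\oplus\Omega^*(Y\to S)\cong\Omega^*(X\sqcup Y\to S)$ by pushforward. (D2) $f^*$ maps $\Omega^i$ to $\Omega^{i-\dim f}$. (D3) $\widetilde c_1(L)$ maps $\Omega^i$ to $\Omega^{i+1}$. (D4) $\times_S$ is biadditive, adds degrees, is commutative and associative, and has unit $1_S\in\Omega^0(S\to S)$ (up to the canonical isomorphisms of fibre products). * (A1) $\mathrm{id}^*=\mathrm{id}$ and $(g\circ f)^*=f^*g^*$. (A2) $g^*f_*=f'_*g'^*$ for a fibre square with $f$ proper, $g$ smooth, and $f'$, $g'$ their base changes. (A3) $f_*\widetilde c_1(f^*M)=\widetilde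 c_1(M)f_*$. (A4) $\widetilde c_1(f^*M)f^*=f^*\widetilde c_1(M)$. (A5) $\widetilde c_1(L)\widetilde c_1(L')=\widetilde c_1(L')\widetilde c_1(L)$, and $\widetilde c_1(L)=\widetilde c_1(L')$ if $L\cong L'$. (A6) $f_*x\times_Sg_*y=(f\times_Sg)_*(x\times_Sy)$. (A7) $f^*x\times_Sg^*y=(f\times_Sg)^*(x\times_Sy)$. (A8) $\widetilde c_1(L)(x)\times_Sy=\widetilde c_1(p_1^*L)(x\times_Sy)$. * $\Phi$ is a unital ring homomorphism for the product of $\Omega^*(S\to S)$ induced by $\times_S$, and $\Phi(\mathbb L_n)\subset\Omega^{-n}(S\to S)$. * For $\pi_X:X\to S$ smooth of constant relative dimension $d$: (rel-Dim) $\widetilde c_1(L_1)\cdots\widetilde c_1(L_n)(\pi_X^*1_S)=0$ if $n>d$. (rel-Sect) $\widetilde c_1(L)(\pi_X^*1_S)=i_*(\pi_Z^*1_S)$ if $i:Z\to X$ is the zero scheme of a fibrewise transverse section of $L$. (rel-FGL) $\sum_{i,j\le d}\Phi(a_{ij})\,\widetilde c_1(L)^i\widetilde c_1(M)^j(\pi_X^*1_S)=\widetilde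 c_1(L\otimes M)(\pi_X^*1_S)$. (2) Let $S=\operatorname{Spec}k$ for a field $k$, and let $\Omega_*(X)$ be Levine–Morel's algebraic cobordism in the description of Gonzalez–Karu: the free abelian group on isomorphism classes of cycles $(h:V\to X;L_1,\dots,L_r)$ with $h$ proper and $V$ a smooth variety (connected), modulo the corresponding relations $\mathcal R^{Dim}$ and $\mathcal R^{Sect}$ (a zero scheme being replaced by the sum of its components), then tensored with $\mathbb L_*$ and divided by the formal group law relations, with $a\otimes[V\to X;L_1,\dots,L_r]$ in degree $\deg a+\dim V-r$. Then for every $X\in Sch/k$ there is an isomorphism of $\mathbb L_*$-modules $\Omega^*(X\to\operatorname{Spec}k)\cong\Omega_*(X)$ which sends $a\otimes[V\to X;\underline L]$ to the sum of its restrictions to the connected components of $V$, and which identifies $\Omega^{-n}(X\to\operatorname{Spec}k)$ with $\Omega_n(X)$ for all $n$. -/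

import Mathlib

open CategoryTheory Limits AlgebraicGeometry
open scoped TensorProduct

universe u v

namespace RelCob

noncomputable section

/-! ## Line bundles -/

/-- Restriction of functions on a scheme to a smaller open subset. -/
abbrev res {X : Scheme.{u}} {U V : X.Opens} (h : V ≤ U) : Γ(X, U) →+* Γ(X, V) :=
  (X.presheaf.map (homOfLE h).op).hom

/-- Pullback of functions along `f : Y ⟶ X`, from an open `U` of `X` to an open of `Y`
which `f` maps into `U`. -/
abbrev pullFun {X Y : Scheme.{u}} (f : Y ⟶ X) {U : X.Opens} {V : Y.Opens} (h : V ≤ f ⁻¹ᵁ U) :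
    Γ(X, U) →+* Γ(Y, V) :=
  (f.appLE U V h).hom

theorem pullFun_res {X Y : Scheme.{u}} (f : Y ⟶ X) {U U' : X.Opens} {V V' : Y.Opens}
    (hU : U' ≤ U) (hV : V' ≤ V) (h : V ≤ f ⁻¹ᵁ U) (h' : V' ≤ f ⁻¹ᵁ U') (a : Γ(X, U)) :
    res hV (pullFun f h a) = pullFun f h' (res hU a) := by
  have h1 := f.appLE_map h (homOfLE hV).op
  have h2 := f.map_appLE h' (homOfLE hU).op
  have := congr($(h1.trans h2.symm) a)
  exact this

theorem preimage_inf_le {X Y : Scheme.{u}} (f : Y ⟶ X) (U V : X.Opens) :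
    f ⁻¹ᵁ U ⊓ f ⁻¹ᵁ V ≤ f ⁻¹ᵁ (U ⊓ V) := le_rfl

theorem res_res {X : Scheme.{u}} {U V W : X.Opens} (h : V ≤ U) (h' : W ≤ V) (a : Γ(X, U)) :
    res h' (res h a) = res (h'.trans h) a := by
  have := X.presheaf.map_comp (homOfLE h).op (homOfLE h').op
  exact congr($(this.symm) a)

/-- A line bundle on a scheme `X`, given by a trivialising open cover `U i` and transition
functions: with `e i` the frame over `U i`, one has `e j = g i j • e i` on `U i ⊓ U j`.
The condition `g i i = 1` follows from `isUnit` and `cocycle`. -/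
structure LineBundle (X : Scheme.{u}) : Type (u + 1) where
  /-- the index set of the trivialising cover -/
  ι : Type u
  /-- the trivialising open sets -/
  U : ι → X.Opens
  covers : ∀ x : X, ∃ i, x ∈ U i
  /-- the transition functions -/
  g : ∀ i j, Γ(X, U i ⊓ U j)
  isUnit : ∀ i j, IsUnit (g i j)
  cocycle : ∀ i j k,
    res (inf_le_left : U i ⊓ U j ⊓ U k ≤ U i ⊓ U j) (g i j) *
      res (le_inf (inf_le_left.trans inf_le_right) inf_le_right : U i ⊓ U j ⊓ U k ≤ U j ⊓ U k)
        (g j k) =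
      res (le_inf (inf_le_left.trans inf_le_left) inf_le_right : U i ⊓ U j ⊓ U k ≤ U i ⊓ U k)
        (g i k)

namespace LineBundle

variable {X Y : Scheme.{u}}

/-- Isomorphism of line bundles. With `e i` the frames of `L` and `e' a` those of `M`, an
isomorphism `M ≅ L` sends `e' a` to `t i a • e i` on the overlap of their domains, for
units `t i a` which are compatible with the transition functions of `L` and of `M`. -/
def Iso (L M : LineBundle X) : Prop :=
  ∃ t : ∀ (i : L.ι) (a : M.ι), Γ(X, L.U i ⊓ M.U a),
    (∀ i a, IsUnit (t i a)) ∧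
    (∀ i j a,
      res (inf_le_left : L.U i ⊓ L.U j ⊓ M.U a ≤ L.U i ⊓ L.U j) (L.g i j) *
        res (le_inf (inf_le_left.trans inf_le_right) inf_le_right :
          L.U i ⊓ L.U j ⊓ M.U a ≤ L.U j ⊓ M.U a) (t j a) =
        res (le_inf (inf_le_left.trans inf_le_left) inf_le_right :
          L.U i ⊓ L.U j ⊓ M.U a ≤ L.U i ⊓ M.U a) (t i a)) ∧
    (∀ i a b,
      res (inf_le_left : L.U i ⊓ M.U a ⊓ M.U b ≤ L.U i ⊓ M.U a) (t i a) *
        res (le_inf (inf_le_left.trans inf_le_right) inf_le_right :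
          L.U i ⊓ M.U a ⊓ M.U b ≤ M.U a ⊓ M.U b) (M.g a b) =
        res (le_inf (inf_le_left.trans inf_le_left) inf_le_right :
          L.U i ⊓ M.U a ⊓ M.U b ≤ L.U i ⊓ M.U b) (t i b))

/-- The pullback `f^* L` of a line bundle. -/
def pullback (f : Y ⟶ X) (L : LineBundle X) : LineBundle Y where
  ι := L.ι
  U i := f ⁻¹ᵁ L.U i
  covers y := L.covers (f y)
  g i j := pullFun f (preimage_inf_le f (L.U i) (L.U j)) (L.g i j)
  isUnit i j := (L.isUnit i j).map _
  cocycle i j k := by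
    have key : f ⁻¹ᵁ L.U i ⊓ f ⁻¹ᵁ L.U j ⊓ f ⁻¹ᵁ L.U k ≤ f ⁻¹ᵁ (L.U i ⊓ L.U j ⊓ L.U k) := le_rfl
    rw [pullFun_res f (U' := L.U i ⊓ L.U j ⊓ L.U k) inf_le_left _ _ key,
      pullFun_res f (U' := L.U i ⊓ L.U j ⊓ L.U k)
        (le_inf (inf_le_left.trans inf_le_right) inf_le_right) _ _ key,
      pullFun_res f (U' := L.U i ⊓ L.U j ⊓ L.U k)
        (le_inf (inf_le_left.trans inf_le_left) inf_le_right) _ _ key,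
      ← map_mul, L.cocycle]

/-- The tensor product `L ⊗ M` of line bundles: its transition functions are the products of
those of `L` and of `M`. -/
def tensor (L M : LineBundle X) : LineBundle X where
  ι := L.ι × M.ι
  U p := L.U p.1 ⊓ M.U p.2
  covers x := by
    obtain ⟨i, hi⟩ := L.covers x
    obtain ⟨a, ha⟩ := M.covers x
    exact ⟨(i, a), hi, ha⟩
  g p q := res (le_inf (inf_le_left.trans inf_le_left) (inf_le_right.trans inf_le_left))
      (L.g p.1 q.1) *
    res (le_inf (inf_le_left.trans inf_le_right) (inf_le_right.trans inf_le_right))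
      (M.g p.2 q.2)
  isUnit p q := ((L.isUnit _ _).map _).mul ((M.isUnit _ _).map _)
  cocycle p q r := by
    simp only [map_mul, res_res]
    have hL := congrArg (res (show L.U p.1 ⊓ M.U p.2 ⊓ (L.U q.1 ⊓ M.U q.2) ⊓ (L.U r.1 ⊓ M.U r.2) ≤
        L.U p.1 ⊓ L.U q.1 ⊓ L.U r.1 from
      le_inf (le_inf (inf_le_left.trans (inf_le_left.trans inf_le_left))
        (inf_le_left.trans (inf_le_right.trans inf_le_left)))
        (inf_le_right.trans inf_le_left))) (L.cocycle p.1 q.1 r.1)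
    have hM := congrArg (res (show L.U p.1 ⊓ M.U p.2 ⊓ (L.U q.1 ⊓ M.U q.2) ⊓ (L.U r.1 ⊓ M.U r.2) ≤
        M.U p.2 ⊓ M.U q.2 ⊓ M.U r.2 from
      le_inf (le_inf (inf_le_left.trans (inf_le_left.trans inf_le_right))
        (inf_le_left.trans (inf_le_right.trans inf_le_right)))
        (inf_le_right.trans inf_le_right))) (M.cocycle p.2 q.2 r.2)
    simp only [map_mul, res_res] at hL hM
    rw [← hL, ← hM]
    ring

/-- A global section of a line bundle: functions `s i` on the trivialising open sets (the
coordinates in the frames `e i`) which transform by the transition functions. -/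
structure GlobalSection (L : LineBundle X) where
  /-- the coordinate in the `i`-th frame -/
  s : ∀ i, Γ(X, L.U i)
  compat : ∀ i j, res inf_le_left (s i) =
    L.g i j * res (inf_le_right : L.U i ⊓ L.U j ≤ L.U j) (s j)

/-- The pullback `f^* s` of the section `s` vanishes. -/
def GlobalSection.PullbackVanishes {L : LineBundle X} (s : L.GlobalSection) (f : Y ⟶ X) : Prop :=
  ∀ i, pullFun f (V := f ⁻¹ᵁ L.U i) le_rfl (s.s i) = 0

/-- `i : Z ⟶ X` is the zero scheme `s⁻¹(0)` of the section `s`: the closed subscheme of `X`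
through which a morphism `f` factors exactly if `f^* s = 0`. -/
def GlobalSection.IsZeroScheme {L : LineBundle X} (s : L.GlobalSection) {Z : Scheme.{u}}
    (i : Z ⟶ X) : Prop :=
  IsClosedImmersion i ∧
    ∀ ⦃T : Scheme.{u}⦄ (f : T ⟶ X), (∃ l : T ⟶ Z, l ≫ i = f) ↔ s.PullbackVanishes f

end LineBundle

/-! ## The category of `S`-schemes -/

/-- Separated morphisms of finite type. -/
def sepFT : MorphismProperty Scheme.{u} :=
  fun _ _ f => IsSeparated f ∧ LocallyOfFiniteType f ∧ QuasiCompact f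

/-- The category `Sch/S` of separated schemes of finite type over `S`, with all `S`-morphisms. -/
abbrev Sch (S : Scheme.{u}) : Type (u + 1) := sepFT.Over ⊤ S

section Sch

variable {S : Scheme.{u}}

theorem sepFT_comp {X Y Z : Scheme.{u}} {f : X ⟶ Y} {g : Y ⟶ Z} (hf : sepFT f) (hg : sepFT g) :
    sepFT (f ≫ g) := by
  obtain ⟨_, _, _⟩ := hf
  obtain ⟨_, _, _⟩ := hg
  exact ⟨inferInstance, inferInstance, inferInstance⟩

theorem sepFT_fst {X Y Z : Scheme.{u}} {f : X ⟶ Z} {g : Y ⟶ Z} (hg : sepFT g) :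
    sepFT (pullback.fst f g) := by
  obtain ⟨_, _, _⟩ := hg
  exact ⟨inferInstance, inferInstance, inferInstance⟩

theorem sepFT_snd {X Y Z : Scheme.{u}} {f : X ⟶ Z} {g : Y ⟶ Z} (hf : sepFT f) :
    sepFT (pullback.snd f g) := by
  obtain ⟨_, _, _⟩ := hf
  exact ⟨inferInstance, inferInstance, inferInstance⟩

theorem sepFT_hom {X Y : Sch S} (f : X ⟶ Y) : sepFT f.left := by
  obtain ⟨_, _, _⟩ := X.prop
  obtain ⟨_, _, _⟩ := Y.prop
  have h : f.left ≫ Y.hom = X.hom := MorphismProperty.Over.w f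
  have : IsSeparated (f.left ≫ Y.hom) := h ▸ inferInstance
  have : LocallyOfFiniteType (f.left ≫ Y.hom) := h ▸ inferInstance
  have : QuasiCompact (f.left ≫ Y.hom) := h ▸ inferInstance
  exact ⟨IsSeparated.of_comp f.left Y.hom, locallyOfFiniteType_of_comp f.left Y.hom,
    QuasiCompact.of_comp f.left Y.hom⟩

/-- `S` as a scheme over itself. -/
def base (S : Scheme.{u}) : Sch S :=
  .mk ⊤ (𝟙 S) ⟨inferInstance, inferInstance, inferInstance⟩

/-- The structure morphism `π_X : X ⟶ S`, as a morphism of `S`-schemes. -/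
def toBase (X : Sch S) : X ⟶ base S :=
  MorphismProperty.Over.homMk X.hom (Category.comp_id _) trivial

/-- The fibre product `X ×_S Y`. -/
def prod (X Y : Sch S) : Sch S :=
  .mk ⊤ (pullback.fst X.hom Y.hom ≫ X.hom) (sepFT_comp (sepFT_fst Y.prop) X.prop)

/-- The first projection `X ×_S Y ⟶ X`. -/
def fst (X Y : Sch S) : prod X Y ⟶ X :=
  MorphismProperty.Over.homMk (pullback.fst X.hom Y.hom) rfl trivial

/-- The second projection `X ×_S Y ⟶ Y`. -/
def snd (X Y : Sch S) : prod X Y ⟶ Y :=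
  MorphismProperty.Over.homMk (pullback.snd X.hom Y.hom) pullback.condition.symm trivial

/-- The morphism to `X ×_S Y` with given components. -/
def lift {T X Y : Sch S} (f : T ⟶ X) (g : T ⟶ Y) : T ⟶ prod X Y :=
  MorphismProperty.Over.homMk
    (pullback.lift f.left g.left
      ((MorphismProperty.Over.w f).trans (MorphismProperty.Over.w g).symm))
    ((pullback.lift_fst_assoc _ _ _ _).trans (MorphismProperty.Over.w f)) trivial

/-- The product `f ×_S g` of morphisms. -/
def prodMap {X X' Y Y' : Sch S} (f : X ⟶ X') (g : Y ⟶ Y') : prod X Y ⟶ prod X' Y' :=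
  lift (fst X Y ≫ f) (snd X Y ≫ g)

/-- The exchange of factors `X ×_S Y ⟶ Y ×_S X`. -/
def swap (X Y : Sch S) : prod X Y ⟶ prod Y X := lift (snd X Y) (fst X Y)

/-- The associativity isomorphism `(X ×_S Y) ×_S Z ⟶ X ×_S (Y ×_S Z)`. -/
def assoc (X Y Z : Sch S) : prod (prod X Y) Z ⟶ prod X (prod Y Z) :=
  lift (fst _ _ ≫ fst _ _) (lift (fst _ _ ≫ snd _ _) (snd _ _))

/-- For `f : X ⟶ Y` and `h : V ⟶ Y`, the fibre product `V ×_Y X`. -/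
def fib {V X Y : Sch S} (h : V ⟶ Y) (f : X ⟶ Y) : Sch S :=
  .mk ⊤ (pullback.snd h.left f.left ≫ X.hom) (sepFT_comp (sepFT_snd (sepFT_hom h)) X.prop)

/-- The projection `V ×_Y X ⟶ V`. -/
def fibFst {V X Y : Sch S} (h : V ⟶ Y) (f : X ⟶ Y) : fib h f ⟶ V :=
  MorphismProperty.Over.homMk (pullback.fst h.left f.left)
    (by
      change pullback.fst h.left f.left ≫ V.hom = pullback.snd h.left f.left ≫ X.hom
      rw [← MorphismProperty.Over.w h, ← MorphismProperty.Over.w f]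
      exact pullback.condition_assoc _) trivial

/-- The projection `V ×_Y X ⟶ X`. -/
def fibSnd {V X Y : Sch S} (h : V ⟶ Y) (f : X ⟶ Y) : fib h f ⟶ X :=
  MorphismProperty.Over.homMk (pullback.snd h.left f.left) rfl trivial

/-- `f` is smooth of some constant relative dimension (denoted `dim f`). -/
def SmoothEquidim {X Y : Scheme.{u}} (f : X ⟶ Y) : Prop :=
  ∃ d : ℕ, SmoothOfRelativeDimension d f

end Sch

/-! ## The Lazard ring -/

section Lazard

open MvPowerSeries

/-- The generators `a i j`, `i + j ≥ 2`, of the Lazard ring. -/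
abbrev LazardVar : Type := {p : ℕ × ℕ // 2 ≤ p.1 + p.2}

/-- The coefficients of the generic power series `u + v + ∑_{i + j ≥ 2} a i j * u ^ i * v ^ j`. -/
def genericCoeff (i j : ℕ) : MvPolynomial LazardVar ℤ :=
  if h : 2 ≤ i + j then MvPolynomial.X ⟨(i, j), h⟩ else if i + j = 1 then 1 else 0

/-- The generic power series `F(u, v) = u + v + ∑_{i + j ≥ 2} a i j * u ^ i * v ^ j`. -/
def genericSeries : MvPowerSeries (Fin 2) (MvPolynomial LazardVar ℤ) :=
  fun d => genericCoeff (d 0) (d 1)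

/-- `F(F(x, y), z)` for the generic series `F`. -/
def genericAssocLeft : MvPowerSeries (Fin 3) (MvPolynomial LazardVar ℤ) :=
  genericSeries.subst ![genericSeries.subst ![X 0, X 1], X 2]

/-- `F(x, F(y, z))` for the generic series `F`. -/
def genericAssocRight : MvPowerSeries (Fin 3) (MvPolynomial LazardVar ℤ) :=
  genericSeries.subst ![X 0, genericSeries.subst ![X 1, X 2]]

/-- The ideal expressing that the generic series is a commutative formal group law. -/
def lazardIdeal : Ideal (MvPolynomial LazardVar ℤ) :=
  Ideal.span ({x | ∃ d, x = coeff d genericAssocLeft - coeff d genericAssocRight} ∪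
    {x | ∃ i j, x = genericCoeff i j - genericCoeff j i})

/-- The Lazard ring `𝕃`, the coefficient ring of the universal (one-dimensional, commutative)
formal group law. -/
def LazardRing : Type := MvPolynomial LazardVar ℤ ⧸ lazardIdeal

instance : CommRing LazardRing :=
  inferInstanceAs (CommRing (MvPolynomial LazardVar ℤ ⧸ lazardIdeal))

namespace LazardRing

/-- The quotient map from the polynomial ring. -/
def proj : MvPolynomial LazardVar ℤ →+* LazardRing := Ideal.Quotient.mk lazardIdeal

theorem constantCoeff_genericSeries : constantCoeff genericSeries = 0 := by
  rw [← coeff_zero_eq_constantCoeff_apply]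
  change genericCoeff 0 0 = 0
  simp [genericCoeff]

/-- The universal formal group law. -/
def universalFGL : FormalGroup LazardRing where
  toPowerSeries := genericSeries.map proj
  zero_constantCoeff := by
    rw [constantCoeff_map, constantCoeff_genericSeries, map_zero]
  lin_coeff_X := by
    rw [coeff_map]
    change proj (genericCoeff _ _) = 1
    simp [genericCoeff]
  lin_coeff_Y := by
    rw [coeff_map]
    change proj (genericCoeff _ _) = 1
    simp [genericCoeff]
  assoc := by
    have h01 : HasSubst ![(X 0 : MvPowerSeries (Fin 3) (MvPolynomial LazardVar ℤ)), X 1] :=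
      HasSubst.X_X
    have h12 : HasSubst ![(X 1 : MvPowerSeries (Fin 3) (MvPolynomial LazardVar ℤ)), X 2] :=
      HasSubst.X_X
    have key : genericAssocLeft.map proj = genericAssocRight.map proj := by
      ext d
      rw [coeff_map, coeff_map]
      exact Ideal.Quotient.eq.mpr (Ideal.subset_span (Or.inl ⟨d, rfl⟩))
    have hm : ∀ a b : MvPowerSeries (Fin 3) (MvPolynomial LazardVar ℤ),
        (fun i => (![a, b] i).map proj) = ![a.map proj, b.map proj] := by
      intro a b
      ext1 i
      fin_cases i <;> rfl
    rw [genericAssocLeft, genericAssocRight,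
      map_subst (HasSubst.cons_subst_zero_left 0 1 2 constantCoeff_genericSeries),
      map_subst (HasSubst.cons_subst_zero_right 0 1 2 constantCoeff_genericSeries), hm, hm,
      map_subst h01, map_subst h12, hm, hm] at key
    simpa only [map_X] using key

/-- The coefficient `a i j` of `u ^ i * v ^ j` in the universal formal group law. -/
def a (i j : ℕ) : LazardRing :=
  coeff (Finsupp.single 0 i + Finsupp.single 1 j) universalFGL.toPowerSeries

/-- The homological grading of the Lazard ring, in which `a i j` has degree `i + j - 1`. -/
def gr (n : ℤ) : AddSubgroup LazardRing :=
  (MvPolynomial.weightedHomogeneousSubmodule ℤ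
    (fun p : LazardVar => (p.1.1 : ℤ) + p.1.2 - 1) n).toAddSubgroup.map proj.toAddMonoidHom

end LazardRing

end Lazard

/-! ## Cobordism cycles -/

section Cycles

variable {S : Scheme.{u}}

/-- A cobordism cycle `(h : V ⟶ X; L₁, …, L_r)` over an `S`-scheme `X`: `h` is proper, the
composite `V ⟶ X ⟶ S` (the structure morphism of `V`) is smooth of constant relative
dimension `dim`, and the `L_i` are line bundles on `V`. -/
structure Cycle (X : Sch S) where
  /-- the source -/
  V : Sch S
  /-- the proper morphism to `X` -/
  h : V ⟶ X
  proper : IsProper h.left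
  /-- the relative dimension of `V` over `S` -/
  dim : ℕ
  smooth : SmoothOfRelativeDimension dim V.hom
  /-- the line bundles -/
  bundles : List (LineBundle V.left)

namespace Cycle

variable {X Y : Sch S}

/-- Two cobordism cycles are isomorphic if there is an isomorphism of their sources over `X`
under which the line bundles correspond, up to isomorphism and order. (The condition on `dim`
is automatic unless the sources are empty.) -/
def Iso (C D : Cycle X) : Prop :=
  C.dim = D.dim ∧ ∃ e : C.V ≅ D.V, e.hom ≫ D.h = C.h ∧
    ∃ l : List (LineBundle C.V.left),
      l.Perm (D.bundles.map (LineBundle.pullback e.hom.left)) ∧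
        List.Forall₂ LineBundle.Iso C.bundles l

/-- `j : V' ⟶ V` presents `D` as the restriction along `j` of the cycle `C` with source `V`. -/
def IsRestriction (C D : Cycle X) (j : D.V ⟶ C.V) : Prop :=
  j ≫ C.h = D.h ∧ D.dim = C.dim ∧ D.bundles = C.bundles.map (LineBundle.pullback j.left)

/-- `C` is the disjoint union of `C₁` and `C₂`. -/
def IsDisjointUnion (C C₁ C₂ : Cycle X) : Prop :=
  ∃ (j₁ : C₁.V ⟶ C.V) (j₂ : C₂.V ⟶ C.V),
    Nonempty (IsColimit (BinaryCofan.mk j₁.left j₂.left)) ∧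
      C.IsRestriction C₁ j₁ ∧ C.IsRestriction C₂ j₂

/-- The cycle with the same source and other line bundles. -/
def withBundles (C : Cycle X) (l : List (LineBundle C.V.left)) : Cycle X :=
  { C with bundles := l }

/-- `f_* (h : V ⟶ X; L₁, …, L_r) = (f ∘ h : V ⟶ Y; L₁, …, L_r)` for `f` proper. -/
def push (C : Cycle X) (f : X ⟶ Y) (hf : IsProper f.left) : Cycle Y where
  V := C.V
  h := C.h ≫ f
  proper := by
    have := C.proper
    exact inferInstanceAs (IsProper (C.h.left ≫ f.left))
  dim := C.dim
  smooth := C.smooth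
  bundles := C.bundles

/-- `f^* (h : W ⟶ Y; L₁, …, L_r) = (W ×_Y X ⟶ X; pr^* L₁, …, pr^* L_r)` for `f : X ⟶ Y` smooth
of relative dimension `d`. -/
def pull (C : Cycle Y) (f : X ⟶ Y) (d : ℕ) (hf : SmoothOfRelativeDimension d f.left) :
    Cycle X where
  V := fib C.h f
  h := fibSnd C.h f
  proper := by
    have := C.proper
    exact inferInstanceAs (IsProper (pullback.snd C.h.left f.left))
  dim := d + C.dim
  smooth := by
    have := C.smooth
    have h1 : SmoothOfRelativeDimension d (pullback.fst C.h.left f.left) :=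
      (smoothOfRelativeDimension_isStableUnderBaseChange d).of_isPullback
        (IsPullback.of_hasPullback C.h.left f.left).flip hf
    have h2 : (fibFst C.h f).left ≫ C.V.hom = (fib C.h f).hom := MorphismProperty.Over.w _
    rw [← h2]
    exact inferInstanceAs
      (SmoothOfRelativeDimension (d + C.dim) (pullback.fst C.h.left f.left ≫ C.V.hom))
  bundles := C.bundles.map (LineBundle.pullback (fibFst C.h f).left)

/-- `c₁(L) (h : V ⟶ X; L₁, …, L_r) = (h : V ⟶ X; L₁, …, L_r, h^* L)`. -/
def chern (C : Cycle X) (L : LineBundle X.left) : Cycle X :=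
  C.withBundles (C.bundles ++ [L.pullback C.h.left])

/-- The external product
`(V ×_S W ⟶ X ×_S Y; pr₁^* L₁, …, pr₁^* L_r, pr₂^* M₁, …, pr₂^* M_s)`. -/
def ext (C : Cycle X) (D : Cycle Y) : Cycle (prod X Y) where
  V := prod C.V D.V
  h := prodMap C.h D.h
  proper := by
    have h1 := MorphismProperty.pullbackMap (P := @IsProper) C.proper D.proper
      (MorphismProperty.Over.w C.h).symm (MorphismProperty.Over.w D.h).symm
    exact h1
  dim := D.dim + C.dim
  smooth := by
    have := C.smooth
    have h1 : SmoothOfRelativeDimension D.dim (pullback.fst C.V.hom D.V.hom) :=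
      (smoothOfRelativeDimension_isStableUnderBaseChange D.dim).of_isPullback
        (IsPullback.of_hasPullback C.V.hom D.V.hom).flip D.smooth
    exact inferInstanceAs
      (SmoothOfRelativeDimension (D.dim + C.dim) (pullback.fst C.V.hom D.V.hom ≫ C.V.hom))
  bundles := C.bundles.map (LineBundle.pullback (fst C.V D.V).left) ++
    D.bundles.map (LineBundle.pullback (snd C.V D.V).left)

/-- The cycle `(id : S ⟶ S)`. -/
def unit (S : Scheme.{u}) : Cycle (base S) where
  V := base S
  h := 𝟙 _
  proper := inferInstanceAs (IsProper (𝟙 S))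
  dim := 0
  smooth := inferInstanceAs (SmoothOfRelativeDimension 0 (𝟙 S))
  bundles := []

end Cycle

/-! ## Relative algebraic cobordism -/

/-- `i : Z ⟶ V` is the zero scheme of a section `s` of a line bundle on `V` which is fibrewise
transverse to the zero section, where `V` is smooth of relative dimension `d` over `S`: the zero
scheme is smooth over `S`, of relative dimension `d - 1` unless it is empty. -/
def IsTransverseZeroScheme {V Z : Sch S} (d : ℕ) {L : LineBundle V.left} (s : L.GlobalSection)
    (i : Z ⟶ V) : Prop :=
  s.IsZeroScheme i.left ∧
    (IsEmpty Z.left ∨ ∃ m : ℕ, m + 1 = d ∧ SmoothOfRelativeDimension m Z.hom)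

namespace Cycle

variable {X : Sch S}

/-- The cycles `(h : V ⟶ X; π^* L₁, …, π^* L_r, M₁, …, M_s)` for a factorisation
`V ⟶ S' ⟶ S` into smooth morphisms and line bundles `L_i` on `S'` with `r > dim (S'/S)`. -/
def IsDimCycle (C : Cycle X) : Prop :=
  ∃ (S' : Sch S) (π : C.V ⟶ S') (e : ℕ) (Ls : List (LineBundle S'.left))
    (Ms : List (LineBundle C.V.left)),
    Smooth π.left ∧ SmoothOfRelativeDimension e S'.hom ∧ e < Ls.length ∧
      C.bundles = Ls.map (LineBundle.pullback π.left) ++ Ms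

/-- `C = (h : V ⟶ X; L₁, …, L_r, L)` and `D = (h ∘ i : Z ⟶ X; i^* L₁, …, i^* L_r)`, where
`i : Z ⟶ V` is the zero scheme of a fibrewise transverse section of `L`. (The condition on
dimensions is automatic unless `Z` is empty.) -/
def IsSectPair (C D : Cycle X) : Prop :=
  ∃ (Ls : List (LineBundle C.V.left)) (L : LineBundle C.V.left) (s : L.GlobalSection)
    (i : D.V ⟶ C.V),
    C.bundles = Ls ++ [L] ∧ IsTransverseZeroScheme C.dim s i ∧ i ≫ C.h = D.h ∧
      (IsEmpty D.V.left ∨ D.dim + 1 = C.dim) ∧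
      D.bundles = Ls.map (LineBundle.pullback i.left)

end Cycle

section Omega

variable (X : Sch S)

/-- The group `𝒵^*(X ⟶ S)`: the free abelian group on the isomorphism classes of cobordism
cycles, in which disjoint union is identified with the sum. -/
abbrev Z : Type (u + 1) :=
  FreeAbelianGroup (Quot (Cycle.Iso (X := X))) ⧸
    AddSubgroup.closure {x | ∃ C C₁ C₂ : Cycle X, C.IsDisjointUnion C₁ C₂ ∧
      x = .of (Quot.mk _ C) - (.of (Quot.mk _ C₁) + .of (Quot.mk _ C₂))}

variable {X} in
/-- The class `[V ⟶ X; L₁, …, L_r]` in `𝒵^*(X ⟶ S)`. -/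
def Z.cls (C : Cycle X) : Z X := QuotientAddGroup.mk (.of (Quot.mk _ C))

/-- The quotient of `𝒵^*(X ⟶ S)` by the subgroup `⟨R^Dim⟩`. -/
abbrev ZDim : Type (u + 1) :=
  Z X ⧸ AddSubgroup.closure {x | ∃ C : Cycle X, C.IsDimCycle ∧ x = Z.cls C}

variable {X} in
/-- The class of a cobordism cycle modulo `⟨R^Dim⟩`. -/
def ZDim.cls (C : Cycle X) : ZDim X := QuotientAddGroup.mk (Z.cls C)

/-- The quotient of `𝒵^*(X ⟶ S) / ⟨R^Dim⟩` by the subgroup `⟨R^Sect⟩`, generated by the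
differences `[V ⟶ X; L₁, …, L_r, L] - [Z ⟶ X; i^* L₁, …, i^* L_r]` with `i : Z ⟶ V` the zero
scheme of a fibrewise transverse section of `L`. -/
abbrev ZSect : Type (u + 1) :=
  ZDim X ⧸ AddSubgroup.closure
    {x | ∃ C D : Cycle X, C.IsSectPair D ∧ x = ZDim.cls C - ZDim.cls D}

variable {X} in
/-- The class of a cobordism cycle modulo `⟨R^Dim⟩` and `⟨R^Sect⟩`. -/
def ZSect.cls (C : Cycle X) : ZSect X := QuotientAddGroup.mk (ZDim.cls C)

variable {X} in
/-- The element `[V ⟶ X; L₁, …, L_r, F(L, M)] = ∑ a i j ⊗ [V ⟶ X; L₁, …, L_r, L^i, M^j]` (where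
`L^i` is `L` repeated `i` times) of `𝕃 ⊗ ZSect X`, for `F` the universal formal group law. The
terms with `i > dim` or `j > dim` vanish by the relations in `⟨R^Dim⟩` and are left out. -/
def fglElement (C : Cycle X) (Ls : List (LineBundle C.V.left)) (L M : LineBundle C.V.left) :
    LazardRing ⊗[ℤ] ZSect X :=
  ∑ i ∈ Finset.range (C.dim + 1), ∑ j ∈ Finset.range (C.dim + 1),
    LazardRing.a i j ⊗ₜ[ℤ]
      ZSect.cls (C.withBundles (Ls ++ List.replicate i L ++ List.replicate j M))

/-- The `𝕃`-submodule of `𝕃 ⊗ ZSect X` generated by the formal group law relations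
`[V ⟶ X; L₁, …, L_r, F(L, M)] - [V ⟶ X; L₁, …, L_r, L ⊗ M]`. -/
def fglSubmodule : Submodule LazardRing (LazardRing ⊗[ℤ] ZSect X) :=
  Submodule.span LazardRing {x | ∃ (C : Cycle X) (Ls : List (LineBundle C.V.left))
    (L M : LineBundle C.V.left),
    x = fglElement C Ls L M - 1 ⊗ₜ[ℤ] ZSect.cls (C.withBundles (Ls ++ [L.tensor M]))}

/-- The relative algebraic cobordism `Ω^*(X ⟶ S)`. -/
abbrev Omega : Type (u + 1) := (LazardRing ⊗[ℤ] ZSect X) ⧸ fglSubmodule X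

variable {X} in
/-- The class of `a ⊗ [V ⟶ X; L₁, …, L_r]` in `Ω^*(X ⟶ S)`. -/
def Omega.cls (a : LazardRing) (C : Cycle X) : Omega X :=
  (fglSubmodule X).mkQ (a ⊗ₜ[ℤ] ZSect.cls C)

/-- The graded piece `Ω^n(X ⟶ S)`: it is generated by the `a ⊗ [V ⟶ X; L₁, …, L_r]` with `a` of
homological degree `m` in `𝕃` and `n = r - dim (V/S) - m`. -/
def Omega.gr (n : ℤ) : AddSubgroup (Omega X) :=
  AddSubgroup.closure {x | ∃ (m : ℤ) (a : LazardRing) (C : Cycle X), a ∈ LazardRing.gr m ∧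
    n = C.bundles.length - C.dim - m ∧ x = Omega.cls a C}

end Omega

end Cycles

/-! ## Oriented Borel–Moore functors with products -/

section BorelMoore

variable {S : Scheme.{u}}

theorem isProper_fst_base (S : Scheme.{u}) : IsProper (fst (base S) (base S)).left :=
  inferInstanceAs (IsProper (pullback.fst (𝟙 S) (𝟙 S)))

theorem isProper_snd_base (X : Sch S) : IsProper (snd (base S) X).left :=
  inferInstanceAs (IsProper (pullback.snd (𝟙 S) X.hom))

/-- The structure of an oriented Borel–Moore functor with products on `Sch/S` on a family of
abelian groups `A X`, `X` in `Sch/S`. -/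
structure OrientedBMFunctor (A : Sch S → Type v) [∀ X, AddCommGroup (A X)] where
  /-- the grading `A^i(X)` -/
  gr : ∀ X : Sch S, ℤ → AddSubgroup (A X)
  isInternal : ∀ X, DirectSum.IsInternal (gr X)
  /-- (D1) the pushforward `f_*` along a proper morphism -/
  push : ∀ {X Y : Sch S} (f : X ⟶ Y), IsProper f.left → (A X →+ A Y)
  push_mem : ∀ {X Y : Sch S} (f : X ⟶ Y) (hf : IsProper f.left) (i : ℤ) (x : A X),
    x ∈ gr X i → push f hf x ∈ gr Y i
  push_id : ∀ (X : Sch S) (h : IsProper (𝟙 X : X ⟶ X).left), push (𝟙 X) h = .id (A X)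
  push_comp : ∀ {X Y Z : Sch S} (f : X ⟶ Y) (g : Y ⟶ Z) (hf : IsProper f.left)
    (hg : IsProper g.left) (hfg : IsProper (f ≫ g).left),
    push (f ≫ g) hfg = (push g hg).comp (push f hf)
  additive_empty : ∀ X : Sch S, IsEmpty X.left → Subsingleton (A X)
  additive : ∀ {X Y W : Sch S} (j : X ⟶ W) (k : Y ⟶ W) (hj : IsProper j.left)
    (hk : IsProper k.left), Nonempty (IsColimit (BinaryCofan.mk j.left k.left)) →
      Function.Bijective (fun p : A X × A Y => push j hj p.1 + push k hk p.2)
  /-- (D2) the pullback `f^*` along a smooth morphism (of constant relative dimension) -/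
  pull : ∀ {X Y : Sch S} (f : X ⟶ Y), SmoothEquidim f.left → (A Y →+ A X)
  pull_mem : ∀ {X Y : Sch S} (f : X ⟶ Y) (hf : SmoothEquidim f.left) (d : ℕ),
    SmoothOfRelativeDimension d f.left → ∀ (i : ℤ) (y : A Y),
      y ∈ gr Y i → pull f hf y ∈ gr X (i - d)
  /-- (D3) the Chern operator of a line bundle -/
  chern : ∀ {X : Sch S}, LineBundle X.left → (A X →+ A X)
  chern_mem : ∀ {X : Sch S} (L : LineBundle X.left) (i : ℤ) (x : A X),
    x ∈ gr X i → chern L x ∈ gr X (i + 1)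
  /-- (D4) the external product -/
  ext : ∀ {X Y : Sch S}, A X →+ A Y →+ A (prod X Y)
  ext_mem : ∀ {X Y : Sch S} (i j : ℤ) (x : A X) (y : A Y),
    x ∈ gr X i → y ∈ gr Y j → ext x y ∈ gr (prod X Y) (i + j)
  ext_comm : ∀ {X Y : Sch S} (x : A X) (y : A Y) (h : IsProper (swap X Y).left),
    push (swap X Y) h (ext x y) = ext y x
  ext_assoc : ∀ {X Y Z : Sch S} (x : A X) (y : A Y) (z : A Z)
    (h : IsProper (assoc X Y Z).left),
    push (assoc X Y Z) h (ext (ext x y) z) = ext x (ext y z)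
  /-- the unit `1 = 1_S` of the external product -/
  one : A (base S)
  one_mem : one ∈ gr (base S) 0
  one_ext : ∀ {X : Sch S} (x : A X), push (snd (base S) X) (isProper_snd_base X) (ext one x) = x
  /-- (A1) -/
  pull_id : ∀ (X : Sch S) (h : SmoothEquidim (𝟙 X : X ⟶ X).left), pull (𝟙 X) h = .id (A X)
  pull_comp : ∀ {X Y Z : Sch S} (f : X ⟶ Y) (g : Y ⟶ Z) (hf : SmoothEquidim f.left)
    (hg : SmoothEquidim g.left) (hfg : SmoothEquidim (f ≫ g).left),
    pull (f ≫ g) hfg = (pull f hf).comp (pull g hg)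
  /-- (A2) -/
  pull_push : ∀ {W X Y Z : Sch S} (g' : W ⟶ X) (f' : W ⟶ Y) (f : X ⟶ Z) (g : Y ⟶ Z)
    (hg' : SmoothEquidim g'.left) (hf' : IsProper f'.left) (hf : IsProper f.left)
    (hg : SmoothEquidim g.left), IsPullback g'.left f'.left f.left g.left →
      (pull g hg).comp (push f hf) = (push f' hf').comp (pull g' hg')
  /-- (A3) -/
  push_chern : ∀ {X Y : Sch S} (f : X ⟶ Y) (hf : IsProper f.left) (M : LineBundle Y.left),
    (push f hf).comp (chern (M.pullback f.left)) = (chern M).comp (push f hf)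
  /-- (A4) -/
  chern_pull : ∀ {X Y : Sch S} (f : X ⟶ Y) (hf : SmoothEquidim f.left) (M : LineBundle Y.left),
    (chern (M.pullback f.left)).comp (pull f hf) = (pull f hf).comp (chern M)
  /-- (A5) -/
  chern_comm : ∀ {X : Sch S} (L L' : LineBundle X.left),
    (chern L).comp (chern L') = (chern L').comp (chern L)
  chern_congr : ∀ {X : Sch S} (L L' : LineBundle X.left), L.Iso L' → chern L = chern L'
  /-- (A6) -/
  push_ext : ∀ {X₁ X₂ Y₁ Y₂ : Sch S} (f : X₁ ⟶ X₂) (g : Y₁ ⟶ Y₂) (hf : IsProper f.left)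
    (hg : IsProper g.left) (hfg : IsProper (prodMap f g).left) (x : A X₁) (y : A Y₁),
    ext (push f hf x) (push g hg y) = push (prodMap f g) hfg (ext x y)
  /-- (A7) -/
  pull_ext : ∀ {X₁ X₂ Y₁ Y₂ : Sch S} (f : X₁ ⟶ X₂) (g : Y₁ ⟶ Y₂) (hf : SmoothEquidim f.left)
    (hg : SmoothEquidim g.left) (hfg : SmoothEquidim (prodMap f g).left) (x : A X₂) (y : A Y₂),
    ext (pull f hf x) (pull g hg y) = pull (prodMap f g) hfg (ext x y)
  /-- (A8) -/
  chern_ext : ∀ {X Y : Sch S} (L : LineBundle X.left) (x : A X) (y : A Y),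
    ext (chern L x) y = chern (L.pullback (fst X Y).left) (ext x y)

namespace OrientedBMFunctor

variable {A : Sch S → Type v} [∀ X, AddCommGroup (A X)] (B : OrientedBMFunctor A)

/-- The product of the ring `A(S ⟶ S)`. -/
def mul (x y : A (base S)) : A (base S) :=
  B.push (fst (base S) (base S)) (isProper_fst_base S) (B.ext x y)

/-- The action of the ring `A(S ⟶ S)` on `A(X ⟶ S)`. -/
def act {X : Sch S} (c : A (base S)) (x : A X) : A X :=
  B.push (snd (base S) X) (isProper_snd_base X) (B.ext c x)

/-- The element `π_X^* 1_S` of `A(X ⟶ S)`, for `X` smooth over `S`. -/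
def fund (X : Sch S) (hX : SmoothEquidim X.hom) : A X := B.pull (toBase X) hX B.one

/-- `Φ` is a graded ring homomorphism from the Lazard ring, graded homologically, to
`A^*(S ⟶ S)`. -/
structure IsLazardHom (Φ : LazardRing →+ A (base S)) : Prop where
  map_one : Φ 1 = B.one
  map_mul : ∀ a b, Φ (a * b) = B.mul (Φ a) (Φ b)
  map_mem : ∀ (n : ℤ) (a : LazardRing), a ∈ LazardRing.gr n → Φ a ∈ B.gr (base S) (-n)

/-- An oriented Borel–Moore functor with products, with the `𝕃`-structure given by `Φ`, is of
geometric type. -/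
structure IsGeometricType (Φ : LazardRing →+ A (base S)) : Prop where
  isLazardHom : B.IsLazardHom Φ
  /-- (rel-Dim) -/
  rel_dim : ∀ (X : Sch S) (hX : SmoothEquidim X.hom) (d : ℕ),
    SmoothOfRelativeDimension d X.hom → ∀ Ls : List (LineBundle X.left), d < Ls.length →
      Ls.foldr (fun L x => B.chern L x) (B.fund X hX) = 0
  /-- (rel-Sect) -/
  rel_sect : ∀ (X Z : Sch S) (hX : SmoothEquidim X.hom) (hZ : SmoothEquidim Z.hom) (d : ℕ),
    SmoothOfRelativeDimension d X.hom → ∀ (L : LineBundle X.left) (s : L.GlobalSection)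
      (i : Z ⟶ X) (hi : IsProper i.left), IsTransverseZeroScheme d s i →
        B.chern L (B.fund X hX) = B.push i hi (B.fund Z hZ)
  /-- (rel-FGL); the terms of the power series with `i > d` or `j > d` vanish by (rel-Dim) -/
  rel_fgl : ∀ (X : Sch S) (hX : SmoothEquidim X.hom) (d : ℕ),
    SmoothOfRelativeDimension d X.hom → ∀ L M : LineBundle X.left,
      (∑ i ∈ Finset.range (d + 1), ∑ j ∈ Finset.range (d + 1),
        B.act (Φ (LazardRing.a i j)) ((B.chern L)^[i] ((B.chern M)^[j] (B.fund X hX)))) =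
      B.chern (L.tensor M) (B.fund X hX)

end OrientedBMFunctor

/-- The operations of `B` on `Ω^*(X ⟶ S)` are those induced by the operations on cobordism
cycles. -/
structure IsInducedByCycles (B : OrientedBMFunctor (fun X : Sch S => Omega X)) : Prop where
  gr_eq : ∀ X n, B.gr X n = Omega.gr X n
  push_cls : ∀ {X Y : Sch S} (f : X ⟶ Y) (hf : IsProper f.left) (a : LazardRing) (C : Cycle X),
    B.push f hf (Omega.cls a C) = Omega.cls a (C.push f hf)
  pull_cls : ∀ {X Y : Sch S} (f : X ⟶ Y) (hf : SmoothEquidim f.left) (d : ℕ)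
    (hd : SmoothOfRelativeDimension d f.left) (a : LazardRing) (C : Cycle Y),
    B.pull f hf (Omega.cls a C) = Omega.cls a (C.pull f d hd)
  chern_cls : ∀ {X : Sch S} (L : LineBundle X.left) (a : LazardRing) (C : Cycle X),
    B.chern L (Omega.cls a C) = Omega.cls a (C.chern L)
  ext_cls : ∀ {X Y : Sch S} (a b : LazardRing) (C : Cycle X) (D : Cycle Y),
    B.ext (Omega.cls a C) (Omega.cls b D) = Omega.cls (a * b) (C.ext D)
  one_eq : B.one = Omega.cls 1 (Cycle.unit S)

end BorelMoore

/-! ## Levine–Morel's algebraic cobordism of a separated scheme of finite type over a field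

This is the construction of Levine and Morel, with cobordism cycles that are proper morphisms
from smooth varieties (no quasi-projectivity is required). A smooth variety is a connected smooth
scheme over `k`; such a scheme is automatically integral. -/

namespace LevineMorel

variable {k : Type u} [Field k]

/-- The category of separated schemes of finite type over the field `k`. -/
abbrev SchField (k : Type u) [Field k] : Type (u + 1) := Sch (Spec (CommRingCat.of k))

/-- The cobordism cycles `(h : V ⟶ X; L₁, …, L_r)` with `V` a smooth variety over `k`. -/
abbrev VarCycle (X : SchField k) : Type (u + 1) := {C : Cycle X // ConnectedSpace C.V.left}

/-- The family `E` of cobordism cycles consists of the restrictions of `C` to the connected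
components of its source. -/
def IsComponents {X : SchField k} (C : Cycle X) {n : ℕ} (E : Fin n → VarCycle X) : Prop :=
  ∃ j : ∀ b, (E b).1.V ⟶ C.V,
    Nonempty (IsColimit (Cofan.mk C.V.left fun b => (j b).left)) ∧
      ∀ b, C.IsRestriction (E b).1 (j b)

variable (X : SchField k)

/-- The group `𝒵_*(X)`: the free abelian group on the isomorphism classes of cobordism cycles
whose source is a smooth variety. -/
abbrev Z : Type (u + 1) := FreeAbelianGroup (Quot fun C D : VarCycle X => C.1.Iso D.1)

variable {X} in
/-- The class of a cobordism cycle in `𝒵_*(X)`. -/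
def Z.cls (C : VarCycle X) : Z X := .of (Quot.mk _ C)

/-- The quotient of `𝒵_*(X)` by `⟨R^Dim⟩(X)`. -/
abbrev ZDim : Type (u + 1) :=
  Z X ⧸ AddSubgroup.closure {x | ∃ C : VarCycle X, C.1.IsDimCycle ∧ x = Z.cls C}

variable {X} in
/-- The class of a cobordism cycle modulo `⟨R^Dim⟩`. -/
def ZDim.cls (C : VarCycle X) : ZDim X := QuotientAddGroup.mk (Z.cls C)

/-- The quotient of `𝒵_*(X) / ⟨R^Dim⟩(X)` by `⟨R^Sect⟩(X)`; the zero scheme of the section is the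
disjoint union of smooth varieties, and its class is the sum of theirs. -/
abbrev ZSect : Type (u + 1) :=
  ZDim X ⧸ AddSubgroup.closure
    {x | ∃ (C : VarCycle X) (D : Cycle X) (n : ℕ) (E : Fin n → VarCycle X),
      C.1.IsSectPair D ∧ IsComponents D E ∧ x = ZDim.cls C - ∑ b, ZDim.cls (E b)}

variable {X} in
/-- The class of a cobordism cycle modulo `⟨R^Dim⟩` and `⟨R^Sect⟩`. -/
def ZSect.cls (C : VarCycle X) : ZSect X := QuotientAddGroup.mk (ZDim.cls C)

variable {X} in
/-- The cycle with the same source and other line bundles. -/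
def withBundles (C : VarCycle X) (l : List (LineBundle C.1.V.left)) : VarCycle X :=
  ⟨C.1.withBundles l, C.2⟩

/-- The `𝕃`-submodule of `𝕃 ⊗ ZSect X` generated by the formal group law relations. -/
def fglSubmodule : Submodule LazardRing (LazardRing ⊗[ℤ] ZSect X) :=
  Submodule.span LazardRing {x | ∃ (C : VarCycle X) (Ls : List (LineBundle C.1.V.left))
    (L M : LineBundle C.1.V.left),
    x = (∑ i ∈ Finset.range (C.1.dim + 1), ∑ j ∈ Finset.range (C.1.dim + 1),
        LazardRing.a i j ⊗ₜ[ℤ]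
          ZSect.cls (withBundles C (Ls ++ List.replicate i L ++ List.replicate j M))) -
      1 ⊗ₜ[ℤ] ZSect.cls (withBundles C (Ls ++ [L.tensor M]))}

/-- Levine–Morel's algebraic cobordism `Ω_*(X)`. -/
abbrev Omega : Type (u + 1) := (LazardRing ⊗[ℤ] ZSect X) ⧸ fglSubmodule X

variable {X} in
/-- The class of `a ⊗ [V ⟶ X; L₁, …, L_r]` in `Ω_*(X)`. -/
def Omega.cls (a : LazardRing) (C : VarCycle X) : Omega X :=
  (fglSubmodule X).mkQ (a ⊗ₜ[ℤ] ZSect.cls C)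

/-- The graded piece `Ω_n(X)`: it is generated by the `a ⊗ [V ⟶ X; L₁, …, L_r]` with `a` of
degree `m` in `𝕃` and `n = m + dim V - r`. -/
def Omega.gr (n : ℤ) : AddSubgroup (Omega X) :=
  AddSubgroup.closure {x | ∃ (m : ℤ) (a : LazardRing) (C : VarCycle X), a ∈ LazardRing.gr m ∧
    n = m + C.1.dim - C.1.bundles.length ∧ x = Omega.cls a C}

end LevineMorel

end

end RelCob

namespace RelCob

noncomputable section

section

/-! ### Strict functoriality of pullback for line bundles and their sections; uniqueness of the
relative dimension -/

namespace LineBundle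

variable {X Y W : Scheme.{u}}

/-! Every group in sight is generated by classes a ⊗ [V → X; L₁, …, L_r]. An operation on Ω is
therefore given by an operation on cycles that is compatible with isomorphism, disjoint union,
R^Dim, R^Sect and the formal group law; and an axiom is an isomorphism between two explicit cycles.
`Omega.Respects` records the compatibilities, `Omega.lift` and `Omega.liftModule` produce the maps,
and `Omega.induction` reduces identities to generators.

Pushforward does not touch the source of a cycle, and a Chern operator only adds a bundle, whose
place in the list is irrelevant. Pullback is base change: smoothness, zero schemes and disjoint
unions are all stable under it. The one delicate relation is the formal group law, since the
truncation of the sum depends on the dimension of the source. It grows under pullback, but the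
bundles come from the old source along a smooth map, so R^Dim kills the additional terms
(`Omega.cls_fgl_of_smooth`). The external product needs no new check of relations: [V → X; L] × y is
(h × id)_* c₁(pr₁^*L) pr₂^* y, which is well defined in y, and the symmetric formula is well defined
in the other variable. On generators they agree (`Omega.respects_ext`).

For the grading, the Lazard ideal is generated by homogeneous elements
(`isHomogeneous_lazardIdeal`), so the Lazard ring has projections to its graded pieces; as all
relations between cycles are homogeneous too, Ω has such projections (`Omega.respects_component`),
and these make the sum direct. Additivity holds because the two inclusions are open immersions,
hence smooth of dimension 0, and their pullbacks invert pushforward. The geometric axioms are the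
defining relations applied to π_X^*1_S = [id_X] (`Omega.pull_toBase_unit`).

Over a field the source of a cycle has finitely many connected components, all open. Summing over
them sends Ω^* to Levine–Morel's Ω_*; regarding a connected cycle as a cycle gives the inverse. The
content is that the sum over components respects R^Sect when the source is disconnected
(`LevineMorel.compSum_of_isSectPair`), and that it can be computed from any partition of the source
(`LevineMorel.compSum_eq_sum`). -/

/-- Preimages of opens are functorial by definition, so two iterated pullbacks have the same cover
on the nose and only the transition functions are left to compare. This yields equalities of line
bundles, not mere isomorphisms, and lists of bundles can be rewritten with them. -/
theorem ext_of_g {ι : Type u} {U : ι → X.Opens} {c : ∀ x : X, ∃ i, x ∈ U i} {c' : ∀ x : X, ∃ i, x ∈ U i}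
    {g g' : ∀ i j, Γ(X, U i ⊓ U j)} {h h' k k'} (H : ∀ i j, g i j = g' i j) :
    (⟨ι, U, c, g, h, k⟩ : LineBundle X) = ⟨ι, U, c', g', h', k'⟩ := by
  obtain rfl : g = g' := funext₂ H
  rfl

theorem pullback_id (L : LineBundle X) : L.pullback (𝟙 X) = L := by
  cases L with | mk ι U c g h k =>
  apply ext_of_g
  intro i j
  have e : ∀ (A : X.Opens) (h : A ≤ (𝟙 X) ⁻¹ᵁ A) (a : Γ(X, A)), pullFun (𝟙 X) h a = a := by
    intro A h a
    have h1 : (𝟙 X : X ⟶ X).appLE A A h = 𝟙 _ := by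
      simp only [Scheme.Hom.appLE, Scheme.Hom.id_app]
      exact (Category.id_comp _).trans (X.presheaf.map_id _)
    exact congr($h1 a)
  exact e _ _ _

theorem pullback_comp (L : LineBundle X) (f : Y ⟶ X) (g : W ⟶ Y) :
    (L.pullback f).pullback g = L.pullback (g ≫ f) := by
  apply ext_of_g
  intro i j
  have := Scheme.Hom.appLE_comp_appLE g f (L.U i ⊓ L.U j) (f ⁻¹ᵁ L.U i ⊓ f ⁻¹ᵁ L.U j)
    (g ⁻¹ᵁ (f ⁻¹ᵁ L.U i) ⊓ g ⁻¹ᵁ (f ⁻¹ᵁ L.U j)) le_rfl le_rfl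
  exact congr($(this) (L.g i j))

theorem pullback_tensor (L M : LineBundle X) (f : Y ⟶ X) :
    (L.tensor M).pullback f = (L.pullback f).tensor (M.pullback f) := by
  apply ext_of_g
  intro i j
  refine (map_mul (pullFun f _) _ _).trans ?_
  exact congrArg₂ (· * ·) (pullFun_res f _ _ _ _ _).symm (pullFun_res f _ _ _ _ _).symm

/-- The transition functions themselves serve as comparison units, and both compatibilities are the
cocycle condition. -/
theorem Iso.refl (L : LineBundle X) : L.Iso L :=
  ⟨L.g, L.isUnit, L.cocycle, L.cocycle⟩

theorem Iso.pullback {L M : LineBundle X} (f : Y ⟶ X) (h : L.Iso M) :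
    (L.pullback f).Iso (M.pullback f) := by
  obtain ⟨t, ht, h1, h2⟩ := h
  refine ⟨fun i a => pullFun f (preimage_inf_le f (L.U i) (M.U a)) (t i a),
    fun i a => (ht i a).map _, fun i j a => ?_, fun i a b => ?_⟩
  · have key : f ⁻¹ᵁ L.U i ⊓ f ⁻¹ᵁ L.U j ⊓ f ⁻¹ᵁ M.U a ≤ f ⁻¹ᵁ (L.U i ⊓ L.U j ⊓ M.U a) := le_rfl
    have := congrArg (pullFun f key) (h1 i j a)
    rw [map_mul, ← pullFun_res f _ _ (preimage_inf_le f _ _) _, ← pullFun_res f _ _ (preimage_inf_le f _ _) _,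
      ← pullFun_res f _ _ (preimage_inf_le f _ _) _] at this
    · exact this
  · have key : f ⁻¹ᵁ L.U i ⊓ f ⁻¹ᵁ M.U a ⊓ f ⁻¹ᵁ M.U b ≤ f ⁻¹ᵁ (L.U i ⊓ M.U a ⊓ M.U b) := le_rfl
    have := congrArg (pullFun f key) (h2 i a b)
    rw [map_mul, ← pullFun_res f _ _ (preimage_inf_le f _ _) _, ← pullFun_res f _ _ (preimage_inf_le f _ _) _,
      ← pullFun_res f _ _ (preimage_inf_le f _ _) _] at this
    · exact this

/-- The pullback of a section along a morphism. -/
def GlobalSection.pullback {L : LineBundle X} (s : L.GlobalSection) (f : Y ⟶ X) :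
    (L.pullback f).GlobalSection where
  s i := pullFun f (V := f ⁻¹ᵁ L.U i) le_rfl (s.s i)
  compat i j := by
    have key : f ⁻¹ᵁ L.U i ⊓ f ⁻¹ᵁ L.U j ≤ f ⁻¹ᵁ (L.U i ⊓ L.U j) := le_rfl
    have := congrArg (pullFun f key) (s.compat i j)
    rw [map_mul, ← pullFun_res f inf_le_left inf_le_left le_rfl key,
      ← pullFun_res f inf_le_right inf_le_right le_rfl key] at this
    exact this

theorem GlobalSection.pullbackVanishes_pullback {L : LineBundle X} (s : L.GlobalSection) (f : Y ⟶ X)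
    (g : W ⟶ Y) : (s.pullback f).PullbackVanishes g ↔ s.PullbackVanishes (g ≫ f) := by
  refine forall_congr' fun i => ?_
  have := Scheme.Hom.appLE_comp_appLE g f (L.U i) (f ⁻¹ᵁ L.U i)
    (g ⁻¹ᵁ (f ⁻¹ᵁ L.U i)) le_rfl le_rfl
  have h := congr($(this) (s.s i))
  exact Iff.of_eq (congrArg (· = 0) h)

/-- Both sides have the same functor of points: a map to `Y` factors through the fibre product
exactly if its composite with `f` factors through `Z`, that is, if the section pulls back to zero.
-/
theorem GlobalSection.IsZeroScheme.of_isPullback {L : LineBundle X} {s : L.GlobalSection}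
    {Z Z' : Scheme.{u}} {i : Z ⟶ X} (hs : s.IsZeroScheme i) {f : Y ⟶ X} {i' : Z' ⟶ Y} {f' : Z' ⟶ Z}
    (h : IsPullback i' f' f i) : (s.pullback f).IsZeroScheme i' := by
  obtain ⟨hi, hu⟩ := hs
  refine ⟨MorphismProperty.of_isPullback h.flip hi, fun T t => ?_⟩
  rw [pullbackVanishes_pullback, ← hu]
  constructor
  · rintro ⟨l, rfl⟩
    exact ⟨l ≫ f', by simp [h.w]⟩
  · rintro ⟨l, hl⟩
    exact ⟨h.lift t l hl.symm, h.lift_fst _ _ _⟩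

end LineBundle

/-- The relative dimension is the rank of the module of differentials, which is well defined over a
nonzero ring. The pullback of cycles takes the dimension as a parameter; this is what makes
`Omega.pull` independent of it. -/
theorem smoothOfRelativeDimension_unique {X Y : Scheme.{u}} (f : X ⟶ Y) {m n : ℕ}
    (hm : SmoothOfRelativeDimension m f) (hn : SmoothOfRelativeDimension n f) [hX : Nonempty X] :
    m = n := by
  obtain ⟨x⟩ := hX
  obtain ⟨U, hU, V, hV, hx, e, h1⟩ := hm.exists_isStandardSmoothOfRelativeDimension x
  have h2 := HasRingHomProperty.appLE (@SmoothOfRelativeDimension n) f hn ⟨U, hU⟩ ⟨V, hV⟩ e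
  obtain ⟨s, hs, h3⟩ := h2
  have : Nontrivial Γ(X, V) := by
    have : Nonempty V := ⟨⟨x, hx⟩⟩
    infer_instance
  -- If all members of `s` were nilpotent, the unit ideal would lie in the nilradical of a nonzero
  -- ring. A non-nilpotent `t` gives a nonzero localization.
  obtain ⟨t, ht, htn⟩ : ∃ t ∈ s, ¬ IsNilpotent t := by
    by_contra! H
    have : Ideal.span s ≤ nilradical _ := Ideal.span_le.mpr fun t ht => H t ht
    rw [hs, top_le_iff, Ideal.eq_top_iff_one] at this
    obtain ⟨k, hk⟩ := this
    simp at hk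
  have : Nontrivial (Localization.Away t) := by
    by_contra H
    rw [not_nontrivial_iff_subsingleton] at H
    have := (IsLocalization.subsingleton_iff (M := Submonoid.powers t) (S := Localization.Away t)).mp H
    exact htn this
  have h4 := h3 t ht
  -- Standard smoothness of dimension `m` passes to the localization where dimension `n` is known,
  -- so both ranks are computed over one ring.
  have h5 := (RingHom.isStandardSmoothOfRelativeDimension_stableUnderCompositionWithLocalizationAway m).right
    (Localization.Away t) t _ h1
  let := ((algebraMap Γ(X, V) (Localization.Away t)).comp (f.appLE U V e).hom).toAlgebra
  have : Algebra.IsStandardSmoothOfRelativeDimension m Γ(Y, U) (Localization.Away t) := h5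
  have : Algebra.IsStandardSmoothOfRelativeDimension n Γ(Y, U) (Localization.Away t) := h4
  have e1 := Algebra.IsStandardSmoothOfRelativeDimension.rank_kaehlerDifferential (R := Γ(Y, U)) (S := Localization.Away t) m
  have e2 := Algebra.IsStandardSmoothOfRelativeDimension.rank_kaehlerDifferential (R := Γ(Y, U)) (S := Localization.Away t) n
  exact_mod_cast e1.symm.trans e2

end

/-! ### The universal property of Ω^*(X → S) -/

section

variable {S : Scheme.{u}}

theorem forall₂_iso_refl {Y : Scheme.{u}} (l : List (LineBundle Y)) :
    List.Forall₂ LineBundle.Iso l l :=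
  List.forall₂_same.mpr fun L _ => LineBundle.Iso.refl L

theorem map_pullback_id {Y : Scheme.{u}} (l : List (LineBundle Y)) :
    l.map (LineBundle.pullback (𝟙 Y)) = l :=
  (List.map_congr_left fun L _ => L.pullback_id).trans l.map_id

theorem map_pullback_comp {Y Y' Y'' : Scheme.{u}} (f : Y' ⟶ Y) (g : Y'' ⟶ Y')
    (l : List (LineBundle Y)) :
    (l.map (LineBundle.pullback f)).map (LineBundle.pullback g) =
      l.map (LineBundle.pullback (g ≫ f)) := by
  rw [List.map_map]
  exact List.map_congr_left fun L _ => L.pullback_comp f g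

theorem comp_left {X Y Z : Sch S} (f : X ⟶ Y) (g : Y ⟶ Z) : (f ≫ g).left = f.left ≫ g.left := rfl

section ClosureLift

variable {G : Type*} {A : Type*} [AddCommGroup G] [AddCommGroup A]

/-- The map induced on the quotient by the subgroup generated by a set. -/
def closureLift {s : Set G} (f : G →+ A) (h : ∀ x ∈ s, f x = 0) : G ⧸ AddSubgroup.closure s →+ A :=
  QuotientAddGroup.lift _ f ((AddSubgroup.closure_le _).mpr h)

theorem closureLift_mk {s : Set G} (f : G →+ A) (h : ∀ x ∈ s, f x = 0) (x : G) :
    closureLift f h (QuotientAddGroup.mk x) = f x := rfl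

theorem mk_eq_zero_of_mem {s : Set G} {x : G} (h : x ∈ s) :
    (QuotientAddGroup.mk x : G ⧸ AddSubgroup.closure s) = 0 :=
  (QuotientAddGroup.eq_zero_iff x).mpr (AddSubgroup.subset_closure h)

end ClosureLift

namespace Cycle

variable {X Y : Sch S}

/-- An isomorphism of bare schemes over `X` is automatically one over `S`, because the maps to `X`
are maps of `S`-schemes. -/
theorem iso_of_left_of_forall₂ {C D : Cycle X} (e : C.V.left ≅ D.V.left)
    (he : e.hom ≫ D.h.left = C.h.left) (hd : C.dim = D.dim) {l : List (LineBundle C.V.left)}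
    (hl : l.Perm (D.bundles.map (LineBundle.pullback e.hom)))
    (hb : List.Forall₂ LineBundle.Iso C.bundles l) : C.Iso D := by
  refine ⟨hd, MorphismProperty.Over.isoMk e ?_, ?_, l, hl, hb⟩
  · rw [← MorphismProperty.Over.w D.h, ← MorphismProperty.Over.w C.h, ← he, Category.assoc]
  · exact MorphismProperty.Over.Hom.ext he

theorem iso_of_left {C D : Cycle X} (e : C.V.left ≅ D.V.left)
    (he : e.hom ≫ D.h.left = C.h.left) (hd : C.dim = D.dim)
    (hb : C.bundles.Perm (D.bundles.map (LineBundle.pullback e.hom))) : C.Iso D :=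
  iso_of_left_of_forall₂ e he hd hb (forall₂_iso_refl _)

theorem withBundles_iso (C : Cycle X) {l l' : List (LineBundle C.V.left)} (h : l.Perm l') :
    (C.withBundles l).Iso (C.withBundles l') :=
  iso_of_left (CategoryTheory.Iso.refl _) (Category.id_comp _) rfl
    ((map_pullback_id l').symm ▸ h)

/-- Two empty open subsets are complementary in an empty scheme. The resulting relation [∅] = [∅] +
[∅] makes cycles with empty source vanish, whatever value their field `dim` has. -/
theorem isDisjointUnion_self (C : Cycle X) [IsEmpty C.V.left] : C.IsDisjointUnion C C := by
  refine ⟨𝟙 _, 𝟙 _, ?_, ?_, ?_⟩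
  · refine nonempty_isColimit_binaryCofanMk_of_isCompl (𝟙 C.V.left) (𝟙 C.V.left) ?_
    have : Subsingleton C.V.left.Opens :=
      ⟨fun a b => TopologicalSpace.Opens.ext (Subsingleton.elim _ _)⟩
    constructor
    · rw [disjoint_iff]
      exact Subsingleton.elim _ _
    · rw [codisjoint_iff]
      exact Subsingleton.elim _ _
  · exact ⟨Category.id_comp _, rfl, (map_pullback_id _).symm⟩
  · exact ⟨Category.id_comp _, rfl, (map_pullback_id _).symm⟩

end Cycle

namespace Omega

variable {X : Sch S}

/-- The relations that a function on cobordism cycles with values in the additive maps out of the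
Lazard ring has to satisfy in order to induce an additive map on `Ω^*(X ⟶ S)`. -/
structure Respects {A : Type v} [AddCommGroup A] (φ : Cycle X → LazardRing →+ A) : Prop where
  iso : ∀ C D, C.Iso D → φ C = φ D
  disjointUnion : ∀ C C₁ C₂, C.IsDisjointUnion C₁ C₂ → φ C = φ C₁ + φ C₂
  dim : ∀ C, C.IsDimCycle → φ C = 0
  sect : ∀ C D, C.IsSectPair D → φ C = φ D
  fgl : ∀ (C : Cycle X) (Ls : List (LineBundle C.V.left)) (L M : LineBundle C.V.left) (a : LazardRing),
    ∑ i ∈ Finset.range (C.dim + 1), ∑ j ∈ Finset.range (C.dim + 1),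
      φ (C.withBundles (Ls ++ List.replicate i L ++ List.replicate j M)) (a * LazardRing.a i j) =
    φ (C.withBundles (Ls ++ [L.tensor M])) a

section Lift

variable {A : Type v} [AddCommGroup A] {φ : Cycle X → LazardRing →+ A} (hφ : Respects φ)

/-- The map on `ZSect X` induced by a function that respects the relations. -/
def zsectLift : ZSect X →+ LazardRing →+ A :=
  -- One lift for each successive quotient: disjoint unions innermost, then R^Dim, then R^Sect.
  closureLift (closureLift (closureLift (FreeAbelianGroup.lift (Quot.lift φ hφ.iso))
    (by
      rintro _ ⟨C, C₁, C₂, h, rfl⟩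
      simpa [sub_eq_zero] using hφ.disjointUnion C C₁ C₂ h))
    (by
      rintro _ ⟨C, h, rfl⟩
      refine (closureLift_mk _ _ _).trans ?_
      simpa using hφ.dim C h))
    (by
      rintro _ ⟨C, D, h, rfl⟩
      rw [map_sub, sub_eq_zero]
      refine (closureLift_mk _ _ _).trans ((closureLift_mk _ _ _).trans ?_)
      refine .trans ?_ ((closureLift_mk _ _ _).trans (closureLift_mk _ _ _)).symm
      simpa using hφ.sect C D h)

theorem zsectLift_cls (C : Cycle X) : zsectLift hφ (ZSect.cls C) = φ C := by
  refine (closureLift_mk _ _ _).trans ((closureLift_mk _ _ _).trans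
    ((closureLift_mk _ _ _).trans ?_))
  simp

/-- The map on `𝕃 ⊗ ZSect X` induced by a function that respects the relations. -/
def tensorLift : LazardRing ⊗[ℤ] ZSect X →+ A :=
  TensorProduct.liftAddHom (zsectLift hφ).flip (fun r m n => by
    rw [AddMonoidHom.flip_apply, AddMonoidHom.flip_apply, map_zsmul, map_zsmul,
      AddMonoidHom.zsmul_apply])

theorem tensorLift_tmul (a : LazardRing) (C : Cycle X) :
    tensorLift hφ (a ⊗ₜ[ℤ] ZSect.cls C) = φ C a := by
  simp [tensorLift, zsectLift_cls]

/-- The map is only additive, whereas the relations span an 𝕃-submodule. That submodule is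
additively generated by the multiples of the relations, which is why the field `fgl` carries an
arbitrary coefficient. -/
theorem tensorLift_fgl (x : LazardRing ⊗[ℤ] ZSect X) (hx : x ∈ fglSubmodule X) :
    tensorLift hφ x = 0 := by
  induction hx using Submodule.closure_induction with
  | zero => exact map_zero _
  | add x y _ _ hx hy => rw [map_add, hx, hy, add_zero]
  | smul_mem a x h =>
    obtain ⟨C, Ls, L, M, rfl⟩ := h
    simp only [fglElement, smul_sub, Finset.smul_sum, TensorProduct.smul_tmul', smul_eq_mul,
      mul_one, map_sub, map_sum, tensorLift_tmul, sub_eq_zero]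
    exact hφ.fgl C Ls L M a

/-- The map on `Ω^*(X ⟶ S)` induced by a function that respects the relations. -/
def lift : Omega X →+ A :=
  (fglSubmodule X).mkQ.toAddMonoidHom.liftOfSurjective (fglSubmodule X).mkQ_surjective
    ⟨tensorLift hφ, fun x hx => tensorLift_fgl hφ x
      (by simpa using hx)⟩

theorem lift_cls (a : LazardRing) (C : Cycle X) : lift hφ (cls a C) = φ C a := by
  have := (fglSubmodule X).mkQ.toAddMonoidHom.liftOfRightInverse_comp_apply
    _ (Function.rightInverse_surjInv (fglSubmodule X).mkQ_surjective)
    ⟨tensorLift hφ, fun x hx => tensorLift_fgl hφ x (by simpa using hx)⟩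
    (a ⊗ₜ[ℤ] ZSect.cls C)
  exact this.trans (tensorLift_tmul hφ a C)

end Lift

theorem induction {p : Omega X → Prop} (x : Omega X) (zero : p 0)
    (cls : ∀ a C, p (cls a C)) (add : ∀ x y, p x → p y → p (x + y)) : p x := by
  obtain ⟨x, rfl⟩ := (fglSubmodule X).mkQ_surjective x
  induction x using TensorProduct.induction_on with
  | zero => simpa using zero
  | add x y hx hy => rw [map_add]; exact add _ _ hx hy
  | tmul a z =>
    obtain ⟨z, rfl⟩ := QuotientAddGroup.mk_surjective z
    obtain ⟨z, rfl⟩ := QuotientAddGroup.mk_surjective z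
    obtain ⟨z, rfl⟩ := QuotientAddGroup.mk_surjective z
    have key : ∀ z : FreeAbelianGroup (Quot (Cycle.Iso (X := X))), ∀ a : LazardRing,
        p ((fglSubmodule X).mkQ (a ⊗ₜ[ℤ] (QuotientAddGroup.mk (QuotientAddGroup.mk
          (QuotientAddGroup.mk z : Z X) : ZDim X) : ZSect X))) := by
      intro z
      induction z using FreeAbelianGroup.induction_on with
      | zero =>
        intro a
        convert! zero
        simp
      | of q =>
        obtain ⟨C, rfl⟩ := Quot.exists_rep q
        exact fun a => cls a C
      -- The sign is moved into the Lazard coefficient, so that generators need no inverses.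
      | neg q h =>
        intro a
        convert! h (-a) using 1
        simp [TensorProduct.neg_tmul, TensorProduct.tmul_neg]
      | add x y hx hy =>
        intro a
        convert! add _ _ (hx a) (hy a) using 1
        simp [TensorProduct.tmul_add]
    exact key z a

theorem addHom_ext {A : Type*} [AddCommMonoid A] {f g : Omega X →+ A}
    (h : ∀ a C, f (cls a C) = g (cls a C)) : f = g := by
  ext x
  induction x using induction with
  | zero => simp
  | cls a C => exact h a C
  | add x y hx hy => rw [map_add, map_add, hx, hy]

theorem smul_cls (b a : LazardRing) (C : Cycle X) : b • cls a C = cls (b * a) C := by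
  rw [cls, ← map_smul, TensorProduct.smul_tmul', smul_eq_mul, cls]

theorem cls_eq_smul (a : LazardRing) (C : Cycle X) : cls a C = a • cls 1 C := by
  rw [smul_cls, mul_one]

theorem cls_add (a b : LazardRing) (C : Cycle X) : cls (a + b) C = cls a C + cls b C := by
  simp [cls, TensorProduct.add_tmul]

theorem cls_zero (C : Cycle X) : cls 0 C = 0 := by
  simp [cls]

/-- The additive map `a ↦ a ⊗ [V ⟶ X; L₁, …, L_r]`. -/
def clsHom (C : Cycle X) : LazardRing →+ Omega X where
  toFun a := cls a C
  map_zero' := cls_zero C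
  map_add' a b := cls_add a b C

theorem clsHom_apply (C : Cycle X) (a : LazardRing) : clsHom C a = cls a C := rfl

theorem cls_congr {C D : Cycle X} (h : C.Iso D) (a : LazardRing) : cls a C = cls a D := by
  have : ZSect.cls C = ZSect.cls D := by
    rw [ZSect.cls, ZDim.cls, Z.cls, Quot.sound h, ← Z.cls, ← ZDim.cls, ← ZSect.cls]
  rw [cls, this, cls]

theorem cls_disjointUnion {C C₁ C₂ : Cycle X} (h : C.IsDisjointUnion C₁ C₂) (a : LazardRing) :
    cls a C = cls a C₁ + cls a C₂ := by
  have h1 : Z.cls C = Z.cls C₁ + Z.cls C₂ :=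
    sub_eq_zero.mp (mk_eq_zero_of_mem ⟨C, C₁, C₂, h, rfl⟩)
  have h2 : ZSect.cls C = ZSect.cls C₁ + ZSect.cls C₂ := by
    simp only [ZSect.cls, ZDim.cls, h1]
    rfl
  rw [cls, h2, TensorProduct.tmul_add, map_add, cls, cls]

theorem cls_of_isDimCycle {C : Cycle X} (h : C.IsDimCycle) (a : LazardRing) : cls a C = 0 := by
  have h1 : ZDim.cls C = 0 := mk_eq_zero_of_mem ⟨C, h, rfl⟩
  have h2 : ZSect.cls C = 0 := by
    rw [ZSect.cls, h1]
    rfl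
  rw [cls, h2, TensorProduct.tmul_zero, map_zero]

theorem cls_of_isSectPair {C D : Cycle X} (h : C.IsSectPair D) (a : LazardRing) :
    cls a C = cls a D := by
  have h1 : ZSect.cls C = ZSect.cls D := by
    have : (QuotientAddGroup.mk (ZDim.cls C - ZDim.cls D) : ZSect X) = 0 :=
      mk_eq_zero_of_mem ⟨C, D, h, rfl⟩
    exact sub_eq_zero.mp this
  rw [cls, h1, cls]

theorem cls_fgl (C : Cycle X) (Ls : List (LineBundle C.V.left)) (L M : LineBundle C.V.left)
    (a : LazardRing) :
    ∑ i ∈ Finset.range (C.dim + 1), ∑ j ∈ Finset.range (C.dim + 1), cls (a * LazardRing.a i j)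
      (C.withBundles (Ls ++ List.replicate i L ++ List.replicate j M)) =
    cls a (C.withBundles (Ls ++ [L.tensor M])) := by
  have h : (fglSubmodule X).mkQ (a • (fglElement C Ls L M -
      1 ⊗ₜ[ℤ] ZSect.cls (C.withBundles (Ls ++ [L.tensor M])))) = 0 := by
    rw [Submodule.mkQ_apply, Submodule.Quotient.mk_eq_zero]
    exact Submodule.smul_mem _ _ (Submodule.subset_span ⟨C, Ls, L, M, rfl⟩)
  rw [← sub_eq_zero, ← h]
  simp only [fglElement, smul_sub, Finset.smul_sum, TensorProduct.smul_tmul', smul_eq_mul,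
      mul_one, map_sub, map_sum]
  rfl

theorem cls_of_isEmpty (C : Cycle X) [IsEmpty C.V.left] (a : LazardRing) : cls a C = 0 := by
  simpa using cls_disjointUnion C.isDisjointUnion_self a

/-- The additive map `a ↦ a • x`. -/
def smulHom {A : Type v} [AddCommGroup A] [Module LazardRing A] (x : A) : LazardRing →+ A where
  toFun a := a • x
  map_zero' := zero_smul _ x
  map_add' a b := add_smul a b x

theorem smulHom_apply {A : Type v} [AddCommGroup A] [Module LazardRing A] (x : A)
    (a : LazardRing) : smulHom x a = a • x := rfl

/-- The relations for a function on cobordism cycles with values in an `𝕃`-module. -/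
theorem Respects.of_module {A : Type v} [AddCommGroup A] [Module LazardRing A] {ψ : Cycle X → A}
    (iso : ∀ C D, C.Iso D → ψ C = ψ D)
    (disjointUnion : ∀ C C₁ C₂, C.IsDisjointUnion C₁ C₂ → ψ C = ψ C₁ + ψ C₂)
    (dim : ∀ C, C.IsDimCycle → ψ C = 0)
    (sect : ∀ C D, C.IsSectPair D → ψ C = ψ D)
    (fgl : ∀ (C : Cycle X) (Ls : List (LineBundle C.V.left)) (L M : LineBundle C.V.left),
      ∑ i ∈ Finset.range (C.dim + 1), ∑ j ∈ Finset.range (C.dim + 1), LazardRing.a i j •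
        ψ (C.withBundles (Ls ++ List.replicate i L ++ List.replicate j M)) =
      ψ (C.withBundles (Ls ++ [L.tensor M]))) :
    Respects fun C => smulHom (ψ C) where
  iso C D h := by rw [iso C D h]
  disjointUnion C C₁ C₂ h := by
    ext a
    simp [smulHom_apply, disjointUnion C C₁ C₂ h]
  dim C h := by
    ext a
    simp [smulHom_apply, dim C h]
  sect C D h := by rw [sect C D h]
  fgl C Ls L M a := by
    simp only [smulHom_apply, mul_smul, ← Finset.smul_sum, fgl]

section LiftModule

variable {A : Type v} [AddCommGroup A] [Module LazardRing A] {ψ : Cycle X → A}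
  (hψ : Respects fun C => smulHom (ψ C))

/-- The linear map on `Ω^*(X ⟶ S)` induced by a function with values in an `𝕃`-module. -/
def liftModule : Omega X →ₗ[LazardRing] A where
  toFun := lift hψ
  map_add' := map_add _
  map_smul' b x := by
    induction x using induction with
    | zero => simp
    | cls a C => simp [smul_cls, lift_cls, smulHom_apply, mul_smul]
    | add x y hx hy => rw [smul_add, map_add, hx, hy, map_add, smul_add]

theorem liftModule_cls (a : LazardRing) (C : Cycle X) : liftModule hψ (cls a C) = a • ψ C :=
  lift_cls hψ a C

end LiftModule

end Omega

end

section

variable {S : Scheme.{u}}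

/-! ## Auxiliary facts on fibre products and coproducts -/

theorem isPullback_fib {V X Y : Sch S} (h : V ⟶ Y) (f : X ⟶ Y) :
    IsPullback (fibFst h f).left (fibSnd h f).left h.left f.left :=
  IsPullback.of_hasPullback h.left f.left

theorem isPullback_prod (X Y : Sch S) :
    IsPullback (fst X Y).left (snd X Y).left X.hom Y.hom :=
  IsPullback.of_hasPullback X.hom Y.hom

/-- The morphism of fibre products induced by a morphism over `Y`. -/
def fibMap {V V' X Y : Sch S} {h : V ⟶ Y} {h' : V' ⟶ Y} (i : V' ⟶ V) (hi : i ≫ h = h')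
    (f : X ⟶ Y) : fib h' f ⟶ fib h f :=
  MorphismProperty.Over.homMk
    ((isPullback_fib h f).lift ((fibFst h' f).left ≫ i.left) (fibSnd h' f).left (by
      rw [← (isPullback_fib h' f).w, ← hi, Category.assoc]
      rfl))
    (by
      change _ ≫ (fibSnd h f).left ≫ X.hom = (fibSnd h' f).left ≫ X.hom
      rw [IsPullback.lift_snd_assoc]) trivial

section FibMap

variable {V V' X Y : Sch S} {h : V ⟶ Y} {h' : V' ⟶ Y} (i : V' ⟶ V) (hi : i ≫ h = h') (f : X ⟶ Y)

theorem fibMap_fibFst : fibMap i hi f ≫ fibFst h f = fibFst h' f ≫ i :=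
  MorphismProperty.Over.Hom.ext ((isPullback_fib h f).lift_fst _ _ _)

theorem fibMap_fibSnd : fibMap i hi f ≫ fibSnd h f = fibSnd h' f :=
  MorphismProperty.Over.Hom.ext ((isPullback_fib h f).lift_snd _ _ _)

theorem isPullback_fibMap :
    IsPullback (fibMap i hi f).left (fibFst h' f).left (fibFst h f).left i.left := by
  refine IsPullback.of_right (h₁₂ := (fibSnd h f).left) (v₁₃ := f.left) (h₂₂ := h.left) ?_ ?_
    (isPullback_fib h f).flip
  · rw [← comp_left, ← comp_left, fibMap_fibSnd, hi]
    exact (isPullback_fib h' f).flip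
  · rw [← comp_left, ← comp_left, fibMap_fibFst]

end FibMap

/-- Schemes form a finitary extensive category, so binary coproducts are van Kampen and stay
coproducts after base change. -/
theorem isColimit_of_isPullback {A B V A' B' V' : Scheme.{u}} {j : A ⟶ V} {k : B ⟶ V}
    (h : Nonempty (IsColimit (BinaryCofan.mk j k))) {f : V' ⟶ V} {j' : A' ⟶ V'} {k' : B' ⟶ V'}
    {a : A' ⟶ A} {b : B' ⟶ B} (ha : IsPullback j' a f j) (hb : IsPullback k' b f k) :
    Nonempty (IsColimit (BinaryCofan.mk j' k')) :=
  ((BinaryCofan.isVanKampen_iff _).mp (FinitaryExtensive.vanKampen _ h.some)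
    (BinaryCofan.mk j' k') a b f ha.w.symm hb.w.symm).mpr ⟨ha, hb⟩

theorem isEmpty_of_hom {X Y : Scheme.{u}} (f : X ⟶ Y) [IsEmpty Y] : IsEmpty X :=
  Function.isEmpty f

theorem perm_of_coe_eq {α : Type*} {l l' : List α} (h : (l : Multiset α) = l') : l.Perm l' :=
  Multiset.coe_eq_coe.mp h

namespace Cycle

variable {X : Sch S} {V V₁ V₂ : Sch S} {h : V ⟶ X} {h₁ : V₁ ⟶ X} {h₂ : V₂ ⟶ X}
  {p : IsProper h.left} {p₁ : IsProper h₁.left} {p₂ : IsProper h₂.left} {d d₁ d₂ : ℕ}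
  {s : SmoothOfRelativeDimension d V.hom} {s₁ : SmoothOfRelativeDimension d₁ V₁.hom}
  {s₂ : SmoothOfRelativeDimension d₂ V₂.hom} {l : List (LineBundle V.left)}
  {l₁ : List (LineBundle V₁.left)} {l₂ : List (LineBundle V₂.left)}

/-- Here and in the lemmas below cycles are written as explicit tuples, so that the results unify
with cycles produced by unfolding an operation. -/
theorem iso_mk_of_forall₂ (e : V.left ⟶ V₁.left) (hi : IsIso e) (he : e ≫ h₁.left = h.left)
    (hd : d = d₁) {m : List (LineBundle V.left)} (hm : m.Perm (l₁.map (LineBundle.pullback e)))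
    (hb : List.Forall₂ LineBundle.Iso l m) :
    (⟨V, h, p, d, s, l⟩ : Cycle X).Iso ⟨V₁, h₁, p₁, d₁, s₁, l₁⟩ :=
  iso_of_left_of_forall₂ (C := ⟨V, h, p, d, s, l⟩) (D := ⟨V₁, h₁, p₁, d₁, s₁, l₁⟩) (asIso e) he hd
    hm hb

theorem iso_mk (e : V.left ⟶ V₁.left) (hi : IsIso e) (he : e ≫ h₁.left = h.left)
    (hd : d = d₁) (hm : l.Perm (l₁.map (LineBundle.pullback e))) :
    (⟨V, h, p, d, s, l⟩ : Cycle X).Iso ⟨V₁, h₁, p₁, d₁, s₁, l₁⟩ :=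
  iso_mk_of_forall₂ e hi he hd hm (forall₂_iso_refl _)

theorem iso_mk_of_perm {p' s'} {l' : List (LineBundle V.left)} (hl : l.Perm l') :
    (⟨V, h, p, d, s, l⟩ : Cycle X).Iso ⟨V, h, p', d, s', l'⟩ :=
  withBundles_iso (⟨V, h, p, d, s, l⟩ : Cycle X) hl

theorem isDisjointUnion_mk (j₁ : V₁ ⟶ V) (j₂ : V₂ ⟶ V)
    (hj : Nonempty (IsColimit (BinaryCofan.mk j₁.left j₂.left))) (h1 : j₁ ≫ h = h₁)
    (h2 : j₂ ≫ h = h₂) (d1 : d₁ = d) (d2 : d₂ = d)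
    (b1 : l₁ = l.map (LineBundle.pullback j₁.left))
    (b2 : l₂ = l.map (LineBundle.pullback j₂.left)) :
    (⟨V, h, p, d, s, l⟩ : Cycle X).IsDisjointUnion ⟨V₁, h₁, p₁, d₁, s₁, l₁⟩
      ⟨V₂, h₂, p₂, d₂, s₂, l₂⟩ :=
  ⟨j₁, j₂, hj, ⟨h1, d1, b1⟩, ⟨h2, d2, b2⟩⟩

theorem isSectPair_mk {Ls : List (LineBundle V.left)} {L : LineBundle V.left} (t : L.GlobalSection)
    (i : V₁ ⟶ V) (hl : l = Ls ++ [L]) (ht : IsTransverseZeroScheme d t i) (hi : i ≫ h = h₁)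
    (hd : IsEmpty V₁.left ∨ d₁ + 1 = d) (h5 : l₁ = Ls.map (LineBundle.pullback i.left)) :
    (⟨V, h, p, d, s, l⟩ : Cycle X).IsSectPair ⟨V₁, h₁, p₁, d₁, s₁, l₁⟩ :=
  ⟨Ls, L, t, i, hl, ht, hi, hd, h5⟩

theorem isDimCycle_mk {T : Sch S} (π : V ⟶ T) (hπ : Smooth π.left) {e : ℕ}
    (hT : SmoothOfRelativeDimension e T.hom) {Ls : List (LineBundle T.left)}
    {Ms : List (LineBundle V.left)} (he : e < Ls.length)
    (hl : l = Ls.map (LineBundle.pullback π.left) ++ Ms) :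
    (⟨V, h, p, d, s, l⟩ : Cycle X).IsDimCycle :=
  ⟨T, π, e, Ls, Ms, hπ, hT, he, hl⟩

end Cycle

theorem perm_append_append_singleton {α : Type*} (l l' l'' : List α) (x : α) :
    (l ++ [x] ++ l' ++ l'').Perm (l ++ l' ++ l'' ++ [x]) := by
  refine perm_of_coe_eq ?_
  simp only [← Multiset.coe_add]
  abel

theorem perm_append_singleton_swap {α : Type*} (l : List α) (x y : α) :
    (l ++ [x] ++ [y]).Perm (l ++ [y] ++ [x]) := by
  refine perm_of_coe_eq ?_
  simp only [← Multiset.coe_add]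
  abel

/-! ## Operations on cobordism cycles and the relations -/

namespace Omega

variable {X Y : Sch S}

/-- `IsDimCycle` asks for the bundles from the base to come first; isomorphism of cycles ignores the
order, so they may stand anywhere. -/
theorem cls_eq_zero_of_perm {V T : Sch S} {h : V ⟶ X} {p d s} {l : List (LineBundle V.left)}
    (π : V ⟶ T) (hπ : Smooth π.left) {e : ℕ}
    (hT : SmoothOfRelativeDimension e T.hom) {Ls : List (LineBundle T.left)}
    {Ms : List (LineBundle V.left)} (he : e < Ls.length)
    (hl : l.Perm (Ls.map (LineBundle.pullback π.left) ++ Ms)) (a : LazardRing) :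
    cls a (⟨V, h, p, d, s, l⟩ : Cycle X) = 0 := by
  refine (cls_congr (Cycle.iso_mk_of_perm (p' := p) (s' := s) hl) a).trans ?_
  exact cls_of_isDimCycle (Cycle.isDimCycle_mk π hπ hT he rfl) a

/-- For bundles pulled back along a smooth `π` the formal group law may be cut off at the dimension
`e` of the base instead of that of the source: more than `e` copies of a bundle from `T` give zero
by R^Dim. Pullback and its larger source dimension need this. -/
theorem cls_fgl_of_smooth (E : Cycle X) {T : Sch S} (π : E.V ⟶ T) (hπ : Smooth π.left) {e : ℕ}
    (hT : SmoothOfRelativeDimension e T.hom) (he : e ≤ E.dim) (Ls : List (LineBundle E.V.left))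
    (L M : LineBundle T.left) (a : LazardRing) :
    ∑ i ∈ Finset.range (e + 1), ∑ j ∈ Finset.range (e + 1), cls (a * LazardRing.a i j)
      (E.withBundles (Ls ++ List.replicate i (L.pullback π.left) ++
        List.replicate j (M.pullback π.left))) =
    cls a (E.withBundles (Ls ++ [(L.pullback π.left).tensor (M.pullback π.left)])) := by
  have hsub : Finset.range (e + 1) ⊆ Finset.range (E.dim + 1) :=
    Finset.range_subset_range.mpr (by lia)
  rw [← cls_fgl]
  rw [← Finset.sum_subset hsub]
  -- Terms with `i ≤ e < j`: the copies of `M` supply the R^Dim relation.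
  · refine Finset.sum_congr rfl fun i _ => Finset.sum_subset hsub fun j _ hj => ?_
    refine cls_eq_zero_of_perm π hπ hT (Ls := List.replicate j M)
      (Ms := Ls ++ List.replicate i (L.pullback π.left)) ?_ ?_ _
    · rw [List.length_replicate]
      exact Nat.lt_of_succ_le (not_lt.mp (mt Finset.mem_range.mpr hj))
    · rw [List.map_replicate]
      exact List.perm_append_comm
  -- Terms with `e < i`, for every `j`: the copies of `L` supply it.
  · intro i _ hi
    refine Finset.sum_eq_zero fun j _ => cls_eq_zero_of_perm π hπ hT (Ls := List.replicate i L)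
      (Ms := Ls ++ List.replicate j (M.pullback π.left)) ?_ ?_ _
    · rw [List.length_replicate]
      exact Nat.lt_of_succ_le (not_lt.mp (mt Finset.mem_range.mpr hi))
    · rw [List.map_replicate]
      refine perm_of_coe_eq ?_
      simp only [← Multiset.coe_add]
      abel

/-! ### Pushforward -/

theorem respects_push (f : X ⟶ Y) (hf : IsProper f.left) :
    Respects (X := X) fun C => smulHom (cls 1 (C.push f hf)) := by
  refine Respects.of_module ?_ ?_ ?_ ?_ ?_
  · rintro C D ⟨hd, e, he, l, hl, hb⟩
    refine cls_congr (C := C.push f hf) (D := D.push f hf) ⟨hd, e, ?_, l, hl, hb⟩ 1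
    exact (Category.assoc _ _ _).symm.trans (congrArg (· ≫ f) he)
  · rintro C C₁ C₂ ⟨j₁, j₂, hj, ⟨h1, h2, h3⟩, ⟨h1', h2', h3'⟩⟩
    refine cls_disjointUnion (Cycle.isDisjointUnion_mk j₁ j₂ hj ?_ ?_ h2 h2' h3 h3') 1
    · rw [← Category.assoc, h1]
    · rw [← Category.assoc, h1']
  · intro C h
    exact cls_of_isDimCycle (C := C.push f hf) h 1
  · rintro C D ⟨Ls, L, s, i, h1, h2, h3, h4, h5⟩
    refine cls_of_isSectPair (Cycle.isSectPair_mk s i h1 h2 ?_ h4 h5) 1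
    rw [← Category.assoc, h3]
  · intro C Ls L M
    simp only [smul_cls, mul_one]
    have := cls_fgl (C.push f hf) Ls L M 1
    simp only [one_mul] at this
    exact this

/-- The pushforward `f_*`. -/
def push (f : X ⟶ Y) (hf : IsProper f.left) : Omega X →ₗ[LazardRing] Omega Y :=
  liftModule (respects_push f hf)

theorem push_cls (f : X ⟶ Y) (hf : IsProper f.left) (a : LazardRing) (C : Cycle X) :
    push f hf (cls a C) = cls a (C.push f hf) :=
  (liftModule_cls _ a C).trans (cls_eq_smul a _).symm

/-! ### Chern operators -/

theorem respects_chern (N : LineBundle X.left) :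
    Respects (X := X) fun C => smulHom (cls 1 (C.chern N)) := by
  refine Respects.of_module ?_ ?_ ?_ ?_ ?_
  · rintro C D ⟨hd, e, he, l, hl, hb⟩
    refine cls_congr (C := C.chern N) (D := D.chern N) ⟨hd, e, he, l ++ [N.pullback C.h.left], ?_,
      List.rel_append hb (forall₂_iso_refl _)⟩ 1
    rw [← he, comp_left, ← LineBundle.pullback_comp]
    exact (hl.append_right _).trans (.of_eq
      (List.map_append (l₁ := D.bundles) (l₂ := [N.pullback D.h.left])).symm)
  · rintro C C₁ C₂ ⟨j₁, j₂, hj, ⟨h1, h2, h3⟩, ⟨h1', h2', h3'⟩⟩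
    refine cls_disjointUnion (Cycle.isDisjointUnion_mk j₁ j₂ hj h1 h1' h2 h2' ?_ ?_) 1
    · rw [List.map_append, List.map_singleton, LineBundle.pullback_comp, ← comp_left, h1, h3]
    · rw [List.map_append, List.map_singleton, LineBundle.pullback_comp, ← comp_left, h1', h3']
  · rintro C ⟨T, π, e, Ls, Ms, hπ, hT, he, h⟩
    refine cls_of_isDimCycle (Cycle.isDimCycle_mk π hπ hT he
      (Ms := Ms ++ [N.pullback C.h.left]) ?_) 1
    rw [h, List.append_assoc]
  · rintro C D ⟨Ls, L, s, i, h1, h2, h3, h4, h5⟩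
    -- R^Sect concerns the last bundle of the list, so the new bundle is moved in front of `L`.
    have e1 : (C.chern N).Iso (C.withBundles (Ls ++ [N.pullback C.h.left] ++ [L])) := by
      refine C.withBundles_iso (perm_of_coe_eq ?_)
      rw [h1]
      simp only [← Multiset.coe_add]
      abel
    rw [cls_congr e1]
    refine cls_of_isSectPair (Cycle.isSectPair_mk s i rfl h2 h3 h4 ?_) 1
    rw [List.map_append, List.map_singleton, LineBundle.pullback_comp, ← comp_left, h3, h5]
  · intro C Ls L M
    simp only [smul_cls, mul_one]
    have := cls_fgl C (Ls ++ [N.pullback C.h.left]) L M 1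
    simp only [one_mul] at this
    refine .trans ?_ (this.trans ?_)
    · refine Finset.sum_congr rfl fun i _ => Finset.sum_congr rfl fun j _ => ?_
      exact cls_congr (Cycle.iso_mk_of_perm (perm_append_append_singleton Ls _ _ _).symm) _
    · exact cls_congr (Cycle.iso_mk_of_perm (perm_append_singleton_swap Ls _ _)) _

/-- The Chern operator `c₁(N)`. -/
def chern (N : LineBundle X.left) : Omega X →ₗ[LazardRing] Omega X :=
  liftModule (respects_chern N)

theorem chern_cls (N : LineBundle X.left) (a : LazardRing) (C : Cycle X) :
    chern N (cls a C) = cls a (C.chern N) :=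
  (liftModule_cls _ a C).trans (cls_eq_smul a _).symm

/-! ### Pullback -/

theorem smooth_fibFst {V : Sch S} (h : V ⟶ Y) (f : X ⟶ Y) {d : ℕ}
    (hf : SmoothOfRelativeDimension d f.left) : Smooth (fibFst h f).left := by
  have := hf.smooth
  exact MorphismProperty.of_isPullback (isPullback_fib h f).flip this

/-- Each datum in a relation is base changed along `fibFst C.h f`, which is smooth because `f` is;
composing it with `π` keeps R^Dim cycles of that form. -/
theorem respects_pull (f : X ⟶ Y) (d : ℕ) (hf : SmoothOfRelativeDimension d f.left) :
    Respects (X := Y) fun C => smulHom (cls 1 (C.pull f d hf)) := by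
  refine Respects.of_module ?_ ?_ ?_ ?_ ?_
  · rintro C D ⟨hd, e, he, l, hl, hb⟩
    have : IsIso e.hom.left :=
      ⟨e.inv.left, by rw [← comp_left, e.hom_inv_id]; rfl, by rw [← comp_left, e.inv_hom_id]; rfl⟩
    have : IsIso (fibMap e.hom he f).left :=
      MorphismProperty.of_isPullback (P := .isomorphisms _) (isPullback_fibMap e.hom he f).flip this
    refine cls_congr (Cycle.iso_mk_of_forall₂ (fibMap e.hom he f).left this ?_
      (congrArg (d + ·) hd) (m := l.map (LineBundle.pullback (fibFst C.h f).left)) ?_ ?_) 1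
    · exact congr($(fibMap_fibSnd e.hom he f).left)
    · refine (hl.map _).trans (.of_eq ?_)
      rw [map_pullback_comp, map_pullback_comp, ← comp_left, ← comp_left, fibMap_fibFst]
    · rw [List.forall₂_map_left_iff, List.forall₂_map_right_iff]
      exact hb.imp fun _ _ h => h.pullback _
  · rintro C C₁ C₂ ⟨j₁, j₂, hj, ⟨h1, h2, h3⟩, ⟨h1', h2', h3'⟩⟩
    refine cls_disjointUnion (Cycle.isDisjointUnion_mk (fibMap j₁ h1 f) (fibMap j₂ h1' f)
      (isColimit_of_isPullback hj (isPullback_fibMap j₁ h1 f) (isPullback_fibMap j₂ h1' f))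
      (fibMap_fibSnd _ _ _) (fibMap_fibSnd _ _ _) (congrArg (d + ·) h2) (congrArg (d + ·) h2')
      ?_ ?_) 1
    · rw [h3, map_pullback_comp, map_pullback_comp, ← comp_left, ← comp_left, fibMap_fibFst]
    · rw [h3', map_pullback_comp, map_pullback_comp, ← comp_left, ← comp_left, fibMap_fibFst]
  · rintro C ⟨T, π, e, Ls, Ms, hπ, hT, he, h⟩
    refine cls_of_isDimCycle (Cycle.isDimCycle_mk (fibFst C.h f ≫ π) ?_ hT he
      (Ms := Ms.map (LineBundle.pullback (fibFst C.h f).left)) ?_) 1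
    · have := smooth_fibFst C.h f hf
      rw [comp_left]
      infer_instance
    · rw [h, List.map_append, map_pullback_comp, comp_left]
  · rintro C D ⟨Ls, L, s, i, h1, ⟨h2, h2'⟩, h3, h4, h5⟩
    refine cls_of_isSectPair (Cycle.isSectPair_mk
      (Ls := Ls.map (LineBundle.pullback (fibFst C.h f).left))
      (s.pullback (fibFst C.h f).left) (fibMap i h3 f) ?_ ⟨?_, ?_⟩ (fibMap_fibSnd _ _ _) ?_ ?_) 1
    · rw [h1, List.map_append, List.map_singleton]
    · exact h2.of_isPullback (isPullback_fibMap i h3 f)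
    · obtain hE | ⟨m, hm, hZ⟩ := h2'
      · exact .inl (isEmpty_of_hom (fibFst D.h f).left)
      -- Pulling back `D` with its dimension replaced by `m` gives the smoothness of the new zero
      -- scheme; `D.dim` itself is arbitrary if the source of `D` is empty.
      · exact .inr ⟨d + m, by lia,
          (Cycle.pull { D with dim := m, smooth := hZ } f d hf).smooth⟩
    · obtain hE | hd := h4
      · exact .inl (isEmpty_of_hom (fibFst D.h f).left)
      · exact .inr (by lia)
    · rw [h5, map_pullback_comp, map_pullback_comp, ← comp_left, ← comp_left, fibMap_fibFst]
  · intro C Ls L M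
    simp only [smul_cls, mul_one]
    -- The base of the smooth map is the old source `C.V`, so the sum stops at `C.dim` and not at `d
    -- + C.dim`.
    have := cls_fgl_of_smooth (C.pull f d hf) (fibFst C.h f) (smooth_fibFst C.h f hf) C.smooth
      (Nat.le_add_left _ _) (Ls.map (LineBundle.pullback (fibFst C.h f).left)) L M 1
    simp only [one_mul] at this
    refine .trans ?_ (this.trans ?_)
    · refine Finset.sum_congr rfl fun i _ => Finset.sum_congr rfl fun j _ => ?_
      rw [← List.map_replicate, ← List.map_replicate, ← List.map_append, ← List.map_append]
      rfl
    · rw [← LineBundle.pullback_tensor, ← List.map_singleton, ← List.map_append]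
      rfl

/-- The pullback `f^*` along a morphism that is smooth of relative dimension `d`. -/
def pullOfDim (f : X ⟶ Y) (d : ℕ) (hf : SmoothOfRelativeDimension d f.left) :
    Omega Y →ₗ[LazardRing] Omega X :=
  liftModule (respects_pull f d hf)

theorem pullOfDim_cls (f : X ⟶ Y) (d : ℕ) (hf : SmoothOfRelativeDimension d f.left)
    (a : LazardRing) (C : Cycle Y) :
    pullOfDim f d hf (cls a C) = cls a (C.pull f d hf) :=
  (liftModule_cls _ a C).trans (cls_eq_smul a _).symm

/-- The pullback `f^*`. -/
def pull (f : X ⟶ Y) (hf : SmoothEquidim f.left) : Omega Y →ₗ[LazardRing] Omega X :=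
  pullOfDim f hf.choose hf.choose_spec

/-- If `X` is nonempty, the dimension chosen in `pull` is forced to be `d`. If `X` is empty, so are
both sources, and both classes vanish. -/
theorem pull_cls (f : X ⟶ Y) (hf : SmoothEquidim f.left) (d : ℕ)
    (hd : SmoothOfRelativeDimension d f.left) (a : LazardRing) (C : Cycle Y) :
    pull f hf (cls a C) = cls a (C.pull f d hd) := by
  refine (pullOfDim_cls f _ hf.choose_spec a C).trans ?_
  obtain hE | hN := isEmpty_or_nonempty X.left
  · have h1 : IsEmpty (fib C.h f).left := isEmpty_of_hom (fibSnd C.h f).left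
    have : IsEmpty (C.pull f d hd).V.left := h1
    have : IsEmpty (C.pull f _ hf.choose_spec).V.left := h1
    rw [cls_of_isEmpty, cls_of_isEmpty]
  · have h1 := smoothOfRelativeDimension_unique f.left hf.choose_spec hd
    congr! 2

end Omega

end

section

variable {S : Scheme.{u}}

/-! ## The external product -/

theorem sch_hom_ext {X Y : Sch S} {f g : X ⟶ Y} (h : f.left = g.left) : f = g :=
  MorphismProperty.Over.Hom.ext h

theorem fib_w {V X Y : Sch S} (h : V ⟶ Y) (f : X ⟶ Y) : fibFst h f ≫ h = fibSnd h f ≫ f :=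
  sch_hom_ext (isPullback_fib h f).w

section Prod

variable {T X X' X'' Y Y' Y'' : Sch S}

theorem lift_fst (f : T ⟶ X) (g : T ⟶ Y) : lift f g ≫ fst X Y = f :=
  sch_hom_ext (pullback.lift_fst _ _ _)

theorem lift_snd (f : T ⟶ X) (g : T ⟶ Y) : lift f g ≫ snd X Y = g :=
  sch_hom_ext (pullback.lift_snd _ _ _)

theorem prod_hom_ext {f g : T ⟶ prod X Y} (h₁ : f ≫ fst X Y = g ≫ fst X Y)
    (h₂ : f ≫ snd X Y = g ≫ snd X Y) : f = g :=
  sch_hom_ext (pullback.hom_ext congr($(h₁).left) congr($(h₂).left))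

theorem prodMap_fst (f : X ⟶ X') (g : Y ⟶ Y') : prodMap f g ≫ fst X' Y' = fst X Y ≫ f :=
  lift_fst _ _

theorem prodMap_snd (f : X ⟶ X') (g : Y ⟶ Y') : prodMap f g ≫ snd X' Y' = snd X Y ≫ g :=
  lift_snd _ _

theorem prodMap_comp (f : X ⟶ X') (f' : X' ⟶ X'') (g : Y ⟶ Y') (g' : Y' ⟶ Y'') :
    prodMap (f ≫ f') (g ≫ g') = prodMap f g ≫ prodMap f' g' := by
  refine prod_hom_ext ?_ ?_
  · rw [prodMap_fst, Category.assoc, prodMap_fst, ← Category.assoc, ← Category.assoc, prodMap_fst]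
  · rw [prodMap_snd, Category.assoc, prodMap_snd, ← Category.assoc, ← Category.assoc, prodMap_snd]

theorem isProper_prodMap {f : X ⟶ X'} {g : Y ⟶ Y'} (hf : IsProper f.left) (hg : IsProper g.left) :
    IsProper (prodMap f g).left :=
  MorphismProperty.pullbackMap (P := @IsProper) hf hg
    (MorphismProperty.Over.w f).symm (MorphismProperty.Over.w g).symm

theorem isProper_id (X : Sch S) : IsProper (𝟙 X : X ⟶ X).left :=
  inferInstanceAs (IsProper (𝟙 X.left))

theorem smooth_snd {d : ℕ} (hX : SmoothOfRelativeDimension d X.hom) :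
    SmoothOfRelativeDimension d (snd X Y).left :=
  (smoothOfRelativeDimension_isStableUnderBaseChange d).of_isPullback (isPullback_prod X Y) hX

theorem smooth_fst {d : ℕ} (hY : SmoothOfRelativeDimension d Y.hom) :
    SmoothOfRelativeDimension d (fst X Y).left :=
  (smoothOfRelativeDimension_isStableUnderBaseChange d).of_isPullback (isPullback_prod X Y).flip hY

end Prod

namespace Cycle

variable {X Y V : Sch S}

/-- Any cartesian square computes the pullback of a cycle. Pullback identities thereby reduce to
pasting squares. -/
theorem iso_pull {C : Cycle Y} {f : X ⟶ Y} {d d' : ℕ} {hf : SmoothOfRelativeDimension d f.left}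
    {h : V ⟶ X} {p s l} (q : V ⟶ C.V) (hq : IsPullback q.left h.left C.h.left f.left)
    (hd : d' = d + C.dim) (hl : l.Perm (C.bundles.map (LineBundle.pullback q.left))) :
    (⟨V, h, p, d', s, l⟩ : Cycle X).Iso (C.pull f d hf) := by
  refine iso_mk (hq.isoIsPullback _ _ (isPullback_fib C.h f)).hom inferInstance
    (IsPullback.isoIsPullback_hom_snd ..) hd ?_
  rw [map_pullback_comp, IsPullback.isoIsPullback_hom_fst]
  exact hl

/-- The analogue for external products: a source that is a fibre product of the two sources over `S`
represents the product once its maps and bundles match. -/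
theorem iso_ext {C : Cycle X} {D : Cycle Y} {d : ℕ} {h : V ⟶ prod X Y} {p s l} (q : V ⟶ C.V)
    (r : V ⟶ D.V) (hq : IsPullback q.left r.left C.V.hom D.V.hom) (h1 : h ≫ fst X Y = q ≫ C.h)
    (h2 : h ≫ snd X Y = r ≫ D.h) (hd : d = D.dim + C.dim)
    (hl : l.Perm (C.bundles.map (LineBundle.pullback q.left) ++
      D.bundles.map (LineBundle.pullback r.left))) :
    (⟨V, h, p, d, s, l⟩ : Cycle (prod X Y)).Iso (C.ext D) := by
  have e : (hq.isoIsPullback _ _ (isPullback_prod C.V D.V)).hom = (lift q r).left := by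
    refine (isPullback_prod C.V D.V).hom_ext ?_ ?_
    · rw [IsPullback.isoIsPullback_hom_fst, ← comp_left, lift_fst]
    · rw [IsPullback.isoIsPullback_hom_snd, ← comp_left, lift_snd]
  refine iso_mk (lift q r).left (e ▸ inferInstance) ?_ hd ?_
  · have : lift q r ≫ prodMap C.h D.h = h := by
      refine prod_hom_ext ?_ ?_
      · rw [Category.assoc, prodMap_fst, ← Category.assoc, lift_fst, h1]
      · rw [Category.assoc, prodMap_snd, ← Category.assoc, lift_snd, h2]
    exact congr($(this).left)
  · rw [List.map_append, map_pullback_comp, map_pullback_comp, ← comp_left, ← comp_left, lift_fst,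
      lift_snd]
    exact hl

end Cycle

namespace Omega

variable {X Y : Sch S}

/-- The composite of the Chern operators of a list of line bundles. -/
def chernList : List (LineBundle X.left) → (Omega X →ₗ[LazardRing] Omega X)
  | [] => LinearMap.id
  | L :: Ls => chernList Ls ∘ₗ chern L

theorem chernList_cls (Ls : List (LineBundle X.left)) (a : LazardRing) (C : Cycle X) :
    chernList Ls (cls a C) =
      cls a (C.withBundles (C.bundles ++ Ls.map (LineBundle.pullback C.h.left))) := by
  induction Ls generalizing C with
  | nil =>
    rw [List.map_nil, List.append_nil]
    rfl
  | cons L Ls ih =>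
    refine (congrArg (chernList Ls) (chern_cls L a C)).trans ((ih (C.chern L)).trans ?_)
    rw [List.map_cons, ← List.singleton_append, ← List.append_assoc]
    rfl

/-- The external product with a cobordism cycle on the left. -/
def extLeft (C : Cycle X) : Omega Y →ₗ[LazardRing] Omega (prod X Y) :=
  push (prodMap C.h (𝟙 Y)) (isProper_prodMap C.proper (isProper_id Y)) ∘ₗ
    chernList (C.bundles.map (LineBundle.pullback (fst C.V Y).left)) ∘ₗ
      pullOfDim (snd C.V Y) C.dim (smooth_snd C.smooth)

/-- The external product with a cobordism cycle on the right. -/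
def extRight (D : Cycle Y) : Omega X →ₗ[LazardRing] Omega (prod X Y) :=
  push (prodMap (𝟙 X) D.h) (isProper_prodMap (isProper_id X) D.proper) ∘ₗ
    chernList (D.bundles.map (LineBundle.pullback (snd X D.V).left)) ∘ₗ
      pullOfDim (fst X D.V) D.dim (smooth_fst D.smooth)

/-- The fibre product of `D.V` with `C.V ×_S Y` over `Y` is `C.V ×_S D.V`, so pushing forward, after
Chern operators and pullback, gives the product cycle. Since it is built from maps on Ω, `extLeft C`
respects the relations in the second variable. -/
theorem extLeft_cls (C : Cycle X) (b : LazardRing) (D : Cycle Y) :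
    extLeft C (cls b D) = cls b (C.ext D) := by
  rw [extLeft, LinearMap.comp_apply, LinearMap.comp_apply, pullOfDim_cls, chernList_cls, push_cls]
  refine cls_congr (Cycle.iso_ext (fibSnd D.h (snd C.V Y) ≫ fst C.V Y) (fibFst D.h (snd C.V Y))
    ?_ ?_ ?_ (Nat.add_comm _ _) ?_) b
  · have := (isPullback_fib D.h (snd C.V Y)).flip.paste_horiz (isPullback_prod C.V Y)
    rwa [MorphismProperty.Over.w] at this
  · dsimp only [Cycle.pull, Cycle.withBundles]
    rw [Category.assoc, prodMap_fst, Category.assoc]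
  · dsimp only [Cycle.pull, Cycle.withBundles]
    rw [Category.assoc, prodMap_snd, Category.comp_id, fib_w]
  · rw [map_pullback_comp, comp_left]
    exact List.perm_append_comm

theorem extRight_cls (a : LazardRing) (C : Cycle X) (D : Cycle Y) :
    extRight D (cls a C) = cls a (C.ext D) := by
  rw [extRight, LinearMap.comp_apply, LinearMap.comp_apply, pullOfDim_cls, chernList_cls, push_cls]
  refine cls_congr (Cycle.iso_ext (fibFst C.h (fst X D.V)) (fibSnd C.h (fst X D.V) ≫ snd X D.V)
    ?_ ?_ ?_ rfl ?_) a
  · have := (isPullback_fib C.h (fst X D.V)).paste_vert (isPullback_prod X D.V)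
    rwa [MorphismProperty.Over.w] at this
  · dsimp only [Cycle.pull, Cycle.withBundles]
    rw [Category.assoc, prodMap_fst, Category.comp_id, fib_w]
  · dsimp only [Cycle.pull, Cycle.withBundles]
    rw [Category.assoc, prodMap_snd, Category.assoc]
  · rw [map_pullback_comp, comp_left]
    exact List.Perm.refl _

/-- On generators `extLeft C` applied to `D` equals `extRight D` applied to `C`, and the latter is
already a map out of `Omega X`. Hence each relation in the first variable is inherited, and no
relation has to be examined again. -/
theorem respects_ext : Respects (X := X) fun C => smulHom (extLeft (Y := Y) C) := by
  have key (C : Cycle X) (b : LazardRing) (D : Cycle Y) :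
      extLeft C (cls b D) = extRight D (cls b C) :=
    (extLeft_cls C b D).trans (extRight_cls b C D).symm
  have ext {f g : Omega Y →ₗ[LazardRing] Omega (prod X Y)}
      (h : ∀ b D, f (cls b D) = g (cls b D)) : f = g :=
    LinearMap.toAddMonoidHom_injective (addHom_ext h)
  refine Respects.of_module ?_ ?_ ?_ ?_ ?_
  · intro C C' h
    refine ext fun b D => ?_
    rw [key, key, cls_congr h]
  · intro C C₁ C₂ h
    refine ext fun b D => ?_
    rw [LinearMap.add_apply, key, key, key, cls_disjointUnion h, map_add]
  · intro C h
    refine ext fun b D => ?_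
    rw [key, cls_of_isDimCycle h, map_zero, LinearMap.zero_apply]
  · intro C C' h
    refine ext fun b D => ?_
    rw [key, key, cls_of_isSectPair h]
  · intro C Ls L M
    refine ext fun b D => ?_
    simp only [LinearMap.sum_apply, LinearMap.smul_apply, key, ← cls_fgl, map_sum]
    simp only [← map_smul, smul_cls, mul_comm]

/-- The external product `×_S`. -/
def ext : Omega X →ₗ[LazardRing] Omega Y →ₗ[LazardRing] Omega (prod X Y) :=
  liftModule respects_ext

theorem ext_cls (a b : LazardRing) (C : Cycle X) (D : Cycle Y) :
    ext (cls a C) (cls b D) = cls (a * b) (C.ext D) := by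
  rw [ext, liftModule_cls, LinearMap.smul_apply, extLeft_cls, smul_cls]

end Omega

end

section

/-! ## The grading of the Lazard ring -/

section Lazard

open MvPowerSeries

/-- The weights of the generators of the Lazard ring. -/
abbrev lazardWeight (p : LazardVar) : ℤ := (p.1.1 : ℤ) + p.1.2 - 1

/-- The grading of the polynomial ring on the generators of the Lazard ring. -/
abbrev polyGr (n : ℤ) : Submodule ℤ (MvPolynomial LazardVar ℤ) :=
  MvPolynomial.weightedHomogeneousSubmodule ℤ lazardWeight n

instance : GradedAlgebra polyGr := MvPolynomial.weightedGradedAlgebra ℤ lazardWeight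

/-- Power series whose coefficients at `d` are homogeneous of degree `|d| - k`. -/
def IsShiftHomogeneous {σ : Type*} (k : ℤ) (f : MvPowerSeries σ (MvPolynomial LazardVar ℤ)) :
    Prop :=
  ∀ d, coeff d f ∈ polyGr (d.degree - k)

section

variable {σ τ : Type*}

theorem isShiftHomogeneous_one :
    IsShiftHomogeneous 0 (1 : MvPowerSeries σ (MvPolynomial LazardVar ℤ)) := by
  classical
  intro d
  rw [coeff_one]
  split_ifs with h
  · subst h
    simpa using MvPolynomial.isWeightedHomogeneous_one ℤ lazardWeight
  · exact zero_mem _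

theorem isShiftHomogeneous_X (s : σ) :
    IsShiftHomogeneous 1 (X s : MvPowerSeries σ (MvPolynomial LazardVar ℤ)) := by
  classical
  intro d
  rw [coeff_X]
  split_ifs with h
  · subst h
    simpa using MvPolynomial.isWeightedHomogeneous_one ℤ lazardWeight
  · exact zero_mem _

theorem IsShiftHomogeneous.mul {k l : ℤ} {f g : MvPowerSeries σ (MvPolynomial LazardVar ℤ)}
    (hf : IsShiftHomogeneous k f) (hg : IsShiftHomogeneous l g) :
    IsShiftHomogeneous (k + l) (f * g) := by
  classical
  intro d
  rw [coeff_mul]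
  refine Submodule.sum_mem _ fun p hp => ?_
  rw [Finset.HasAntidiagonal.mem_antidiagonal] at hp
  have := SetLike.GradedMul.mul_mem (hf p.1) (hg p.2)
  convert! this using 2
  rw [← hp, map_add]
  push_cast
  ring

theorem IsShiftHomogeneous.pow {k : ℤ} {f : MvPowerSeries σ (MvPolynomial LazardVar ℤ)}
    (hf : IsShiftHomogeneous k f) (n : ℕ) : IsShiftHomogeneous (n * k) (f ^ n) := by
  induction n with
  | zero => simpa using isShiftHomogeneous_one
  | succ n ih =>
    rw [pow_succ]
    convert! ih.mul hf using 1
    push_cast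
    ring

theorem IsShiftHomogeneous.finset_prod {ι : Type*} (s : Finset ι) {k : ι → ℤ}
    {f : ι → MvPowerSeries σ (MvPolynomial LazardVar ℤ)} (hf : ∀ i, IsShiftHomogeneous (k i) (f i)) :
    IsShiftHomogeneous (∑ i ∈ s, k i) (∏ i ∈ s, f i) := by
  classical
  induction s using Finset.induction_on with
  | empty => simpa using isShiftHomogeneous_one
  | insert i s hi ih =>
    rw [Finset.prod_insert hi, Finset.sum_insert hi]
    exact (hf i).mul ih

/-- The coefficient of `f` at `d` has degree |d| - k, and a product of |d| series of shift 1 has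
shift |d|; in the coefficient at `e` the two contributions of |d| cancel. -/
theorem IsShiftHomogeneous.subst {k : ℤ} {f : MvPowerSeries σ (MvPolynomial LazardVar ℤ)}
    (hf : IsShiftHomogeneous k f) {a : σ → MvPowerSeries τ (MvPolynomial LazardVar ℤ)}
    (ha : HasSubst a) (ha' : ∀ i, IsShiftHomogeneous 1 (a i)) :
    IsShiftHomogeneous k (f.subst a) := by
  intro e
  rw [coeff_subst ha]
  refine finsum_induction (· ∈ polyGr _) (Submodule.zero_mem _)
    (fun _ _ => Submodule.add_mem _) fun d => ?_
  have h1 : IsShiftHomogeneous (d.degree) (d.prod fun s n => a s ^ n) := by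
    have := IsShiftHomogeneous.finset_prod d.support (fun i => (ha' i).pow (d i))
    convert! this using 1
    rw [Finsupp.degree_apply]
    simp
  have := SetLike.GradedMul.mul_mem (hf d) (h1 e)
  rw [smul_eq_mul]
  convert! this using 2
  ring

end

/-- The linear coefficients 1 fit because their degree i + j - 1 is 0; the constant coefficient is 0
and fits anywhere. -/
theorem genericCoeff_mem (i j : ℕ) : genericCoeff i j ∈ polyGr ((i : ℤ) + j - 1) := by
  rw [genericCoeff]
  split_ifs with h1 h2
  · exact MvPolynomial.isWeightedHomogeneous_X ℤ lazardWeight _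
  · have : (i : ℤ) + j - 1 = 0 := by lia
    rw [this]
    exact SetLike.GradedOne.one_mem
  · exact zero_mem _

theorem isShiftHomogeneous_genericSeries : IsShiftHomogeneous 1 genericSeries := by
  intro d
  have := genericCoeff_mem (d 0) (d 1)
  convert! this using 2
  simp [Finsupp.degree_eq_sum]

theorem isShiftHomogeneous_genericAssocLeft : IsShiftHomogeneous 1 genericAssocLeft := by
  refine isShiftHomogeneous_genericSeries.subst
    (HasSubst.cons_subst_zero_left 0 1 2 LazardRing.constantCoeff_genericSeries) fun i => ?_
  fin_cases i
  · refine isShiftHomogeneous_genericSeries.subst HasSubst.X_X fun i => ?_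
    fin_cases i <;> exact isShiftHomogeneous_X _
  · exact isShiftHomogeneous_X _

theorem isShiftHomogeneous_genericAssocRight : IsShiftHomogeneous 1 genericAssocRight := by
  refine isShiftHomogeneous_genericSeries.subst
    (HasSubst.cons_subst_zero_right 0 1 2 LazardRing.constantCoeff_genericSeries) fun i => ?_
  fin_cases i
  · exact isShiftHomogeneous_X _
  · refine isShiftHomogeneous_genericSeries.subst HasSubst.X_X fun i => ?_
    fin_cases i <;> exact isShiftHomogeneous_X _

/-- Giving both variables degree -1 makes the generic series homogeneous of degree -1. Both ways of
associating it then have shift 1, so each generator is a difference of two elements of equal degree.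
-/
theorem isHomogeneous_lazardIdeal : lazardIdeal.IsHomogeneous polyGr := by
  refine Ideal.homogeneous_span _ _ ?_
  rintro x (⟨d, rfl⟩ | ⟨i, j, rfl⟩)
  · exact ⟨_, sub_mem (isShiftHomogeneous_genericAssocLeft d)
      (isShiftHomogeneous_genericAssocRight d)⟩
  · refine ⟨(i : ℤ) + j - 1, sub_mem (genericCoeff_mem i j) ?_⟩
    rw [add_comm (i : ℤ)]
    exact genericCoeff_mem j i

namespace LazardRing

/-- The projection of the Lazard ring to the elements of degree `n`. -/
def component (n : ℤ) : LazardRing →+ LazardRing :=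
  QuotientAddGroup.map (Submodule.toAddSubgroup lazardIdeal) (Submodule.toAddSubgroup lazardIdeal)
    (GradedRing.proj polyGr n) fun _ hx => isHomogeneous_lazardIdeal n hx

theorem proj_surjective : Function.Surjective proj := Ideal.Quotient.mk_surjective

theorem component_of_mem {n : ℤ} {x : LazardRing} (hx : x ∈ gr n) : component n x = x := by
  obtain ⟨y, hy, rfl⟩ := hx
  exact congrArg proj (DirectSum.decompose_of_mem_same polyGr hy)

theorem component_of_mem_ne {m n : ℤ} {x : LazardRing} (hx : x ∈ gr n) (h : n ≠ m) :
    component m x = 0 := by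
  obtain ⟨y, hy, rfl⟩ := hx
  exact (congrArg proj (DirectSum.decompose_of_mem_ne polyGr hy h)).trans (map_zero _)

theorem a_eq (i j : ℕ) : a i j = proj (genericCoeff i j) := by
  rw [a]
  change coeff _ (genericSeries.map proj) = _
  rw [coeff_map]
  change proj (genericCoeff _ _) = _
  simp

theorem a_mem (i j : ℕ) : a i j ∈ gr ((i : ℤ) + j - 1) :=
  ⟨_, genericCoeff_mem i j, (a_eq i j).symm⟩

theorem one_mem : (1 : LazardRing) ∈ gr 0 := ⟨1, SetLike.GradedOne.one_mem (A := polyGr), map_one proj⟩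

theorem mul_mem {m n : ℤ} {x y : LazardRing} (hx : x ∈ gr m) (hy : y ∈ gr n) :
    x * y ∈ gr (m + n) := by
  obtain ⟨x, hx, rfl⟩ := hx
  obtain ⟨y, hy, rfl⟩ := hy
  exact ⟨x * y, SetLike.GradedMul.mul_mem (A := polyGr) hx hy, map_mul proj _ _⟩

/-- Multiplication by a homogeneous element shifts the projections. This is the form in which the
coefficients of the formal group law meet the grading. -/
theorem component_mul {m n : ℤ} (x : LazardRing) {y : LazardRing} (hy : y ∈ gr n) :
    component (m + n) (x * y) = component m x * y := by
  obtain ⟨x, rfl⟩ := proj_surjective x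
  obtain ⟨y, hy, rfl⟩ := hy
  have := DirectSum.coe_decompose_mul_add_of_right_mem (i := m) polyGr (a := x) hy
  exact (congrArg proj this).trans (map_mul _ _ _)

theorem mem_iSup_gr (x : LazardRing) : x ∈ ⨆ n, gr n := by
  classical
  obtain ⟨x, rfl⟩ := proj_surjective x
  rw [← DirectSum.sum_support_decompose polyGr x, map_sum]
  exact sum_mem fun n _ => AddSubgroup.mem_iSup_of_mem n ⟨_, SetLike.coe_mem _, rfl⟩

end LazardRing

end Lazard

end

section

variable {S : Scheme.{u}}

/-! ## The grading of `Ω^*(X ⟶ S)` -/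

namespace Cycle

variable {X : Sch S}

/-- The degree `r - dim (V/S)` of a cobordism cycle. -/
def deg (C : Cycle X) : ℤ := C.bundles.length - C.dim

theorem Iso.deg_eq {C D : Cycle X} (h : C.Iso D) : C.deg = D.deg := by
  obtain ⟨hd, e, -, l, hl, hb⟩ := h
  have h1 := hb.length_eq
  have h2 := hl.length_eq
  rw [List.length_map] at h2
  rw [deg, deg, hd, h1, h2]

theorem IsRestriction.deg_eq {C D : Cycle X} {j : D.V ⟶ C.V} (h : C.IsRestriction D j) :
    D.deg = C.deg := by
  rw [deg, deg, h.2.1, h.2.2, List.length_map]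

/-- One bundle and one dimension are lost at the same time. An empty zero scheme may carry any
dimension, hence the exception. -/
theorem IsSectPair.deg_eq {C D : Cycle X} (h : C.IsSectPair D) :
    IsEmpty D.V.left ∨ C.deg = D.deg := by
  obtain ⟨Ls, L, s, i, h1, -, -, h4, h5⟩ := h
  refine h4.imp_right fun h4 => ?_
  rw [deg, deg, h1, h5, ← h4, List.length_append, List.length_map, List.length_singleton]
  push_cast
  ring

end Cycle

namespace Omega

variable {X : Sch S}

/-- A generator a ⊗ C has degree deg C minus the degree of a, so its part in degree n comes from the
part of a in degree deg C - n. The relations are homogeneous, so this is compatible with them. The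
construction is additive but not 𝕃-linear, which is why `Respects` allows values in additive maps.
-/
theorem respects_component (n : ℤ) :
    Respects (X := X) fun C => (clsHom C).comp (LazardRing.component (C.deg - n)) := by
  constructor
  · intro C D h
    ext a
    rw [h.deg_eq]
    exact cls_congr h _
  · rintro C C₁ C₂ h
    obtain ⟨j₁, j₂, -, h1, h2⟩ := id h
    ext a
    rw [h1.deg_eq, h2.deg_eq]
    exact cls_disjointUnion h _
  · intro C h
    ext a
    exact cls_of_isDimCycle h _
  · intro C D h
    ext a
    obtain hE | h1 := h.deg_eq
    -- With `D` empty both classes are zero for all coefficients, so the mismatch of degrees does no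
    -- harm.
    · exact (cls_of_isSectPair h _).trans ((cls_of_isEmpty D _).trans (cls_of_isEmpty D _).symm)
    · rw [h1]
      exact cls_of_isSectPair h _
  · intro C Ls L M a
    refine Eq.trans ?_ (cls_fgl C Ls L M _)
    refine Finset.sum_congr rfl fun i _ => Finset.sum_congr rfl fun j _ => ?_
    -- The term with `i + j` additional bundles exceeds the tensor term, with one, by `i + j - 1` in
    -- degree; this is the degree of its coefficient.
    rw [AddMonoidHom.comp_apply, ← LazardRing.component_mul _ (LazardRing.a_mem i j), clsHom_apply]
    congr 3
    simp only [Cycle.deg, Cycle.withBundles, List.length_append, List.length_replicate,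
      List.length_singleton]
    push_cast
    ring

/-- The projection of `Ω^*(X ⟶ S)` to `Ω^n(X ⟶ S)`. -/
def component (n : ℤ) : Omega X →+ Omega X := lift (respects_component n)

theorem component_cls (n : ℤ) (a : LazardRing) (C : Cycle X) :
    component n (cls a C) = cls (LazardRing.component (C.deg - n) a) C :=
  lift_cls (respects_component n) a C

theorem cls_mem {n m : ℤ} {a : LazardRing} (ha : a ∈ LazardRing.gr m) (C : Cycle X)
    (h : n = C.bundles.length - C.dim - m) : cls a C ∈ gr X n :=
  AddSubgroup.subset_closure ⟨m, a, C, ha, h, rfl⟩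

theorem map_mem_of_cls {A : Type*} [AddCommGroup A] {n : ℤ} {B : AddSubgroup A} (f : Omega X →+ A)
    (h : ∀ (m : ℤ) (a : LazardRing) (C : Cycle X), a ∈ LazardRing.gr m →
      n = C.bundles.length - C.dim - m → f (cls a C) ∈ B) {x : Omega X} (hx : x ∈ gr X n) :
    f x ∈ B := by
  have : gr X n ≤ B.comap f := by
    refine (AddSubgroup.closure_le _).mpr ?_
    rintro _ ⟨m, a, C, ha, hn, rfl⟩
    exact h m a C ha hn
  exact this hx

theorem component_of_mem {n : ℤ} {x : Omega X} (hx : x ∈ gr X n) : component n x = x := by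
  rw [← sub_eq_zero, ← AddSubgroup.mem_bot]
  refine map_mem_of_cls (component n - AddMonoidHom.id _) (fun m a C ha hn => ?_) hx
  rw [AddSubgroup.mem_bot, AddMonoidHom.sub_apply, component_cls, AddMonoidHom.id_apply, sub_eq_zero,
    Cycle.deg, hn, sub_sub_cancel, LazardRing.component_of_mem ha]

theorem component_of_mem_ne {m n : ℤ} (h : m ≠ n) {x : Omega X} (hx : x ∈ gr X m) :
    component n x = 0 := by
  rw [← AddSubgroup.mem_bot]
  refine map_mem_of_cls (component n) (fun k a C ha hn => ?_) hx
  rw [AddSubgroup.mem_bot, component_cls, LazardRing.component_of_mem_ne ha, cls_zero]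
  rw [Cycle.deg]
  lia

theorem component_coe (n : ℤ) (x : DirectSum ℤ fun n => gr X n) :
    component n (DirectSum.coeAddMonoidHom (gr X) x) = x n := by
  induction x using DirectSum.induction_on with
  | zero => simp
  | of m x =>
    rw [DirectSum.coeAddMonoidHom_of]
    obtain rfl | h := eq_or_ne m n
    · rw [component_of_mem x.2, DirectSum.of_eq_same]
    · rw [component_of_mem_ne h x.2, DirectSum.of_eq_of_ne _ _ _ h.symm]
      rfl
  | add x y hx hy => rw [map_add, map_add, hx, hy]; rfl

/-- The projections `component n` recover the summands, so the sum is direct; it is everything since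
every Lazard coefficient is a sum of homogeneous ones. -/
theorem isInternal (X : Sch S) : DirectSum.IsInternal (gr X) := by
  constructor
  · rw [injective_iff_map_eq_zero]
    intro x hx
    ext n
    rw [← component_coe, hx, map_zero]
    rfl
  · rw [← AddMonoidHom.mrange_eq_top, eq_top_iff]
    intro x _
    induction x using induction with
    | zero => exact zero_mem _
    | add x y hx hy => exact add_mem (hx trivial) (hy trivial)
    | cls a C =>
      induction LazardRing.mem_iSup_gr a using AddSubgroup.iSup_induction' with
      | h1 => rw [cls_zero]; exact zero_mem _
      | hadd x y _ _ hx hy => rw [cls_add]; exact add_mem (hx trivial) (hy trivial)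
      | hp m a ha =>
        exact ⟨DirectSum.of (fun n => gr X n) _ ⟨_, cls_mem ha C rfl⟩,
          DirectSum.coeAddMonoidHom_of _ _ _⟩

end Omega

end

section

variable {S : Scheme.{u}}

/-! ## The axioms of an oriented Borel–Moore functor with products -/

theorem perm_append_singleton_append {α : Type*} (l l' : List α) (x : α) :
    (l ++ [x] ++ l').Perm (l ++ l' ++ [x]) := by
  rw [List.append_assoc, List.append_assoc]
  exact List.Perm.append_left _ List.perm_append_comm

theorem isIso_snd_base (X : Sch S) : IsIso (snd (base S) X).left :=
  have : IsIso (base S).hom := inferInstanceAs (IsIso (𝟙 S))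
  (isPullback_prod (base S) X).isIso_snd_of_isIso

/-- The square of the outer product over `Z` factors through that of `Y ×_S Z`; cancelling the lower
square and pasting with `X ×_S Y` leaves the required one. -/
theorem isPullback_prod_assoc (X Y Z : Sch S) :
    IsPullback (fst (prod X Y) Z ≫ fst X Y).left
      (RelCob.lift (fst (prod X Y) Z ≫ snd X Y) (snd (prod X Y) Z)).left X.hom (prod Y Z).hom := by
  have h1 := isPullback_prod (prod X Y) Z
  have h2 := isPullback_prod Y Z
  have e : (RelCob.lift (fst (prod X Y) Z ≫ snd X Y) (snd (prod X Y) Z)).left ≫ (snd Y Z).left =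
    (snd (prod X Y) Z).left := congr($(lift_snd _ _).left)
  rw [← e, ← MorphismProperty.Over.w (snd X Y)] at h1
  have h3 := IsPullback.of_bot h1 congr($((lift_fst (fst (prod X Y) Z ≫ snd X Y)
    (snd (prod X Y) Z)).symm).left) h2
  have h4 := h3.paste_horiz (isPullback_prod X Y)
  rwa [MorphismProperty.Over.w (fst Y Z)] at h4

/-- f × g is the composite of f × id and id × g, which are base changes of `f` and of `g`. -/
theorem smooth_prodMap {X X' Y Y' : Sch S} {f : X ⟶ X'} {g : Y ⟶ Y'} {d e : ℕ}
    (hf : SmoothOfRelativeDimension d f.left) (hg : SmoothOfRelativeDimension e g.left) :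
    SmoothOfRelativeDimension (d + e) (prodMap f g).left := by
  have h1 : IsPullback (fst X Y).left (prodMap f (𝟙 Y)).left f.left (fst X' Y).left := by
    refine IsPullback.of_bot (v₂₁ := (snd X' Y).left) (v₂₂ := X'.hom) (h₃₁ := Y.hom) ?_
      congr($(prodMap_fst f (𝟙 Y)).left).symm (isPullback_prod X' Y)
    rw [MorphismProperty.Over.w, ← comp_left, prodMap_snd, Category.comp_id]
    exact isPullback_prod X Y
  have h2 : IsPullback (prodMap (𝟙 X') g).left (snd X' Y).left (snd X' Y').left g.left := by
    refine IsPullback.of_right (h₁₂ := (fst X' Y').left) (v₁₃ := X'.hom) (h₂₂ := Y'.hom) ?_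
      congr($(prodMap_snd (𝟙 X') g).left) (isPullback_prod X' Y')
    rw [MorphismProperty.Over.w, ← comp_left, prodMap_fst, Category.comp_id]
    exact isPullback_prod X' Y
  have h3 : SmoothOfRelativeDimension d (prodMap f (𝟙 Y)).left :=
    (smoothOfRelativeDimension_isStableUnderBaseChange d).of_isPullback h1 hf
  have h4 : SmoothOfRelativeDimension e (prodMap (𝟙 X') g).left :=
    (smoothOfRelativeDimension_isStableUnderBaseChange e).of_isPullback h2.flip hg
  have h5 : prodMap f g = prodMap f (𝟙 Y) ≫ prodMap (𝟙 X') g := by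
    rw [← prodMap_comp, Category.id_comp, Category.comp_id]
  rw [h5]
  exact inferInstanceAs
    (SmoothOfRelativeDimension (d + e) ((prodMap f (𝟙 Y)).left ≫ (prodMap (𝟙 X') g).left))

theorem isPullback_prodMap {P X Y T P' X' Y' T' : Sch S} {a : P ⟶ X} {b : P ⟶ Y} {c : X ⟶ T}
    {d : Y ⟶ T} {a' : P' ⟶ X'} {b' : P' ⟶ Y'} {c' : X' ⟶ T'} {d' : Y' ⟶ T'}
    (h : IsPullback a.left b.left c.left d.left) (h' : IsPullback a'.left b'.left c'.left d'.left) :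
    IsPullback (prodMap a a').left (prodMap b b').left (prodMap c c').left (prodMap d d').left := by
  have w : prodMap a a' ≫ prodMap c c' = prodMap b b' ≫ prodMap d d' := by
    rw [← prodMap_comp, ← prodMap_comp, sch_hom_ext (f := a ≫ c) (g := b ≫ d) h.w,
      sch_hom_ext (f := a' ≫ c') (g := b' ≫ d') h'.w]
  have map_fst {U U' V V' : Sch S} (f : U ⟶ U') (g : V ⟶ V') :
    (prodMap f g).left ≫ (fst U' V').left = (fst U V).left ≫ f.left := congr($(prodMap_fst f g).left)
  have map_snd {U U' V V' : Sch S} (f : U ⟶ U') (g : V ⟶ V') :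
    (prodMap f g).left ≫ (snd U' V').left = (snd U V).left ≫ g.left := congr($(prodMap_snd f g).left)
  refine IsPullback.mk' congr($(w).left) (fun T φ φ' h₁ h₂ => ?_) (fun T u v huv => ?_)
  · refine (isPullback_prod P P').hom_ext (h.hom_ext ?_ ?_) (h'.hom_ext ?_ ?_)
    · rw [Category.assoc, Category.assoc, ← map_fst a a', reassoc_of% h₁]
    · rw [Category.assoc, Category.assoc, ← map_fst b b', reassoc_of% h₂]
    · rw [Category.assoc, Category.assoc, ← map_snd a a', reassoc_of% h₁]
    · rw [Category.assoc, Category.assoc, ← map_snd b b', reassoc_of% h₂]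
  · obtain ⟨l, hl₁, hl₂⟩ := h.exists_lift (u ≫ (fst X X').left) (v ≫ (fst Y Y').left) (by
      rw [Category.assoc, Category.assoc, ← map_fst c c', ← map_fst d d', reassoc_of% huv])
    obtain ⟨l', hl₁', hl₂'⟩ := h'.exists_lift (u ≫ (snd X X').left) (v ≫ (snd Y Y').left) (by
      rw [Category.assoc, Category.assoc, ← map_snd c c', ← map_snd d d', reassoc_of% huv])
    obtain ⟨m, hm₁, hm₂⟩ := (isPullback_prod P P').exists_lift l l' (by
      rw [← MorphismProperty.Over.w a, ← MorphismProperty.Over.w a', reassoc_of% hl₁,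
        reassoc_of% hl₁', (isPullback_prod X X').w])
    refine ⟨m, (isPullback_prod X X').hom_ext ?_ ?_, (isPullback_prod Y Y').hom_ext ?_ ?_⟩
    · rw [Category.assoc, map_fst a a', reassoc_of% hm₁, hl₁]
    · rw [Category.assoc, map_snd a a', reassoc_of% hm₂, hl₁']
    · rw [Category.assoc, map_fst b b', reassoc_of% hm₁, hl₂]
    · rw [Category.assoc, map_snd b b', reassoc_of% hm₂, hl₂']

namespace Omega

variable {W X Y Z X₁ X₂ Y₁ Y₂ : Sch S}

theorem push_mem (f : X ⟶ Y) (hf : IsProper f.left) (i : ℤ) (x : Omega X) (hx : x ∈ gr X i) :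
    push f hf x ∈ gr Y i :=
  map_mem_of_cls (push f hf).toAddMonoidHom (fun _ a C ha hn =>
    (push_cls f hf a C).symm ▸ cls_mem (C := C.push f hf) ha hn) hx

theorem pull_mem (f : X ⟶ Y) (hf : SmoothEquidim f.left) (d : ℕ)
    (hd : SmoothOfRelativeDimension d f.left) (i : ℤ) (y : Omega Y) (hy : y ∈ gr Y i) :
    pull f hf y ∈ gr X (i - d) := by
  refine map_mem_of_cls (pull f hf).toAddMonoidHom (fun m a C ha hn => ?_) hy
  refine (pull_cls f hf d hd a C).symm ▸ cls_mem ha (C.pull f d hd) ?_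
  rw [hn]
  simp only [Cycle.pull, List.length_map]
  push_cast
  ring

theorem chern_mem (L : LineBundle X.left) (i : ℤ) (x : Omega X) (hx : x ∈ gr X i) :
    chern L x ∈ gr X (i + 1) := by
  refine map_mem_of_cls (chern L).toAddMonoidHom (fun m a C ha hn => ?_) hx
  refine (chern_cls L a C).symm ▸ cls_mem ha (C.chern L) ?_
  rw [hn]
  simp only [Cycle.chern, Cycle.withBundles, List.length_append, List.length_singleton]
  push_cast
  ring

theorem ext_mem (i j : ℤ) (x : Omega X) (y : Omega Y) (hx : x ∈ gr X i) (hy : y ∈ gr Y j) :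
    ext x y ∈ gr (prod X Y) (i + j) := by
  refine map_mem_of_cls (ext.flip y).toAddMonoidHom (fun m a C ha hn => ?_) hx
  refine map_mem_of_cls (ext (cls a C)).toAddMonoidHom (fun m' b D hb hn' => ?_) hy
  refine (ext_cls a b C D).symm ▸ cls_mem (LazardRing.mul_mem ha hb) (C.ext D) ?_
  rw [hn, hn']
  simp only [Cycle.ext, List.length_append, List.length_map]
  push_cast
  ring

theorem cls_congr_mk {V : Sch S} {h h' : V ⟶ X} {p p' d d' s s'} {l l' : List (LineBundle V.left)}
    (hh : h = h') (hd : d = d') (hl : l.Perm l') (a : LazardRing) :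
    cls a (⟨V, h, p, d, s, l⟩ : Cycle X) = cls a ⟨V, h', p', d', s', l'⟩ := by
  subst hh hd
  exact cls_congr (Cycle.iso_mk_of_perm hl) a

theorem push_id_apply (h : IsProper (𝟙 X : X ⟶ X).left) (x : Omega X) : push (𝟙 X) h x = x := by
  refine DFunLike.congr_fun (f := (push (𝟙 X) h).toAddMonoidHom) (g := AddMonoidHom.id _)
    (addHom_ext fun a C => ?_) x
  exact (push_cls _ _ _ _).trans (cls_congr_mk (Category.comp_id _) rfl (.refl _) a)

theorem push_comp_apply (f : X ⟶ Y) (g : Y ⟶ Z) (hf : IsProper f.left) (hg : IsProper g.left)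
    (hfg : IsProper (f ≫ g).left) (x : Omega X) : push (f ≫ g) hfg x = push g hg (push f hf x) := by
  induction x using induction with
  | zero => simp only [map_zero]
  | add x y hx hy => simp only [map_add, hx, hy]
  | cls a C =>
    rw [push_cls, push_cls, push_cls]
    exact cls_congr_mk (Category.assoc _ _ _).symm rfl (.refl _) a

theorem subsingleton_of_isEmpty (h : IsEmpty X.left) : Subsingleton (Omega X) := by
  have key (x : Omega X) : x = 0 := by
    induction x using induction with
    | zero => rfl
    | add x y hx hy => rw [hx, hy, add_zero]
    | cls a C =>
      have : IsEmpty C.V.left := isEmpty_of_hom C.h.left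
      exact cls_of_isEmpty C a
  exact ⟨fun x y => (key x).trans (key y).symm⟩

theorem pull_id_apply (h : SmoothEquidim (𝟙 X : X ⟶ X).left) (x : Omega X) :
    pull (𝟙 X) h x = x := by
  induction x using induction with
  | zero => simp only [map_zero]
  | add x y hx hy => simp only [map_add, hx, hy]
  | cls a C =>
    have h0 : SmoothOfRelativeDimension 0 (𝟙 X : X ⟶ X).left :=
      inferInstanceAs (SmoothOfRelativeDimension 0 (𝟙 X.left))
    rw [pull_cls _ h 0 h0]
    refine (cls_congr (Cycle.iso_pull (C := C) (h := C.h) (p := C.proper) (s := C.smooth)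
      (l := C.bundles) (𝟙 C.V) ?_ (Nat.zero_add _).symm ?_) a).symm
    · exact IsPullback.of_horiz_isIso ⟨rfl⟩
    · exact .of_eq (map_pullback_id _).symm

theorem pull_comp_apply (f : X ⟶ Y) (g : Y ⟶ Z) (hf : SmoothEquidim f.left)
    (hg : SmoothEquidim g.left) (hfg : SmoothEquidim (f ≫ g).left) (x : Omega Z) :
    pull (f ≫ g) hfg x = pull f hf (pull g hg x) := by
  induction x using induction with
  | zero => simp only [map_zero]
  | add x y hx hy => simp only [map_add, hx, hy]
  | cls a C =>
    obtain ⟨d, hd⟩ := id hf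
    obtain ⟨e, he⟩ := id hg
    have hde : SmoothOfRelativeDimension (d + e) (f ≫ g).left :=
      inferInstanceAs (SmoothOfRelativeDimension (d + e) (f.left ≫ g.left))
    rw [pull_cls _ hg e he, pull_cls _ hf d hd, pull_cls _ hfg _ hde]
    refine (cls_congr (Cycle.iso_pull (fibFst (fibSnd C.h g) f ≫ fibFst C.h g) ?_
      (Nat.add_assoc _ _ _).symm ?_) a).symm
    · exact (isPullback_fib (fibSnd C.h g) f).paste_horiz (isPullback_fib C.h g)
    · exact .of_eq (map_pullback_comp _ _ _)

theorem pull_push_apply (g' : W ⟶ X) (f' : W ⟶ Y) (f : X ⟶ Z) (g : Y ⟶ Z)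
    (hg' : SmoothEquidim g'.left) (hf' : IsProper f'.left) (hf : IsProper f.left)
    (hg : SmoothEquidim g.left) (h : IsPullback g'.left f'.left f.left g.left) (x : Omega X) :
    pull g hg (push f hf x) = push f' hf' (pull g' hg' x) := by
  induction x using induction with
  | zero => simp only [map_zero]
  | add x y hx hy => simp only [map_add, hx, hy]
  | cls a C =>
    obtain ⟨d, hd⟩ := id hg
    -- `g'` is given with an unspecified dimension; as a base change of `g` it also has dimension
    -- `d`, and `pull_cls` accepts any valid one.
    have hd' : SmoothOfRelativeDimension d g'.left :=
      (smoothOfRelativeDimension_isStableUnderBaseChange d).of_isPullback h.flip hd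
    have hp := (isPullback_fib C.h g').paste_vert h
    rw [← comp_left, ← comp_left] at hp
    rw [push_cls, pull_cls _ hg d hd, pull_cls _ hg' d hd', push_cls]
    exact (cls_congr (Cycle.iso_pull (C := C.push f hf) (f := g) (hf := hd) (V := fib C.h g')
      (h := fibSnd C.h g' ≫ f') (p := ((C.pull g' d hd').push f' hf').proper)
      (s := (C.pull g' d hd').smooth) (d' := d + C.dim)
      (l := C.bundles.map (LineBundle.pullback (fibFst C.h g').left))
      (fibFst C.h g') hp rfl (List.Perm.refl _)) a).symm

theorem push_chern_apply (f : X ⟶ Y) (hf : IsProper f.left) (M : LineBundle Y.left) (x : Omega X) :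
    push f hf (chern (M.pullback f.left) x) = chern M (push f hf x) := by
  induction x using induction with
  | zero => simp only [map_zero]
  | add x y hx hy => simp only [map_add, hx, hy]
  | cls a C =>
    rw [push_cls, chern_cls, chern_cls, push_cls]
    refine cls_congr_mk rfl rfl (.of_eq ?_) a
    dsimp only [Cycle.push, Cycle.chern, Cycle.withBundles]
    rw [LineBundle.pullback_comp, comp_left]
    rfl

theorem chern_pull_apply (f : X ⟶ Y) (hf : SmoothEquidim f.left) (M : LineBundle Y.left)
    (x : Omega Y) : chern (M.pullback f.left) (pull f hf x) = pull f hf (chern M x) := by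
  induction x using induction with
  | zero => simp only [map_zero]
  | add x y hx hy => simp only [map_add, hx, hy]
  | cls a C =>
    obtain ⟨d, hd⟩ := id hf
    rw [chern_cls, pull_cls _ hf d hd, pull_cls _ hf d hd, chern_cls]
    refine cls_congr_mk rfl rfl (.of_eq ?_) a
    dsimp only [Cycle.pull, Cycle.chern, Cycle.withBundles]
    rw [List.map_append, List.map_singleton, LineBundle.pullback_comp, LineBundle.pullback_comp,
      (isPullback_fib C.h f).w]
    rfl

theorem chern_comm_apply (L L' : LineBundle X.left) (x : Omega X) :
    chern L (chern L' x) = chern L' (chern L x) := by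
  induction x using induction with
  | zero => simp only [map_zero]
  | add x y hx hy => simp only [map_add, hx, hy]
  | cls a C =>
    rw [chern_cls, chern_cls, chern_cls, chern_cls]
    exact cls_congr_mk rfl rfl (perm_append_singleton_swap _ _ _) a

theorem chern_congr {L L' : LineBundle X.left} (h : L.Iso L') : chern L = chern L' := by
  refine LinearMap.toAddMonoidHom_injective (addHom_ext fun a C => ?_)
  refine (chern_cls L a C).trans (.trans ?_ (chern_cls L' a C).symm)
  exact cls_congr (Cycle.iso_mk_of_forall₂ (𝟙 _) inferInstance (Category.id_comp _) rfl
    (.of_eq (map_pullback_id _).symm)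
    (List.rel_append (forall₂_iso_refl _) (.cons (h.pullback _) .nil))) a

theorem push_ext_apply (f : X₁ ⟶ X₂) (g : Y₁ ⟶ Y₂) (hf : IsProper f.left)
    (hg : IsProper g.left) (hfg : IsProper (prodMap f g).left) (x : Omega X₁) (y : Omega Y₁) :
    ext (push f hf x) (push g hg y) = push (prodMap f g) hfg (ext x y) := by
  induction x using induction with
  | zero => simp only [map_zero, LinearMap.zero_apply]
  | add x y hx hy => simp only [map_add, hx, hy, LinearMap.add_apply]
  | cls a C =>
    induction y using induction with
    | zero => simp only [map_zero]
    | add x y hx hy => simp only [map_add, hx, hy]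
    | cls b D =>
      rw [push_cls, push_cls, ext_cls, ext_cls, push_cls]
      exact cls_congr_mk (prodMap_comp _ _ _ _) rfl (.refl _) _

theorem pull_ext_apply (f : X₁ ⟶ X₂) (g : Y₁ ⟶ Y₂) (hf : SmoothEquidim f.left)
    (hg : SmoothEquidim g.left) (hfg : SmoothEquidim (prodMap f g).left) (x : Omega X₂)
    (y : Omega Y₂) : ext (pull f hf x) (pull g hg y) = pull (prodMap f g) hfg (ext x y) := by
  induction x using induction with
  | zero => simp only [map_zero, LinearMap.zero_apply]
  | add x y hx hy => simp only [map_add, hx, hy, LinearMap.add_apply]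
  | cls a C =>
    induction y using induction with
    | zero => simp only [map_zero]
    | add x y hx hy => simp only [map_add, hx, hy]
    | cls b D =>
      obtain ⟨d, hd⟩ := id hf
      obtain ⟨e, he⟩ := id hg
      have hde := smooth_prodMap hd he
      rw [pull_cls _ hf d hd, pull_cls _ hg e he, ext_cls, ext_cls, pull_cls _ hfg _ hde]
      refine cls_congr (Cycle.iso_pull (C := C.ext D) (prodMap (fibFst C.h f) (fibFst D.h g))
        (isPullback_prodMap (isPullback_fib C.h f) (isPullback_fib D.h g)) ?_ (.of_eq ?_)) _
      · dsimp only [Cycle.pull, Cycle.ext]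
        omega
      · dsimp only [Cycle.pull, Cycle.ext]
        rw [List.map_append, map_pullback_comp, map_pullback_comp, map_pullback_comp,
          map_pullback_comp, ← comp_left, ← comp_left, ← comp_left, ← comp_left, prodMap_fst,
          prodMap_snd]
        rfl

theorem ext_comm_apply (x : Omega X) (y : Omega Y) (h : IsProper (swap X Y).left) :
    push (swap X Y) h (ext x y) = ext y x := by
  induction x using induction with
  | zero => simp only [map_zero, LinearMap.zero_apply]
  | add x y hx hy => simp only [map_add, hx, hy, LinearMap.add_apply]
  | cls a C =>
    induction y using induction with
    | zero => simp only [map_zero, LinearMap.zero_apply]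
    | add x y hx hy => simp only [map_add, hx, hy, LinearMap.add_apply]
    | cls b D =>
      rw [ext_cls, ext_cls, push_cls, mul_comm]
      refine cls_congr (Cycle.iso_ext (snd C.V D.V) (fst C.V D.V) (isPullback_prod C.V D.V).flip
        ?_ ?_ (Nat.add_comm _ _) List.perm_append_comm) _
      · dsimp only [Cycle.ext]
        rw [Category.assoc, swap, lift_fst]
        exact prodMap_snd _ _
      · dsimp only [Cycle.ext]
        rw [Category.assoc, swap, lift_snd]
        exact prodMap_fst _ _

theorem ext_assoc_apply (x : Omega X) (y : Omega Y) (z : Omega Z)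
    (h : IsProper (assoc X Y Z).left) :
    push (assoc X Y Z) h (ext (ext x y) z) = ext x (ext y z) := by
  induction x using induction with
  | zero => simp only [map_zero, LinearMap.zero_apply]
  | add x y hx hy => simp only [map_add, hx, hy, LinearMap.add_apply]
  | cls a C =>
    induction y using induction with
    | zero => simp only [map_zero, LinearMap.zero_apply]
    | add x y hx hy => simp only [map_add, hx, hy, LinearMap.add_apply]
    | cls b D =>
      induction z using induction with
      | zero => simp only [map_zero]
      | add x y hx hy => simp only [map_add, hx, hy]
      | cls c E =>
        rw [ext_cls, ext_cls, ext_cls, ext_cls, push_cls, mul_assoc]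
        refine cls_congr (Cycle.iso_ext (C := C) (D := D.ext E)
          (fst (prod C.V D.V) E.V ≫ fst C.V D.V)
          (RelCob.lift (fst (prod C.V D.V) E.V ≫ snd C.V D.V) (snd (prod C.V D.V) E.V))
          (isPullback_prod_assoc C.V D.V E.V) ?_ ?_ ?_ (.of_eq ?_)) _
        · dsimp only [Cycle.ext]
          rw [Category.assoc, assoc, lift_fst, ← Category.assoc, prodMap_fst, Category.assoc,
            prodMap_fst, Category.assoc]
        · dsimp only [Cycle.ext]
          refine prod_hom_ext ?_ ?_
          · rw [Category.assoc, assoc, Category.assoc, ← Category.assoc (RelCob.lift _ _) (snd X (prod Y Z)),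
              lift_snd, lift_fst, Category.assoc,
              prodMap_fst, ← Category.assoc, prodMap_fst, Category.assoc, prodMap_snd,
              ← Category.assoc, ← Category.assoc, lift_fst]
          · rw [Category.assoc, assoc, Category.assoc, ← Category.assoc (RelCob.lift _ _) (snd X (prod Y Z)),
              lift_snd, lift_snd, Category.assoc,
              prodMap_snd, prodMap_snd, ← Category.assoc, lift_snd]
        · dsimp only [Cycle.ext]
          omega
        · dsimp only [Cycle.ext]
          rw [List.map_append, List.map_append, map_pullback_comp, map_pullback_comp,
            map_pullback_comp, map_pullback_comp, ← comp_left, ← comp_left, ← comp_left,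
            ← comp_left, lift_fst, lift_snd, List.append_assoc]

/-- Since S ×_S V ≅ V, only the coefficient acts. This one identity yields the unit law, the
multiplicativity of Φ, and the fact that Φ acts on Ω by the 𝕃-module structure. -/
theorem push_snd_ext_unit (a : LazardRing) (x : Omega X)  :
    push (snd (base S) X) (isProper_snd_base X) (ext (cls a (Cycle.unit S)) x) = a • x := by
  induction x using induction with
  | zero => simp only [map_zero, smul_zero]
  | add x y hx hy => simp only [map_add, hx, hy, smul_add]
  | cls b D =>
    rw [ext_cls, push_cls, smul_cls]
    refine cls_congr (Cycle.iso_mk (snd (base S) D.V).left (isIso_snd_base D.V) ?_ rfl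
      (.refl _)) _
    exact congr($(prodMap_snd (Cycle.unit S).h D.h).left).symm

theorem chern_ext_apply (L : LineBundle X.left) (x : Omega X) (y : Omega Y) :
    ext (chern L x) y = chern (L.pullback (fst X Y).left) (ext x y) := by
  induction x using induction with
  | zero => simp only [map_zero, LinearMap.zero_apply]
  | add x y hx hy => simp only [map_add, hx, hy, LinearMap.add_apply]
  | cls a C =>
    induction y using induction with
    | zero => simp only [map_zero]
    | add x y hx hy => simp only [map_add, hx, hy]
    | cls b D =>
      rw [chern_cls, ext_cls, ext_cls, chern_cls]
      refine cls_congr_mk rfl rfl ?_ _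
      dsimp only [Cycle.ext, Cycle.chern, Cycle.withBundles]
      rw [List.map_append, List.map_singleton, LineBundle.pullback_comp, LineBundle.pullback_comp,
        ← comp_left, ← comp_left, prodMap_fst]
      exact perm_append_singleton_append _ _ _

end Omega

end

section

variable {S : Scheme.{u}}

/-! ## Additivity -/

section Coproducts

theorem range_comp {A B C : Scheme.{u}} (f : A ⟶ B) (g : B ⟶ C) :
    Set.range (f ≫ g) = g '' Set.range f := by
  rw [← Set.range_comp]
  exact congrArg Set.range (funext fun x => Scheme.Hom.comp_apply f g x)

/-- These properties hold for the standard coproduct and are transported along the unique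
isomorphism to `V`. -/
theorem isOpenImmersion_of_isColimit_binaryCofan {A B V : Scheme.{u}} {j : A ⟶ V} {k : B ⟶ V}
    (h : Nonempty (IsColimit (BinaryCofan.mk j k))) :
    IsOpenImmersion j ∧ IsOpenImmersion k ∧ Disjoint (Set.range j) (Set.range k) ∧
      Set.range j ∪ Set.range k = Set.univ := by
  obtain ⟨e, h1, h2⟩ : ∃ e : A ⨿ B ≅ V, coprod.inl ≫ e.hom = j ∧ coprod.inr ≫ e.hom = k :=
    ⟨(coprodIsCoprod A B).coconePointUniqueUpToIso h.some,
      (coprodIsCoprod A B).comp_coconePointUniqueUpToIso_hom h.some ⟨.left⟩,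
      (coprodIsCoprod A B).comp_coconePointUniqueUpToIso_hom h.some ⟨.right⟩⟩
  have hc := isCompl_range_inl_inr A B
  have hb : Function.Bijective e.hom := (Scheme.homeoOfIso e).bijective
  refine ⟨h1 ▸ inferInstance, h2 ▸ inferInstance, ?_, ?_⟩
  · rw [← h1, ← h2, range_comp, range_comp]
    exact (Set.disjoint_image_iff hb.1).mpr hc.disjoint
  · have : Set.range (coprod.inl : A ⟶ A ⨿ B) ∪ Set.range (coprod.inr : B ⟶ A ⨿ B) = Set.univ :=
      hc.sup_eq_top
    rw [← h1, ← h2, range_comp, range_comp, ← Set.image_union, this, Set.image_univ,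
      hb.2.range_eq]

end Coproducts

namespace Omega

variable {X Y W : Sch S}

theorem additive_of_isColimit (j : X ⟶ W) (k : Y ⟶ W) (hj : IsProper j.left)
    (hk : IsProper k.left) (h : Nonempty (IsColimit (BinaryCofan.mk j.left k.left))) :
    Function.Bijective (fun p : Omega X × Omega Y => push j hj p.1 + push k hk p.2) := by
  obtain ⟨oj, ok, hd, -⟩ := isOpenImmersion_of_isColimit_binaryCofan h
  have dj : SmoothOfRelativeDimension 0 j.left := inferInstance
  have dk : SmoothOfRelativeDimension 0 k.left := inferInstance
  have sj : SmoothEquidim j.left := ⟨0, dj⟩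
  have sk : SmoothEquidim k.left := ⟨0, dk⟩
  have pull_push_self {X : Sch S} (j : X ⟶ W) (hj : IsProper j.left) [IsOpenImmersion j.left]
      (sj : SmoothEquidim j.left) (x : Omega X) : pull j sj (push j hj x) = x := by
    have h0 : SmoothEquidim (𝟙 X : X ⟶ X).left :=
      ⟨0, inferInstanceAs (SmoothOfRelativeDimension 0 (𝟙 X.left))⟩
    -- A monomorphism is its own kernel pair: base change along the square with identities gives
    -- j^*j_* = id.
    rw [pull_push_apply (𝟙 X) (𝟙 X) j j h0 (isProper_id X) hj sj (IsKernelPair.id_of_mono j.left),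
      push_id_apply, pull_id_apply]
  have pull_push_zero {X Y : Sch S} (j : X ⟶ W) (k : Y ⟶ W) (hj : IsProper j.left)
      (d : SmoothOfRelativeDimension 0 k.left)
      (sk : SmoothEquidim k.left) (hd : Disjoint (Set.range j.left) (Set.range k.left)) (x : Omega X) :
      pull k sk (push j hj x) = 0 := by
    -- The images are disjoint, so k^*j_* factors through Ω of the empty scheme.
    have he : IsEmpty (fib j k).left := Scheme.isEmpty_pullback _ _ hd
    have hp := isPullback_fib j k
    have hs : SmoothOfRelativeDimension 0 (fibFst j k).left :=
      (smoothOfRelativeDimension_isStableUnderBaseChange 0).of_isPullback hp.flip d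
    have hq : IsProper (fibSnd j k).left := MorphismProperty.of_isPullback hp hj
    have hs' : SmoothEquidim (fibFst j k).left := ⟨0, hs⟩
    rw [pull_push_apply (fibFst j k) (fibSnd j k) j k hs' hq hj sk hp,
      (subsingleton_of_isEmpty he).elim (pull _ hs' x) 0, map_zero]
  refine Function.bijective_iff_has_inverse.mpr
    ⟨fun w => (pull j sj w, pull k sk w), fun p => ?_, fun w => ?_⟩
  · dsimp only
    rw [map_add, map_add, pull_push_self j, pull_push_self k, pull_push_zero k j _ dj sj hd.symm,
      pull_push_zero j k _ dk sk hd, add_zero, zero_add]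
  · dsimp only
    induction w using induction with
    | zero => simp only [map_zero, add_zero]
    | add x y hx hy =>
      nth_rewrite 3 [← hx, ← hy]
      simp only [map_add]
      abel
    | cls a C =>
      rw [pull_cls _ _ 0 dj, pull_cls _ _ 0 dk, push_cls, push_cls]
      -- j_*j^* + k_*k^* = id is the disjoint union relation for the source split into the preimages
      -- of the two summands.
      exact (cls_disjointUnion (Cycle.isDisjointUnion_mk (fibFst C.h j) (fibFst C.h k)
        (isColimit_of_isPullback h (isPullback_fib C.h j) (isPullback_fib C.h k))
        (fib_w C.h j) (fib_w C.h k) (Nat.zero_add _) (Nat.zero_add _) rfl rfl) a).symm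

end Omega

end

section

variable {S : Scheme.{u}}

/-! ## Relative algebraic cobordism is of geometric type -/

namespace Cycle

/-- The cycle `(id : X ⟶ X; L₁, …, L_r)`, for `X` smooth over `S`. -/
def ofSmooth (X : Sch S) (d : ℕ) (hd : SmoothOfRelativeDimension d X.hom)
    (l : List (LineBundle X.left)) : Cycle X :=
  ⟨X, 𝟙 X, isProper_id X, d, hd, l⟩

end Cycle

namespace Omega

variable {X : Sch S} {d : ℕ} (hd : SmoothOfRelativeDimension d X.hom)

/-- The fundamental element π_X^*1_S is the class of id_X, so the geometric axioms become statements
about explicit cycles on `X`. -/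
theorem pull_toBase_unit (hX : SmoothEquidim (toBase X).left) (a : LazardRing) :
    pull (toBase X) hX (cls a (Cycle.unit S)) = cls a (Cycle.ofSmooth X d hd []) := by
  rw [pull_cls _ hX d hd]
  refine (cls_congr (Cycle.iso_pull (C := Cycle.unit S) (V := X) (h := 𝟙 X) (toBase X) ?_ rfl
    (.refl _)) a).symm
  have : IsIso (𝟙 X : X ⟶ X).left := inferInstanceAs (IsIso (𝟙 X.left))
  have : IsIso (Cycle.unit S).h.left := inferInstanceAs (IsIso (𝟙 S))
  exact IsPullback.of_vert_isIso ⟨(Category.comp_id _).trans (Category.id_comp _).symm⟩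

theorem chern_ofSmooth (L : LineBundle X.left) (a : LazardRing) (l : List (LineBundle X.left)) :
    chern L (cls a (Cycle.ofSmooth X d hd l)) = cls a (Cycle.ofSmooth X d hd (l ++ [L])) := by
  have h : l ++ [L.pullback (𝟙 X.left)] = l ++ [L] := by rw [L.pullback_id]
  rw [chern_cls]
  exact cls_congr_mk rfl rfl (.of_eq h) a

theorem foldr_chern_ofSmooth (Ls : List (LineBundle X.left)) (a : LazardRing)
    (l : List (LineBundle X.left)) :
    Ls.foldr (fun L x => chern L x) (cls a (Cycle.ofSmooth X d hd l)) =
      cls a (Cycle.ofSmooth X d hd (l ++ Ls.reverse)) := by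
  induction Ls with
  | nil => rw [List.reverse_nil, List.append_nil, List.foldr_nil]
  | cons L Ls ih =>
    rw [List.foldr_cons, ih, chern_ofSmooth, List.reverse_cons, List.append_assoc]

theorem iterate_chern_ofSmooth (L : LineBundle X.left) (i : ℕ) (a : LazardRing)
    (l : List (LineBundle X.left)) :
    (chern L)^[i] (cls a (Cycle.ofSmooth X d hd l)) =
      cls a (Cycle.ofSmooth X d hd (l ++ List.replicate i L)) := by
  induction i with
  | zero => rw [List.replicate_zero, List.append_nil, Function.iterate_zero_apply]
  | succ i ih =>
    rw [Function.iterate_succ_apply', ih, chern_ofSmooth, List.replicate_succ', List.append_assoc]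

/-- R^Dim for the trivial factorisation: the intermediate scheme is `X` and the smooth map is the
identity. -/
theorem cls_ofSmooth_eq_zero (a : LazardRing) (l : List (LineBundle X.left)) (h : d < l.length) :
    cls a (Cycle.ofSmooth X d hd l) = 0 := by
  refine cls_of_isDimCycle (Cycle.isDimCycle_mk (T := X) (𝟙 X)
    (inferInstanceAs (Smooth (𝟙 X.left))) hd (Ls := l) (Ms := []) h ?_) a
  rw [List.append_nil]
  exact (map_pullback_id l).symm

theorem cls_ofSmooth_of_isTransverseZeroScheme {Z : Sch S} {e : ℕ}
    (he : SmoothOfRelativeDimension e Z.hom) {L : LineBundle X.left} (s : L.GlobalSection)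
    (i : Z ⟶ X) (hi : IsProper i.left) (h : IsTransverseZeroScheme d s i)
    (h' : IsEmpty Z.left ∨ e + 1 = d) (a : LazardRing) :
    cls a (Cycle.ofSmooth X d hd [L]) = push i hi (cls a (Cycle.ofSmooth Z e he [])) := by
  rw [push_cls]
  exact cls_of_isSectPair (Cycle.isSectPair_mk (Ls := []) s i rfl h
    ((Category.comp_id i).trans (Category.id_comp i).symm) h' rfl) a

end Omega

/-- Relative algebraic cobordism as an oriented Borel–Moore functor with products. -/
def omegaFunctor (S : Scheme.{u}) : OrientedBMFunctor (fun X : Sch S => Omega X) where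
  gr X := Omega.gr X
  isInternal := Omega.isInternal
  push f hf := (Omega.push f hf).toAddMonoidHom
  push_mem := Omega.push_mem
  push_id _ h := AddMonoidHom.ext (Omega.push_id_apply h)
  push_comp f g hf hg hfg := AddMonoidHom.ext (Omega.push_comp_apply f g hf hg hfg)
  additive_empty _ h := Omega.subsingleton_of_isEmpty h
  additive j k hj hk h := Omega.additive_of_isColimit j k hj hk h
  pull f hf := (Omega.pull f hf).toAddMonoidHom
  pull_mem := Omega.pull_mem
  chern L := (Omega.chern L).toAddMonoidHom
  chern_mem := Omega.chern_mem
  ext := AddMonoidHom.mk' (fun x => (Omega.ext x).toAddMonoidHom) fun x y =>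
    congrArg LinearMap.toAddMonoidHom (map_add Omega.ext x y)
  ext_mem := Omega.ext_mem
  ext_comm := Omega.ext_comm_apply
  ext_assoc := Omega.ext_assoc_apply
  one := Omega.cls 1 (Cycle.unit S)
  one_mem := Omega.cls_mem LazardRing.one_mem _ rfl
  one_ext x := (Omega.push_snd_ext_unit 1 x).trans (one_smul _ x)
  pull_id _ h := AddMonoidHom.ext (Omega.pull_id_apply h)
  pull_comp f g hf hg hfg := AddMonoidHom.ext (Omega.pull_comp_apply f g hf hg hfg)
  pull_push g' f' f g hg' hf' hf hg h :=
    AddMonoidHom.ext (Omega.pull_push_apply g' f' f g hg' hf' hf hg h)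
  push_chern f hf M := AddMonoidHom.ext (Omega.push_chern_apply f hf M)
  chern_pull f hf M := AddMonoidHom.ext (Omega.chern_pull_apply f hf M)
  chern_comm L L' := AddMonoidHom.ext (Omega.chern_comm_apply L L')
  chern_congr _ _ h := congrArg LinearMap.toAddMonoidHom (Omega.chern_congr h)
  push_ext := Omega.push_ext_apply
  pull_ext := Omega.pull_ext_apply
  chern_ext := Omega.chern_ext_apply

theorem isInducedByCycles_omegaFunctor (S : Scheme.{u}) : IsInducedByCycles (omegaFunctor S) where
  gr_eq _ _ := rfl
  push_cls := Omega.push_cls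
  pull_cls := Omega.pull_cls
  chern_cls := Omega.chern_cls
  ext_cls := Omega.ext_cls
  one_eq := rfl

theorem fst_base_eq_snd_base (S : Scheme.{u}) : fst (base S) (base S) = snd (base S) (base S) :=
  sch_hom_ext (((Category.comp_id _).symm.trans (isPullback_prod (base S) (base S)).w).trans
    (Category.comp_id _))

theorem isLazardHom_omegaFunctor (S : Scheme.{u}) :
    (omegaFunctor S).IsLazardHom (Omega.clsHom (Cycle.unit S)) where
  map_one := rfl
  map_mul a b := by
    have h (f : prod (base S) (base S) ⟶ base S) (hf : IsProper f.left)
        (e : f = snd (base S) (base S)) :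
        Omega.push f hf (Omega.ext (Omega.cls a (Cycle.unit S)) (Omega.cls b (Cycle.unit S))) =
          Omega.cls (a * b) (Cycle.unit S) := by
      subst e
      exact (Omega.push_snd_ext_unit a _).trans (Omega.smul_cls a b _)
    exact (h _ (isProper_fst_base S) (fst_base_eq_snd_base S)).symm
  map_mem n a ha := Omega.cls_mem ha _ (zero_sub n).symm

theorem isGeometricType_omegaFunctor (S : Scheme.{u}) :
    (omegaFunctor S).IsGeometricType (Omega.clsHom (Cycle.unit S)) where
  isLazardHom := isLazardHom_omegaFunctor S
  rel_dim X hX d hd Ls h := by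
    refine (congrArg (fun x => Ls.foldr (fun L x => Omega.chern L x) x)
      (Omega.pull_toBase_unit hd hX 1)).trans ?_
    refine (Omega.foldr_chern_ofSmooth hd Ls 1 []).trans (Omega.cls_ofSmooth_eq_zero hd 1 _ ?_)
    rwa [List.nil_append, List.length_reverse]
  rel_sect X Z hX hZ d hd L s i hi h := by
    -- If `Z` is empty any dimension will do; otherwise transversality provides d - 1.
    obtain ⟨e, he, h'⟩ : ∃ e, SmoothOfRelativeDimension e Z.hom ∧ (IsEmpty Z.left ∨ e + 1 = d) := by
      rcases h.2 with h0 | ⟨m, hm, hm'⟩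
      · obtain ⟨e, he⟩ := hZ
        exact ⟨e, he, .inl h0⟩
      · exact ⟨m, hm', .inr hm⟩
    refine (congrArg (Omega.chern L) (Omega.pull_toBase_unit hd hX 1)).trans ?_
    refine (Omega.chern_ofSmooth hd L 1 []).trans ?_
    refine (Omega.cls_ofSmooth_of_isTransverseZeroScheme hd he s i hi h h' 1).trans ?_
    exact (congrArg (Omega.push i hi) (Omega.pull_toBase_unit he hZ 1)).symm
  rel_fgl X hX d hd L M := by
    have hf : (omegaFunctor S).fund X hX = Omega.cls 1 (Cycle.ofSmooth X d hd []) :=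
      Omega.pull_toBase_unit hd hX 1
    have hact (a : LazardRing) (x : Omega X) :
        (omegaFunctor S).act (Omega.clsHom (Cycle.unit S) a) x = a • x :=
      Omega.push_snd_ext_unit a x
    rw [hf]
    refine .trans ?_ ((Omega.cls_fgl (Cycle.ofSmooth X d hd []) [] L M 1).trans
      (Omega.chern_ofSmooth hd _ 1 []).symm)
    refine Finset.sum_congr rfl fun i _ => Finset.sum_congr rfl fun j _ => ?_
    rw [hact]
    refine (congrArg (fun x => LazardRing.a i j • (Omega.chern L)^[i] x)
      (Omega.iterate_chern_ofSmooth hd M j 1 [])).trans ?_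
    refine (congrArg (fun x => LazardRing.a i j • x)
      (Omega.iterate_chern_ofSmooth hd L i 1 _)).trans ?_
    rw [Omega.smul_cls, mul_one, one_mul]
    -- The operators of `M` act first, so its copies precede those of `L`; the relation lists them
    -- the other way round.
    exact Omega.cls_congr_mk rfl rfl List.perm_append_comm _

end

section

variable {k : Type u} [Field k]

/-! ## The relations in Levine–Morel's algebraic cobordism -/

namespace LevineMorel

namespace Omega

variable {X : SchField k}

theorem smul_cls (b a : LazardRing) (C : VarCycle X) : b • cls a C = cls (b * a) C := by
  rw [cls, ← map_smul, TensorProduct.smul_tmul', smul_eq_mul, cls]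

theorem cls_congr {C D : VarCycle X} (h : C.1.Iso D.1) (a : LazardRing) : cls a C = cls a D := by
  have h1 : Z.cls C = Z.cls D := congrArg FreeAbelianGroup.of (Quot.sound h)
  have : ZSect.cls C = ZSect.cls D := by
    rw [ZSect.cls, ZDim.cls, h1, ← ZDim.cls, ← ZSect.cls]
  rw [cls, this, cls]

theorem cls_of_isDimCycle {C : VarCycle X} (h : C.1.IsDimCycle) (a : LazardRing) :
    cls a C = 0 := by
  have h1 : ZDim.cls C = 0 := mk_eq_zero_of_mem ⟨C, h, rfl⟩
  have h2 : ZSect.cls C = 0 := by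
    rw [ZSect.cls, h1]
    rfl
  rw [cls, h2, TensorProduct.tmul_zero, map_zero]

theorem cls_of_isSectPair {C : VarCycle X} {D : Cycle X} {n : ℕ} {E : Fin n → VarCycle X}
    (h : C.1.IsSectPair D) (hE : IsComponents D E) (a : LazardRing) :
    cls a C = ∑ b, cls a (E b) := by
  have h1 : ZSect.cls C = ∑ b, ZSect.cls (E b) := by
    have : ZSect.cls C - QuotientAddGroup.mk (∑ b, ZDim.cls (E b)) = 0 :=
      mk_eq_zero_of_mem ⟨C, D, n, E, h, hE, rfl⟩
    refine (sub_eq_zero.mp this).trans ?_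
    exact map_sum (QuotientAddGroup.mk' _) (fun b => ZDim.cls (E b)) _
  rw [cls, h1, TensorProduct.tmul_sum, map_sum]
  rfl

theorem cls_fgl (C : VarCycle X) (Ls : List (LineBundle C.1.V.left)) (L M : LineBundle C.1.V.left)
    (a : LazardRing) :
    ∑ i ∈ Finset.range (C.1.dim + 1), ∑ j ∈ Finset.range (C.1.dim + 1), cls (a * LazardRing.a i j)
      (withBundles C (Ls ++ List.replicate i L ++ List.replicate j M)) =
    cls a (withBundles C (Ls ++ [L.tensor M])) := by
  have h := (Submodule.Quotient.mk_eq_zero (fglSubmodule X)).mpr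
    (Submodule.subset_span ⟨C, Ls, L, M, rfl⟩)
  have h' := congrArg (a • ·) ((map_sub (fglSubmodule X).mkQ _ _).symm.trans h)
  simp only [map_sum, smul_sub, Finset.smul_sum, smul_zero, sub_eq_zero] at h'
  simp only [← map_smul, TensorProduct.smul_tmul', smul_eq_mul, mul_one] at h'
  exact h'

theorem induction {p : Omega X → Prop} (x : Omega X) (zero : p 0)
    (cls : ∀ a C, p (cls a C)) (add : ∀ x y, p x → p y → p (x + y)) : p x := by
  obtain ⟨x, rfl⟩ := (fglSubmodule X).mkQ_surjective x
  induction x using TensorProduct.induction_on with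
  | zero => simpa using zero
  | add x y hx hy => rw [map_add]; exact add _ _ hx hy
  | tmul a z =>
    obtain ⟨z, rfl⟩ := QuotientAddGroup.mk_surjective z
    obtain ⟨z, rfl⟩ := QuotientAddGroup.mk_surjective z
    induction z using FreeAbelianGroup.induction_on generalizing a with
    | zero =>
      have : (QuotientAddGroup.mk (QuotientAddGroup.mk 0) : ZSect X) = 0 := rfl
      rw [this, TensorProduct.tmul_zero, map_zero]
      exact zero
    | of C =>
      induction C using Quot.induction_on
      exact cls a _
    | neg C h =>
      have : (QuotientAddGroup.mk (QuotientAddGroup.mk (-.of C)) : ZSect X) =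
        -QuotientAddGroup.mk (QuotientAddGroup.mk (.of C)) := rfl
      rw [this, TensorProduct.tmul_neg, ← TensorProduct.neg_tmul]
      exact h (-a)
    | add x y hx hy =>
      have : (QuotientAddGroup.mk (QuotientAddGroup.mk (x + y)) : ZSect X) =
        QuotientAddGroup.mk (QuotientAddGroup.mk x) + QuotientAddGroup.mk (QuotientAddGroup.mk y) :=
        rfl
      rw [this, TensorProduct.tmul_add, map_add]
      exact add _ _ (hx a) (hy a)

theorem linearMap_ext {A : Type*} [AddCommGroup A] [Module LazardRing A]
    {f g : Omega X →ₗ[LazardRing] A} (h : ∀ C, f (cls 1 C) = g (cls 1 C)) : f = g := by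
  ext1
  refine TensorProduct.AlgebraTensorModule.ext fun a z => ?_
  have key (x : Omega X) : f x = g x := by
    induction x using induction with
    | zero => rw [map_zero, map_zero]
    | add x y hx hy => rw [map_add, map_add, hx, hy]
    | cls a C => rw [← mul_one a, ← smul_cls, map_smul, map_smul, h]
  exact key _

section Lift

variable {A : Type v} [AddCommGroup A] {ψ : VarCycle X → A}
  (iso : ∀ C D : VarCycle X, C.1.Iso D.1 → ψ C = ψ D)
  (dim : ∀ C : VarCycle X, C.1.IsDimCycle → ψ C = 0)
  (sect : ∀ (C : VarCycle X) (D : Cycle X) (n : ℕ) (E : Fin n → VarCycle X),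
    C.1.IsSectPair D → IsComponents D E → ψ C = ∑ b, ψ (E b))

/-- The additive map on `ZDim X` induced by a function on cobordism cycles. -/
def zdimLift : ZDim X →+ A :=
  closureLift (FreeAbelianGroup.lift (Quot.lift ψ iso)) (by
    rintro _ ⟨C, h, rfl⟩
    exact (FreeAbelianGroup.lift_apply_of _ _).trans (dim C h))

theorem zdimLift_cls (C : VarCycle X) : zdimLift iso dim (ZDim.cls C) = ψ C :=
  FreeAbelianGroup.lift_apply_of _ _

/-- The additive map on `ZSect X` induced by a function on cobordism cycles. -/
def zsectLift : ZSect X →+ A :=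
  closureLift (zdimLift iso dim) (by
    rintro _ ⟨C, D, n, E, h, hE, rfl⟩
    rw [map_sub, map_sum, zdimLift_cls, sect C D n E h hE, sub_eq_zero]
    exact Finset.sum_congr rfl fun b _ => (zdimLift_cls iso dim (E b)).symm)

theorem zsectLift_cls (C : VarCycle X) : zsectLift iso dim sect (ZSect.cls C) = ψ C :=
  zdimLift_cls iso dim C

variable [Module LazardRing A]
  (fgl : ∀ (C : VarCycle X) (Ls : List (LineBundle C.1.V.left)) (L M : LineBundle C.1.V.left),
    ∑ i ∈ Finset.range (C.1.dim + 1), ∑ j ∈ Finset.range (C.1.dim + 1), LazardRing.a i j •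
      ψ (withBundles C (Ls ++ List.replicate i L ++ List.replicate j M)) =
    ψ (withBundles C (Ls ++ [L.tensor M])))

/-- The linear map on `Ω_*(X)` induced by a function on cobordism cycles. -/
def liftModule : Omega X →ₗ[LazardRing] A :=
  (fglSubmodule X).liftQ ((zsectLift iso dim sect).toIntLinearMap.liftBaseChange LazardRing) (by
    refine Submodule.span_le.mpr ?_
    rintro _ ⟨C, Ls, L, M, rfl⟩
    simp only [SetLike.mem_coe, LinearMap.mem_ker, map_sub, map_sum,
      LinearMap.liftBaseChange_tmul, AddMonoidHom.coe_toIntLinearMap, zsectLift_cls, one_smul, fgl,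
      sub_self])

theorem liftModule_cls (a : LazardRing) (C : VarCycle X) :
    liftModule iso dim sect fgl (cls a C) = a • ψ C := by
  refine ((fglSubmodule X).liftQ_apply _ _).trans ?_
  rw [LinearMap.liftBaseChange_tmul, AddMonoidHom.coe_toIntLinearMap, zsectLift_cls]

end Lift

theorem cls_mem {n m : ℤ} {a : LazardRing} (ha : a ∈ LazardRing.gr m) (C : VarCycle X)
    (h : n = m + C.1.dim - C.1.bundles.length) : cls a C ∈ gr X n :=
  AddSubgroup.subset_closure ⟨m, a, C, ha, h, rfl⟩

theorem map_mem_of_cls {A : Type*} [AddCommGroup A] {n : ℤ} {B : AddSubgroup A} (f : Omega X →+ A)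
    (h : ∀ (m : ℤ) (a : LazardRing) (C : VarCycle X), a ∈ LazardRing.gr m →
      n = m + C.1.dim - C.1.bundles.length → f (cls a C) ∈ B) {x : Omega X} (hx : x ∈ gr X n) :
    f x ∈ B := by
  have : gr X n ≤ B.comap f := by
    refine (AddSubgroup.closure_le _).mpr ?_
    rintro _ ⟨m, a, C, ha, hn, rfl⟩
    exact h m a C ha hn
  exact this hx

end Omega

end LevineMorel

end

section

variable {S : Scheme.{u}}

/-! ## Restriction of cobordism cycles to open and closed subschemes -/

section ClopenSubscheme

/-- The open subset underlying an open and closed subset of a scheme. -/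
abbrev clopenOpens {V : Scheme.{u}} (U : TopologicalSpace.Clopens V) : V.Opens := U.toOpens

theorem clopenOpens_le {V : Scheme.{u}} {U U' : TopologicalSpace.Clopens V} (h : U ≤ U') :
    clopenOpens U ≤ clopenOpens U' := h

variable (V : Sch S) (U : TopologicalSpace.Clopens V.left)

theorem isClosedImmersion_clopens : IsClosedImmersion (clopenOpens U).ι :=
  .of_isPreimmersion _ (by
    rw [Scheme.Opens.range_ι]
    exact U.isClosed)

/-- The `S`-scheme on an open and closed subset. -/
def clopenSub : Sch S :=
  .mk ⊤ ((clopenOpens U).ι ≫ V.hom) (sepFT_comp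
    (have := isClosedImmersion_clopens V U
    ⟨inferInstance, inferInstance, inferInstance⟩) V.prop)

/-- The inclusion of an open and closed subscheme. -/
def clopenι : clopenSub V U ⟶ V := MorphismProperty.Over.homMk (clopenOpens U).ι rfl trivial

instance isOpenImmersion_clopenι : IsOpenImmersion (clopenι V U).left :=
  inferInstanceAs (IsOpenImmersion (clopenOpens U).ι)

theorem range_clopenι : Set.range (clopenι V U).left = U := Scheme.Opens.range_ι _

/-- The inclusion of an open and closed subscheme in a larger one. -/
def clopenHomOfLE {U U' : TopologicalSpace.Clopens V.left} (h : U ≤ U') :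
    clopenSub V U ⟶ clopenSub V U' :=
  MorphismProperty.Over.homMk (V.left.homOfLE (clopenOpens_le h)) (by
    change _ ≫ (clopenOpens U').ι ≫ V.hom = (clopenOpens U).ι ≫ V.hom
    rw [Scheme.homOfLE_ι_assoc]) trivial

theorem clopenHomOfLE_clopenι {U U' : TopologicalSpace.Clopens V.left} (h : U ≤ U') :
    clopenHomOfLE V h ≫ clopenι V U' = clopenι V U :=
  sch_hom_ext (Scheme.homOfLE_ι _ (clopenOpens_le h))

theorem isColimit_clopenHomOfLE {U U' : TopologicalSpace.Clopens V.left} (h : Disjoint U U') :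
    Nonempty (IsColimit (BinaryCofan.mk
      (clopenHomOfLE V (le_sup_left : U ≤ U ⊔ U')).left
      (clopenHomOfLE V (le_sup_right : U' ≤ U ⊔ U')).left)) := by
  refine nonempty_isColimit_binaryCofanMk_of_isCompl
    (V.left.homOfLE (clopenOpens_le (le_sup_left : U ≤ U ⊔ U')))
    (V.left.homOfLE (clopenOpens_le (le_sup_right : U' ≤ U ⊔ U'))) ?_
  rw [Scheme.opensRange_homOfLE, Scheme.opensRange_homOfLE]
  refine ⟨disjoint_iff_inf_le.mpr fun x hx => ?_, codisjoint_iff_le_sup.mpr fun x _ => ?_⟩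
  · exact (Set.disjoint_left.mp (TopologicalSpace.Clopens.coe_disjoint.mpr h) hx.1 hx.2).elim
  · exact x.2

end ClopenSubscheme

namespace Cycle

variable {X : Sch S}

/-- The restriction of a cobordism cycle to an open and closed subscheme of its source. -/
def restrict (C : Cycle X) (U : TopologicalSpace.Clopens C.V.left) : Cycle X where
  V := clopenSub C.V U
  h := clopenι C.V U ≫ C.h
  proper := by
    have := isClosedImmersion_clopens C.V U
    have := C.proper
    exact inferInstanceAs (IsProper ((clopenOpens U).ι ≫ C.h.left))
  dim := C.dim
  smooth := by
    have := C.smooth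
    have h : SmoothOfRelativeDimension (0 + C.dim) ((clopenOpens U).ι ≫ C.V.hom) := inferInstance
    rw [Nat.zero_add] at h
    exact h
  bundles := C.bundles.map (LineBundle.pullback (clopenι C.V U).left)

theorem isDisjointUnion_restrict (C : Cycle X) {U U' : TopologicalSpace.Clopens C.V.left}
    (h : Disjoint U U') :
    (C.restrict (U ⊔ U')).IsDisjointUnion (C.restrict U) (C.restrict U') := by
  refine isDisjointUnion_mk (clopenHomOfLE C.V le_sup_left) (clopenHomOfLE C.V le_sup_right)
    (isColimit_clopenHomOfLE C.V h) ?_ ?_ rfl rfl ?_ ?_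
  · rw [← Category.assoc, clopenHomOfLE_clopenι]
  · rw [← Category.assoc, clopenHomOfLE_clopenι]
  · rw [map_pullback_comp, ← comp_left, clopenHomOfLE_clopenι]
  · rw [map_pullback_comp, ← comp_left, clopenHomOfLE_clopenι]

theorem restrict_top_iso (C : Cycle X) : (C.restrict ⊤).Iso C := by
  have h : IsIso (clopenι C.V ⊤).left :=
    isIso_of_isOpenImmersion_of_opensRange_eq_top _
      (TopologicalSpace.Opens.ext (range_clopenι C.V ⊤))
  exact iso_mk (V₁ := C.V) (h₁ := C.h) (p₁ := C.proper) (s₁ := C.smooth) (l₁ := C.bundles)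
    (clopenι C.V ⊤).left h rfl rfl (.refl _)

theorem IsDimCycle.restrict {C : Cycle X} (h : C.IsDimCycle)
    (U : TopologicalSpace.Clopens C.V.left) : (C.restrict U).IsDimCycle := by
  obtain ⟨T, π, e, Ls, Ms, hπ, hT, he, hl⟩ := h
  refine isDimCycle_mk (T := T) (clopenι C.V U ≫ π)
    (inferInstanceAs (Smooth ((clopenOpens U).ι ≫ π.left))) hT he
    (Ms := Ms.map (LineBundle.pullback (clopenι C.V U).left)) ?_
  rw [hl, List.map_append, map_pullback_comp]
  rfl

/-- The preimage of an open and closed subset. -/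
def _root_.RelCob.clopensPreimage {V W : Scheme.{u}} (f : V ⟶ W)
    (U : TopologicalSpace.Clopens W) : TopologicalSpace.Clopens V :=
  ⟨f ⁻¹' U, U.isClopen.preimage f.continuous⟩

/-- Zero schemes of sections restrict to open subsets. One `i` serves all `U`, so the preimages of a
partition of the source of `C` partition that of `D`. -/
theorem exists_isSectPair_restrict {C D : Cycle X} (h : C.IsSectPair D) :
    ∃ i : D.V ⟶ C.V, ∀ U : TopologicalSpace.Clopens C.V.left,
      (C.restrict U).IsSectPair (D.restrict (clopensPreimage i.left U)) := by
  obtain ⟨Ls, L, s, i, hl, hs, hi, hd, hb⟩ := h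
  refine ⟨i, fun U => ?_⟩
  let r : clopenSub D.V (clopensPreimage i.left U) ⟶ clopenSub C.V U :=
    MorphismProperty.Over.homMk (i.left ∣_ clopenOpens U) (by
      change _ ≫ (clopenOpens U).ι ≫ C.V.hom = (i.left ⁻¹ᵁ clopenOpens U).ι ≫ D.V.hom
      rw [morphismRestrict_ι_assoc, MorphismProperty.Over.w i]) trivial
  have hr : r ≫ clopenι C.V U = clopenι D.V (clopensPreimage i.left U) ≫ i :=
    sch_hom_ext (morphismRestrict_ι i.left (clopenOpens U))
  have hp : IsPullback r.left (clopenι D.V (clopensPreimage i.left U)).left (clopenι C.V U).left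
    i.left := isPullback_morphismRestrict i.left (clopenOpens U)
  have hd' : IsEmpty (clopenSub D.V (clopensPreimage i.left U)).left ∨ D.dim + 1 = C.dim :=
    hd.imp_left fun h =>
      have : IsEmpty D.V.left := h
      isEmpty_of_hom (clopenι D.V (clopensPreimage i.left U)).left
  refine isSectPair_mk (s.pullback (clopenι C.V U).left) r
    (Ls := Ls.map (LineBundle.pullback (clopenι C.V U).left)) ?_ ⟨?_, ?_⟩ ?_ hd' ?_
  · rw [hl, List.map_append, List.map_singleton]
  · exact hs.1.of_isPullback hp
  · exact hd'.imp_right fun e => ⟨D.dim, e, (D.restrict (clopensPreimage i.left U)).smooth⟩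
  · rw [← Category.assoc, hr, Category.assoc, hi]
  · rw [hb, map_pullback_comp, map_pullback_comp, ← comp_left, ← hr]
    rfl

end Cycle

namespace Omega

variable {X : Sch S}

theorem cls_restrict_sup (C : Cycle X) {ι : Type*} (s : Finset ι)
    (U : ι → TopologicalSpace.Clopens C.V.left) (hU : Pairwise (Function.onFun Disjoint U))
    (a : LazardRing) : cls a (C.restrict (s.sup U)) = ∑ i ∈ s, cls a (C.restrict (U i)) := by
  classical
  induction s using Finset.induction_on with
  | empty =>
    have : IsEmpty (C.restrict (Finset.sup ∅ U)).V.left :=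
      Set.isEmpty_coe_sort.mpr (TopologicalSpace.Clopens.coe_bot (α := C.V.left))
    rw [Finset.sum_empty, cls_of_isEmpty]
  | insert i s hi ih =>
    rw [Finset.sum_insert hi, Finset.sup_insert, ← ih]
    refine cls_disjointUnion (C.isDisjointUnion_restrict ?_) a
    exact Finset.disjoint_sup_right.mpr fun j hj => hU fun e => hi (e ▸ hj)

end Omega

end

section

/-! ## Connected components -/

section Topology

variable {α : Type*} [TopologicalSpace α]

/-- Irreducible components are finite in number, each lies in one connected component, and every
connected component is reached. -/
theorem finite_connectedComponents_of_noetherianSpace [TopologicalSpace.NoetherianSpace α] :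
    Finite (ConnectedComponents α) := by
  have : Finite (irreducibleComponents α) :=
    TopologicalSpace.NoetherianSpace.finite_irreducibleComponents
  have hne (Z : irreducibleComponents α) : (Z : Set α).Nonempty := Z.2.1.1
  refine Finite.of_surjective
    (fun Z : irreducibleComponents α => ConnectedComponents.mk (hne Z).choose) ?_
  intro c
  obtain ⟨x, rfl⟩ := ConnectedComponents.surjective_coe c
  let Z : irreducibleComponents α :=
    ⟨irreducibleComponent x, irreducibleComponent_mem_irreducibleComponents x⟩
  refine ⟨Z, ConnectedComponents.coe_eq_coe'.mpr ?_⟩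
  exact isIrreducible_irreducibleComponent.isPreirreducible.isPreconnected.subset_connectedComponent
    mem_irreducibleComponent (hne Z).choose_spec

theorem isClosed_preimage_connectedComponents (c : ConnectedComponents α) :
    IsClosed (ConnectedComponents.mk ⁻¹' {c}) := by
  obtain ⟨x, rfl⟩ := ConnectedComponents.surjective_coe c
  rw [connectedComponents_preimage_singleton]
  exact isClosed_connectedComponent

theorem isClopen_preimage_connectedComponents [Finite (ConnectedComponents α)]
    (c : ConnectedComponents α) : IsClopen (ConnectedComponents.mk ⁻¹' {c}) := by
  refine ⟨isClosed_preimage_connectedComponents c, ?_⟩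
  have : (ConnectedComponents.mk ⁻¹' {c})ᶜ =
      ⋃ d : {d // d ≠ c}, ConnectedComponents.mk ⁻¹' {d.1} := by
    ext x
    simp
  rw [← isClosed_compl_iff, this]
  exact isClosed_iUnion_of_finite fun d => isClosed_preimage_connectedComponents d.1

theorem isConnected_preimage_connectedComponents (c : ConnectedComponents α) :
    IsConnected (ConnectedComponents.mk ⁻¹' {c}) := by
  obtain ⟨x, rfl⟩ := ConnectedComponents.surjective_coe c
  rw [connectedComponents_preimage_singleton]
  exact isConnected_connectedComponent

end Topology

/-! ### Partitions of a cycle into open and closed pieces -/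

namespace Cycle

section Partition

variable {S : Scheme.{u}} {X : Sch S}

/-- The source of `C` is the disjoint union of the sources of the `E b`, embedded by `j b`, and
the cycle `E b` is isomorphic to the restriction of `C`. -/
structure IsPartition (C : Cycle X) {ι : Type v} (E : ι → Cycle X) (j : ∀ b, (E b).V ⟶ C.V) :
    Prop where
  isOpenImmersion : ∀ b, IsOpenImmersion (j b).left
  eq_of_eq : ∀ b b' x y, (j b).left x = (j b').left y → b = b'
  covers : ∀ x, ∃ b, x ∈ Set.range (j b).left
  comp_h : ∀ b, j b ≫ C.h = (E b).h
  dim_eq : ∀ b, (E b).dim = C.dim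
  bundles : ∀ b, ∃ l, l.Perm (E b).bundles ∧
    List.Forall₂ LineBundle.Iso (C.bundles.map (LineBundle.pullback (j b).left)) l

theorem forall₂_iso_map {V W : Scheme.{u}} (f : V ⟶ W) {l l' : List (LineBundle W)}
    (h : List.Forall₂ LineBundle.Iso l l') :
    List.Forall₂ LineBundle.Iso (l.map (LineBundle.pullback f)) (l'.map (LineBundle.pullback f)) :=
  List.forall₂_map_left_iff.mpr (List.forall₂_map_right_iff.mpr (h.imp fun _ _ h => h.pullback f))

variable {C : Cycle X} {ι : Type v} {E : ι → Cycle X} {j : ∀ b, (E b).V ⟶ C.V}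

theorem IsPartition.isClopen_range (h : C.IsPartition E j) (b : ι) :
    IsClopen (Set.range (j b).left) := by
  have := h.isOpenImmersion
  refine ⟨?_, (j b).left.isOpenEmbedding.isOpen_range⟩
  have : (Set.range (j b).left)ᶜ = ⋃ d : {d // d ≠ b}, Set.range (j d.1).left := by
    ext x
    rw [Set.mem_compl_iff, Set.mem_iUnion]
    constructor
    · intro hx
      obtain ⟨d, hd⟩ := h.covers x
      exact ⟨⟨d, fun e => hx (e ▸ hd)⟩, hd⟩
    · rintro ⟨⟨d, hd⟩, y, rfl⟩ ⟨z, hz⟩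
      exact hd (h.eq_of_eq _ _ _ _ hz.symm)
  rw [← isOpen_compl_iff, this]
  exact isOpen_iUnion fun d => (j d.1).left.isOpenEmbedding.isOpen_range

/-- Refinement: cutting every piece of a partition further gives a partition of the whole. -/
theorem IsPartition.restrict (h : C.IsPartition E j) {κ : ι → Type*}
    (U : ∀ b, κ b → TopologicalSpace.Clopens (E b).V.left)
    (hU : ∀ b, Pairwise (Function.onFun Disjoint (U b))) (hc : ∀ b x, ∃ c, x ∈ U b c) :
    C.IsPartition (fun p : Σ b, κ b => (E p.1).restrict (U p.1 p.2))
      (fun p => clopenι (E p.1).V (U p.1 p.2) ≫ j p.1) where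
  isOpenImmersion p := by
    have := h.isOpenImmersion p.1
    exact inferInstanceAs (IsOpenImmersion ((clopenι (E p.1).V (U p.1 p.2)).left ≫ (j p.1).left))
  eq_of_eq := by
    rintro ⟨b, c⟩ ⟨b', c'⟩ x y e
    change (j b).left ((clopenι (E b).V (U b c)).left x) =
      (j b').left ((clopenι (E b').V (U b' c')).left y) at e
    obtain rfl := h.eq_of_eq _ _ _ _ e
    have hi := (h.isOpenImmersion b)
    have e' := (j b).left.isOpenEmbedding.injective e
    congr 1
    by_contra hcc
    have hx : (clopenι (E b).V (U b c)).left x ∈ U b c :=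
      (range_clopenι (E b).V (U b c)).subset ⟨x, rfl⟩
    have hy : (clopenι (E b).V (U b c')).left y ∈ U b c' :=
      (range_clopenι (E b).V (U b c')).subset ⟨y, rfl⟩
    rw [e'] at hx
    exact Set.disjoint_left.mp (TopologicalSpace.Clopens.coe_disjoint.mpr (hU b hcc)) hx hy
  covers x := by
    obtain ⟨b, y, rfl⟩ := h.covers x
    obtain ⟨c, hc⟩ := hc b y
    obtain ⟨z, rfl⟩ := (range_clopenι (E b).V (U b c)).superset hc
    exact ⟨⟨b, c⟩, z, rfl⟩
  comp_h p := (Category.assoc _ _ _).trans (congrArg _ (h.comp_h p.1))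
  dim_eq p := h.dim_eq p.1
  bundles p := by
    obtain ⟨l, hl, hl'⟩ := h.bundles p.1
    refine ⟨l.map (LineBundle.pullback (clopenι (E p.1).V (U p.1 p.2)).left), hl.map _, ?_⟩
    have := forall₂_iso_map (clopenι (E p.1).V (U p.1 p.2)).left hl'
    rw [map_pullback_comp] at this
    exact this

/-- An isomorphism is a partition into one piece, embedded by the inverse; a single additivity
statement for partitions then covers isomorphisms and disjoint unions. -/
theorem Iso.isPartition {C D : Cycle X} (h : C.Iso D) :
    ∃ j : D.V ⟶ C.V, C.IsPartition (fun _ : PUnit.{v + 1} => D) fun _ => j := by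
  obtain ⟨hd, e, he, l, hl, hl'⟩ := h
  have hinv : e.inv.left ≫ e.hom.left = 𝟙 _ := congr($(e.inv_hom_id).left)
  have hinv' : e.hom.left ≫ e.inv.left = 𝟙 _ := congr($(e.hom_inv_id).left)
  have hi : IsIso e.inv.left := ⟨e.hom.left, hinv, hinv'⟩
  refine ⟨e.inv, fun _ => inferInstance, fun _ _ _ _ _ => rfl, fun x => ⟨⟨⟩, e.hom.left x, ?_⟩,
    fun _ => by rw [← he, e.inv_hom_id_assoc], fun _ => hd.symm,
    fun _ => ⟨l.map (LineBundle.pullback e.inv.left), ?_, forall₂_iso_map _ hl'⟩⟩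
  · exact (Scheme.Hom.comp_apply _ _ _).symm.trans congr($hinv' x)
  · have := hl.map (LineBundle.pullback e.inv.left)
    rwa [map_pullback_comp, hinv, map_pullback_id] at this

theorem Iso.refl (C : Cycle X) : C.Iso C :=
  iso_of_left (CategoryTheory.Iso.refl _) (Category.id_comp _) rfl
    ((map_pullback_id C.bundles).symm ▸ .refl _)

theorem isPartition_self (C : Cycle X) :
    ∃ j : C.V ⟶ C.V, C.IsPartition (fun _ : PUnit.{v + 1} => C) fun _ => j :=
  (Iso.refl C).isPartition

theorem IsDisjointUnion.isPartition {C C₁ C₂ : Cycle X} (h : C.IsDisjointUnion C₁ C₂) :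
    ∃ j, C.IsPartition (fun b : Bool => cond b C₁ C₂) j := by
  obtain ⟨j₁, j₂, hj, ⟨h₁, d₁, b₁⟩, ⟨h₂, d₂, b₂⟩⟩ := h
  obtain ⟨i₁, i₂, hd, hc⟩ := isOpenImmersion_of_isColimit_binaryCofan hj
  refine ⟨fun b => match b with
    | true => j₁
    | false => j₂, ?_, ?_, ?_, ?_, ?_, ?_⟩
  · rintro (_ | _)
    exacts [i₂, i₁]
  · rintro (_ | _) (_ | _) x y e
    · rfl
    · exact (Set.disjoint_left.mp hd ⟨y, rfl⟩ ⟨x, e⟩).elim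
    · exact (Set.disjoint_left.mp hd ⟨x, rfl⟩ ⟨y, e.symm⟩).elim
    · rfl
  · intro x
    rcases hc.superset (Set.mem_univ x) with hx | hx
    exacts [⟨true, hx⟩, ⟨false, hx⟩]
  · rintro (_ | _)
    exacts [h₂, h₁]
  · rintro (_ | _)
    exacts [d₂, d₁]
  · rintro (_ | _)
    exacts [⟨_, .of_eq b₂.symm, forall₂_iso_refl _⟩, ⟨_, .of_eq b₁.symm, forall₂_iso_refl _⟩]

theorem isPartition_restrict (C : Cycle X) {κ : Type v} (U : κ → TopologicalSpace.Clopens C.V.left)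
    (hU : Pairwise (Function.onFun Disjoint U)) (hc : ∀ x, ∃ c, x ∈ U c) :
    C.IsPartition (fun c => C.restrict (U c)) (fun c => clopenι C.V (U c)) where
  isOpenImmersion c := isOpenImmersion_clopenι C.V (U c)
  eq_of_eq c c' x y e := by
    by_contra hcc
    have hx : (clopenι C.V (U c)).left x ∈ U c := (range_clopenι C.V (U c)).subset ⟨x, rfl⟩
    have hy : (clopenι C.V (U c')).left y ∈ U c' := (range_clopenι C.V (U c')).subset ⟨y, rfl⟩
    change (clopenι C.V (U c)).left x = (clopenι C.V (U c')).left y at e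
    rw [e] at hx
    exact Set.disjoint_left.mp (TopologicalSpace.Clopens.coe_disjoint.mpr (hU hcc)) hx hy
  covers x := by
    obtain ⟨c, hx⟩ := hc x
    exact ⟨c, (range_clopenι C.V (U c)).superset hx⟩
  comp_h _ := rfl
  dim_eq _ := rfl
  bundles _ := ⟨_, .refl _, forall₂_iso_refl _⟩

/-- Open immersions with equal image differ by a unique isomorphism, under which the restricted
bundles correspond. -/
theorem iso_of_range_eq {C D : Cycle X} {D' : Cycle X} {j : D.V ⟶ C.V} {j' : D'.V ⟶ C.V}
    (i : IsOpenImmersion j.left) (i' : IsOpenImmersion j'.left)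
    (h : Set.range j.left = Set.range j'.left) (hj : j ≫ C.h = D.h) (hj' : j' ≫ C.h = D'.h)
    (hd : D.dim = D'.dim) (hb : D.bundles = C.bundles.map (LineBundle.pullback j.left))
    (hb' : ∃ l, l.Perm D'.bundles ∧
      List.Forall₂ LineBundle.Iso (C.bundles.map (LineBundle.pullback j'.left)) l) :
    D.Iso D' := by
  let e := IsOpenImmersion.isoOfRangeEq j.left j'.left h
  have he : e.hom ≫ j'.left = j.left := IsOpenImmersion.isoOfRangeEq_hom_fac _ _ _
  obtain ⟨l, hl, hl'⟩ := hb'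
  refine iso_of_left_of_forall₂ e ?_ hd (hl.map (LineBundle.pullback e.hom)) ?_
  · rw [← hj, ← hj', comp_left, comp_left, reassoc_of% he]
  · have := forall₂_iso_map e.hom hl'
    rwa [map_pullback_comp, he, ← hb] at this

end Partition

end Cycle

end

section

variable {k : Type u} [Field k]

/-! ## Comparison with Levine–Morel's algebraic cobordism -/

namespace LevineMorel

instance finite_connectedComponents (V : SchField k) : Finite (_root_.ConnectedComponents V.left) := by
  obtain ⟨_, h1, h2⟩ := V.prop
  have : IsLocallyNoetherian V.left :=
    LocallyOfFiniteType.isLocallyNoetherian (Y := Spec (CommRingCat.of k)) V.hom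
  have : CompactSpace V.left :=
    QuasiCompact.compactSpace_of_compactSpace (Y := Spec (CommRingCat.of k)) V.hom
  have : IsNoetherian V.left := {}
  exact finite_connectedComponents_of_noetherianSpace

instance fintypeConnectedComponents (V : SchField k) : Fintype (_root_.ConnectedComponents V.left) :=
  Fintype.ofFinite _

/-- A connected component, as an open and closed subset. -/
def componentClopen (V : SchField k) (c : _root_.ConnectedComponents V.left) :
    TopologicalSpace.Clopens V.left :=
  ⟨_root_.ConnectedComponents.mk ⁻¹' {c}, isClopen_preimage_connectedComponents c⟩

theorem pairwise_disjoint_componentClopen (V : SchField k) :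
    Pairwise (Function.onFun Disjoint (componentClopen V)) := fun c c' h =>
  TopologicalSpace.Clopens.coe_disjoint.mp
    (Set.disjoint_left.mpr fun _ (hx : _ = c) (hy : _ = c') => h (hx.symm.trans hy))

variable {X : SchField k}

/-- The restriction of a cobordism cycle to a connected component of its source. -/
def component (C : Cycle X) (c : _root_.ConnectedComponents C.V.left) : VarCycle X :=
  ⟨C.restrict (componentClopen C.V c),
    Subtype.connectedSpace (isConnected_preimage_connectedComponents c)⟩

theorem component_iso {C : Cycle X} {ι : Type v} {E : ι → VarCycle X}
    {j : ∀ b, (E b).1.V ⟶ C.V} (h : C.IsPartition (fun b => (E b).1) j) (b : ι)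
    {c : _root_.ConnectedComponents C.V.left}
    (hc : Set.range (j b).left = _root_.ConnectedComponents.mk ⁻¹' {c}) :
    (component C c).1.Iso (E b).1 :=
  Cycle.iso_of_range_eq (isOpenImmersion_clopenι C.V (componentClopen C.V c))
    (h.isOpenImmersion b) ((range_clopenι C.V (componentClopen C.V c)).trans hc.symm) rfl
    (h.comp_h b) (h.dim_eq b).symm rfl (h.bundles b)

section CompSum

variable {A : Type*} [AddCommGroup A] (f : VarCycle X → A)

/-- The sum of the values of a function on the restrictions of a cobordism cycle to the connected
components of its source. -/
def compSum (C : Cycle X) : A := ∑ c : _root_.ConnectedComponents C.V.left, f (component C c)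

variable {f} (hf : ∀ C D : VarCycle X, C.1.Iso D.1 → f C = f D)
include hf

/-- A connected piece that is open and closed is a connected component, so the pieces are in
bijection with the components. -/
theorem sum_eq_compSum {C : Cycle X} {ι : Type v} [Fintype ι] {E : ι → VarCycle X}
    {j : ∀ b, (E b).1.V ⟶ C.V} (h : C.IsPartition (fun b => (E b).1) j) :
    ∑ b, f (E b) = compSum f C := by
  have hr (b : ι) : ∃ c : _root_.ConnectedComponents C.V.left,
      Set.range (j b).left = _root_.ConnectedComponents.mk ⁻¹' {c} := by
    have := (E b).2
    obtain ⟨x⟩ := this.toNonempty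
    refine ⟨(j b).left x, ?_⟩
    rw [connectedComponents_preimage_singleton]
    refine Set.Subset.antisymm ?_ ?_
    · exact (isPreconnected_range (j b).left.continuous).subset_connectedComponent ⟨x, rfl⟩
    · exact (h.isClopen_range b).connectedComponent_subset ⟨x, rfl⟩
  choose φ hφ using hr
  refine Fintype.sum_bijective φ ⟨fun b b' e => ?_, fun c => ?_⟩ _ _ fun b =>
    (hf _ _ (component_iso h b (hφ b))).symm
  · have := (E b).2
    obtain ⟨x⟩ := this.toNonempty
    have hx : (j b).left x ∈ Set.range (j b').left := by
      rw [hφ b', ← e, ← hφ b]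
      exact ⟨x, rfl⟩
    obtain ⟨y, hy⟩ := hx
    exact h.eq_of_eq _ _ _ _ hy.symm
  · obtain ⟨x, rfl⟩ := _root_.ConnectedComponents.surjective_coe c
    obtain ⟨b, hb⟩ := h.covers x
    rw [hφ b] at hb
    exact ⟨b, hb.symm⟩

theorem compSum_eq_of_connected (C : VarCycle X) : compSum f C.1 = f C := by
  obtain ⟨j, hj⟩ := C.1.isPartition_self
  have := sum_eq_compSum hf (E := fun _ : PUnit.{1} => C) hj
  rw [← this, Fintype.sum_unique]

/-- Refine the partition by the components of its pieces. The refined pieces are connected, so the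
previous lemma applies, and the sum is regrouped by piece. -/
theorem compSum_eq_sum {C : Cycle X} {ι : Type v} [Fintype ι] {E : ι → Cycle X}
    {j : ∀ b, (E b).V ⟶ C.V} (h : C.IsPartition E j) : compSum f C = ∑ b, compSum f (E b) := by
  have h' := h.restrict (fun b => componentClopen (E b).V)
    (fun b => pairwise_disjoint_componentClopen (E b).V) fun b x => ⟨_root_.ConnectedComponents.mk x, rfl⟩
  have := sum_eq_compSum hf (E := fun p : Σ b, _root_.ConnectedComponents (E b).V.left =>
    component (E p.1) p.2) h'
  rw [← this, Fintype.sum_sigma]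
  rfl

theorem compSum_congr {C D : Cycle X} (h : C.Iso D) : compSum f C = compSum f D := by
  obtain ⟨j, hj⟩ := h.isPartition
  rw [compSum_eq_sum hf (ι := PUnit.{1}) hj, Fintype.sum_unique]

theorem compSum_disjointUnion {C C₁ C₂ : Cycle X} (h : C.IsDisjointUnion C₁ C₂) :
    compSum f C = compSum f C₁ + compSum f C₂ := by
  obtain ⟨j, hj⟩ := h.isPartition
  rw [compSum_eq_sum hf hj, Fintype.sum_bool]
  rfl

end CompSum

theorem IsComponents.isPartition {C : Cycle X} {n : ℕ} {E : Fin n → VarCycle X}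
    (h : IsComponents C E) : ∃ j, C.IsPartition (fun b => (E b).1) j := by
  obtain ⟨j, ⟨hj⟩, hr⟩ := h
  let e : (∐ fun b => (E b).1.V.left) ≅ C.V.left :=
    (coproductIsCoproduct _).coconePointUniqueUpToIso hj
  have he (b : Fin n) : Sigma.ι (fun b => (E b).1.V.left) b ≫ e.hom = (j b).left :=
    (coproductIsCoproduct _).comp_coconePointUniqueUpToIso_hom hj ⟨b⟩
  have hb : Function.Bijective e.hom := (Scheme.homeoOfIso e).bijective
  refine ⟨j, fun b => he b ▸ inferInstance, fun b b' x y hxy => ?_, fun x => ?_,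
    fun b => (hr b).1, fun b => (hr b).2.1, fun b => ⟨_, .of_eq (hr b).2.2.symm,
      forall₂_iso_refl _⟩⟩
  · rw [← he, ← he] at hxy
    have := hb.1 (((Scheme.Hom.comp_apply _ _ _).symm.trans hxy).trans (Scheme.Hom.comp_apply _ _ _))
    exact congrArg Sigma.fst ((sigmaι_eq_iff _ _ _ _ _).mp this)
  · obtain ⟨y, rfl⟩ := hb.2 x
    obtain ⟨b, z, rfl⟩ := (sigmaOpenCover fun b => (E b).1.V.left).exists_eq y
    exact ⟨b, z, congr($((he b).symm) z).trans (Scheme.Hom.comp_apply _ _ _)⟩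

theorem exists_isComponents (C : Cycle X) :
    ∃ (n : ℕ) (E : Fin n → VarCycle X), IsComponents C E := by
  let σ := (Fintype.equivFin (_root_.ConnectedComponents C.V.left)).symm
  have hi (b) : IsOpenImmersion (clopenι C.V (componentClopen C.V (σ b))).left :=
    isOpenImmersion_clopenι _ _
  refine ⟨_, fun b => component C (σ b), fun b => clopenι C.V (componentClopen C.V (σ b)),
    nonempty_isColimit_cofanMk_of (fun b => (clopenι C.V (componentClopen C.V (σ b))).left)
      ?_ ?_, fun b => ⟨rfl, rfl, rfl⟩⟩
  · refine eq_top_iff.mpr fun x _ => TopologicalSpace.Opens.mem_iSup.mpr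
      ⟨σ.symm (_root_.ConnectedComponents.mk x), ?_⟩
    refine (range_clopenι C.V (componentClopen C.V _)).superset ?_
    exact (σ.apply_symm_apply _).symm
  · intro b b' h
    refine disjoint_iff_inf_le.mpr fun x hx => ?_
    have h1 := (range_clopenι C.V (componentClopen C.V (σ b))).subset hx.1
    have h2 := (range_clopenι C.V (componentClopen C.V (σ b'))).subset hx.2
    exact (h (σ.injective ((show _ = σ b from h1).symm.trans (show _ = σ b' from h2)))).elim

end LevineMorel

end

/-! ### The mutually inverse maps between Ω^* and Levine–Morel's Ω_* -/

section

variable {k : Type u} [Field k]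

namespace LevineMorel

variable {X : SchField k}

theorem compSum_withBundles {A : Type*} [AddCommGroup A] (f : VarCycle X → A) (C : Cycle X)
    (l : List (LineBundle C.V.left)) :
    compSum f (C.withBundles l) = ∑ c : _root_.ConnectedComponents C.V.left,
      f (withBundles (component C c)
        (l.map (LineBundle.pullback (clopenι C.V (componentClopen C.V c)).left))) := rfl

/-- The disjoint union relation, applied to the finitely many components; it shows that restricting
to components and returning is the identity of Ω^*. -/
theorem cls_eq_compSum (a : LazardRing) (C : Cycle X) :
    RelCob.Omega.cls a C = compSum (fun D => RelCob.Omega.cls a D.1) C := by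
  refine .trans ?_ (RelCob.Omega.cls_restrict_sup C Finset.univ (componentClopen C.V)
    (pairwise_disjoint_componentClopen C.V) a)
  have : Finset.univ.sup (componentClopen C.V) = ⊤ := by
    refine top_le_iff.mp fun x _ => ?_
    exact Finset.le_sup (f := componentClopen C.V) (Finset.mem_univ (ConnectedComponents.mk x)) rfl
  rw [this]
  exact (RelCob.Omega.cls_congr C.restrict_top_iso a).symm

theorem cls_eq_sum_of_isComponents {C : Cycle X} {n : ℕ} {E : Fin n → VarCycle X}
    (h : IsComponents C E) (a : LazardRing) :
    RelCob.Omega.cls a C = ∑ b, RelCob.Omega.cls a (E b).1 := by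
  obtain ⟨j, hj⟩ := h.isPartition
  rw [cls_eq_compSum, ← sum_eq_compSum (fun _ _ h => RelCob.Omega.cls_congr h a) hj]

/-- Levine–Morel's relation requires a connected source. Restrict the section to each component of
`C`; the zero schemes obtained partition that of `D`, and each of them is replaced by the sum of its
own components. -/
theorem compSum_of_isSectPair {C D : Cycle X} (h : C.IsSectPair D) (a : LazardRing) :
    compSum (Omega.cls a) C = compSum (Omega.cls a) D := by
  obtain ⟨i, hi⟩ := Cycle.exists_isSectPair_restrict h
  have hf : ∀ C D : VarCycle X, C.1.Iso D.1 → Omega.cls a C = Omega.cls a D :=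
    fun _ _ h => Omega.cls_congr h a
  have hD := D.isPartition_restrict (fun c => clopensPreimage i.left (componentClopen C.V c))
    (fun c c' hc => TopologicalSpace.Clopens.coe_disjoint.mp
      ((TopologicalSpace.Clopens.coe_disjoint.mpr
        (pairwise_disjoint_componentClopen C.V hc)).preimage i.left))
    fun x => ⟨ConnectedComponents.mk (i.left x), rfl⟩
  rw [compSum_eq_sum hf hD]
  refine Finset.sum_congr rfl fun c _ => ?_
  obtain ⟨n, E, hE⟩ := exists_isComponents
    (D.restrict (clopensPreimage i.left (componentClopen C.V c)))
  obtain ⟨j, hj⟩ := hE.isPartition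
  rw [← sum_eq_compSum hf hj]
  exact Omega.cls_of_isSectPair (C := component C c) (hi (componentClopen C.V c)) hE a

theorem respects_compSum :
    RelCob.Omega.Respects (X := X) fun C => RelCob.Omega.smulHom (compSum (Omega.cls 1) C) := by
  have hf : ∀ C D : VarCycle X, C.1.Iso D.1 → Omega.cls 1 C = Omega.cls 1 D :=
    fun _ _ h => Omega.cls_congr h 1
  refine RelCob.Omega.Respects.of_module (fun _ _ => compSum_congr hf)
    (fun _ _ _ => compSum_disjointUnion hf) ?_ (fun _ _ h => compSum_of_isSectPair h 1) ?_
  · intro C h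
    exact Finset.sum_eq_zero fun c _ => Omega.cls_of_isDimCycle (h.restrict _) 1
  · intro C Ls L M
    simp only [compSum_withBundles, Finset.smul_sum, List.map_append, List.map_replicate,
      List.map_singleton, Omega.smul_cls]
    -- The sum over components is moved outermost. Restriction preserves `dim`, so each component
    -- carries its own formal group law with the same range.
    rw [Finset.sum_congr rfl fun i _ => Finset.sum_comm, Finset.sum_comm]
    refine Finset.sum_congr rfl fun c _ => ?_
    let i : (component C c).1.V.left ⟶ C.V.left := (clopenι C.V (componentClopen C.V c)).left
    have := Omega.cls_fgl (component C c) (Ls.map (LineBundle.pullback i)) (L.pullback i)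
      (M.pullback i) 1
    simp only [one_mul] at this
    simp only [mul_one]
    exact this.trans (congrArg (fun N => Omega.cls 1
      (withBundles (component C c) (Ls.map (LineBundle.pullback i) ++ [N])))
      (L.pullback_tensor M i).symm)

/-- The homomorphism to Levine–Morel's algebraic cobordism which restricts a cobordism cycle to
the connected components of its source. -/
def toLevineMorel (X : SchField k) : RelCob.Omega X →ₗ[LazardRing] Omega X :=
  RelCob.Omega.liftModule respects_compSum

theorem toLevineMorel_cls (a : LazardRing) (C : Cycle X) :
    toLevineMorel X (RelCob.Omega.cls a C) = compSum (Omega.cls a) C := by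
  refine (RelCob.Omega.liftModule_cls respects_compSum a C).trans ?_
  rw [compSum, Finset.smul_sum]
  simp only [Omega.smul_cls, mul_one]
  rfl

/-- The homomorphism from Levine–Morel's algebraic cobordism which is the identity on cobordism
cycles. -/
def ofLevineMorel (X : SchField k) : Omega X →ₗ[LazardRing] RelCob.Omega X :=
  Omega.liftModule (ψ := fun C => RelCob.Omega.cls 1 C.1)
    (fun _ _ h => RelCob.Omega.cls_congr h 1)
    (fun _ h => RelCob.Omega.cls_of_isDimCycle h 1)
    (fun _ _ _ _ h hE =>
      (RelCob.Omega.cls_of_isSectPair h 1).trans (cls_eq_sum_of_isComponents hE 1))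
    (fun C Ls L M => by
      refine .trans ?_ (RelCob.Omega.cls_fgl C.1 Ls L M 1)
      simp only [RelCob.Omega.smul_cls, mul_one, one_mul]
      rfl)

theorem ofLevineMorel_cls (a : LazardRing) (C : VarCycle X) :
    ofLevineMorel X (Omega.cls a C) = RelCob.Omega.cls a C.1 := by
  refine (Omega.liftModule_cls _ _ _ _ a C).trans ?_
  rw [RelCob.Omega.smul_cls, mul_one]

/-- The isomorphism with Levine–Morel's algebraic cobordism. -/
def levineMorelEquiv (X : SchField k) : RelCob.Omega X ≃ₗ[LazardRing] Omega X :=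
  LinearEquiv.ofLinearMap (toLevineMorel X) (ofLevineMorel X)
    -- A connected source has itself as its only component.
    (Omega.linearMap_ext fun C => by
      rw [LinearMap.comp_apply, ofLevineMorel_cls, toLevineMorel_cls,
        compSum_eq_of_connected (fun _ _ h => Omega.cls_congr h 1), LinearMap.id_apply])
    (LinearMap.toAddMonoidHom_injective (RelCob.Omega.addHom_ext fun a C => by
      refine (congrArg (ofLevineMorel X) (toLevineMorel_cls a C)).trans ?_
      refine .trans ?_ (cls_eq_compSum a C).symm
      rw [compSum, map_sum]
      exact Finset.sum_congr rfl fun c _ => ofLevineMorel_cls a _))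

theorem levineMorelEquiv_cls_of_isComponents {C : Cycle X} {n : ℕ} {E : Fin n → VarCycle X}
    (h : IsComponents C E) (a : LazardRing) :
    levineMorelEquiv X (RelCob.Omega.cls a C) = ∑ b, Omega.cls a (E b) := by
  obtain ⟨j, hj⟩ := h.isPartition
  rw [sum_eq_compSum (fun _ _ h => Omega.cls_congr h a) hj]
  exact toLevineMorel_cls a C

/-- Both mutually inverse maps preserve degree on generators, as components keep the dimension and
the number of bundles; only the sign convention differs. -/
theorem mem_gr_iff_levineMorelEquiv (n : ℤ) (x : RelCob.Omega X) :
    x ∈ RelCob.Omega.gr X (-n) ↔ levineMorelEquiv X x ∈ Omega.gr X n := by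
  constructor
  · refine RelCob.Omega.map_mem_of_cls (toLevineMorel X).toAddMonoidHom fun m a C ha hn => ?_
    refine (toLevineMorel_cls a C).symm ▸ AddSubgroup.sum_mem _ fun c _ => ?_
    refine Omega.cls_mem ha (component C c) ?_
    have : (component C c).1.bundles.length = C.bundles.length := List.length_map _
    rw [this]
    change n = m + C.dim - _
    omega
  · intro h
    have := Omega.map_mem_of_cls (B := RelCob.Omega.gr X (-n)) (ofLevineMorel X).toAddMonoidHom
      (fun m a C ha hn => by
        refine (ofLevineMorel_cls a C).symm ▸ RelCob.Omega.cls_mem ha C.1 ?_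
        omega) h
    exact (levineMorelEquiv X).symm_apply_apply x ▸ this

end LevineMorel

end

end

end RelCob

/-! ### The two parts of the theorem -/

theorem mainTheorem1 :
    (∀ S : Scheme.{u}, ∃ (B : RelCob.OrientedBMFunctor (fun X : RelCob.Sch S => RelCob.Omega X))
      (Φ : RelCob.LazardRing →+ RelCob.Omega (RelCob.base S)),
      RelCob.IsInducedByCycles B ∧
        (∀ a, Φ a = RelCob.Omega.cls a (RelCob.Cycle.unit S)) ∧
        B.IsGeometricType Φ) ∧
    (∀ (k : Type u) [Field k] (X : RelCob.Sch (Spec (CommRingCat.of k))),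
      ∃ e : RelCob.Omega X ≃ₗ[RelCob.LazardRing] RelCob.LevineMorel.Omega X,
        (∀ (a : RelCob.LazardRing) (C : RelCob.Cycle X) (n : ℕ)
          (E : Fin n → RelCob.LevineMorel.VarCycle X), RelCob.LevineMorel.IsComponents C E →
            e (RelCob.Omega.cls a C) = ∑ b, RelCob.LevineMorel.Omega.cls a (E b)) ∧
        ∀ (n : ℤ) (x : RelCob.Omega X),
          x ∈ RelCob.Omega.gr X (-n) ↔ e x ∈ RelCob.LevineMorel.Omega.gr X n) := by
  refine ⟨fun S => ⟨RelCob.omegaFunctor S, RelCob.Omega.clsHom (RelCob.Cycle.unit S),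
    RelCob.isInducedByCycles_omegaFunctor S, fun _ => rfl,
    RelCob.isGeometricType_omegaFunctor S⟩, fun k _ X => ⟨RelCob.LevineMorel.levineMorelEquiv X,
    fun a _ _ _ h => RelCob.LevineMorel.levineMorelEquiv_cls_of_isComponents h a,
    RelCob.LevineMorel.mem_gr_iff_levineMorelEquiv⟩⟩
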